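/- **Notation.** Let $(q)_n=\prod_{i=1}^n(1-q^i)$, $(q)_\infty=\prod_{i\ge1}(1-q^i)$, and let $\left[{P\atop N}\right]=\frac{(q)_P}{(q)_N(q)_{P-N}}$ if $P\ge N\ge0$ and $0$ otherwise. All identities are between formal power series in $q$ with integer coefficients, and limits are coefficientwise. For non-negative integers $N,M,a,b,\alpha,\beta$ with $a+b>0$ and $\alpha+\beta>0$, let $R(N,M,a,b,\alpha,\beta)=\sum q^{\sum_i \mathsf q_i+\sum_i \mathsf p_i}$, the sum being over all pairs of integer sequences $0\le \mathsf q_1\le\dots\le \mathsf q_N\le M$, $0\le \mathsf p_1\le\dots\le \mathsf p_N\le M$ such that $\mathsf p_i-\mathsf q_{i+1-a}\ge1-\alpha$ for $\max\{1,a\}\le i\le\min\{N,N+a-1\}$, and $\mathsf q_i-\mathsf p_{i+1-b}\ge1-\beta$ for $\max\{1,b\}\le i\le\min\{N,N+b-1\}$; if $a=0$, also $\mathsf q_1\le\alpha-1$ and $\mathsf p_N\ge M-\alpha+1$; if $b=0$, also $\mathsf p_1\le\beta-1$ and $\mathsf q_N\ge M-\beta+1$. (If $N=0$, read $\mathsf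 q_0=\mathsf p_0=0$ and $\mathsf q_1=\mathsf p_1=M$ here.) For positive coprime integers $s,r$, or $(s,r)=(1,0)$, the continued fraction of $(s:r)$ is $()$ for $(1:0)$, and otherwise it is $(c_1,\dots,c_n)$ where $c_1$ is the largest integer with $c_1r\le s$ and $(c_2,\dots,c_n)$ is the continued fraction of $(r:s-c_1r)$. For $n>1$, $(c_1,\dots,c_{n-1},1)$ is identified with $(c_1,\dots,c_{n-1}+1)$. **Theorem.** Let $0<p<p'$ be coprime integers and let $(p':p)$ have continued fraction $(c_1,\dots,c_{t-1},c_t+2)$ with $t\ge1$ and all $c_k\ge0$. Let $1\le u\le t$ and $1\le d\le c_u$, and let $r,s$ be such that $(c_1,\dots,c_{u-1},d)$ is the continued fraction of $(s:r)$. Put $(f_1,\dots,f_{t+1})=(c_1,\dots,c_{u-1},d,c_u-d,c_{u+1},\dots,c_t)$. Consider the sequences $n^{(1)},\dots,n^{(x)}$ with $u\le x\le t+1$, where each $n^{(k)}=(n_{k,1},\dots,n_{k,f_k})$ is a sequence of integers with $n_{k,0}\ge n_{k,1}\ge\dots\ge n_{k,f_k}\ge0$, whose weight $\mathrm{wt}(n^{(k)})=\sum_{i=1}^{f_k}n_{k,i}$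 satisfies $\mathrm{wt}(n^{(k)})\le w_k$ for all $k$ and $\mathrm{wt}(n^{(x)})=w_x$; moreover $\mathrm{wt}(n^{(u)})<w_u$ if $u<x$; $n_{k,f_k}>0$ if $u<k<x$; and $n_{x,f_x}=0$ if $x<t+1$. Here (with $\infty\pm m=\infty$ for integers $m$) $$w_1=\infty,\quad w_k=n_{k-1,f_{k-1}}\ (2\le k\le u),\quad w_{u+1}=w_u-1-\mathrm{wt}(n^{(u)}),\quad w_k=n_{k-1,f_{k-1}}-1\ (u+2\le k\le x),$$ $$n_{1,0}=\infty,\quad n_{k,0}=w_{k-1}-\mathrm{wt}(n^{(k-1)})\ (2\le k\le u),\quad n_{u+1,0}=n_{u,f_u}+1,\quad n_{k,0}=w_{k-1}+1-\mathrm{wt}(n^{(k-1)})\ (u+2\le k\le x).$$ For such a sequence let $$E=n_{u,d}+\sum_{k=1}^u\sum_{i=1}^{f_k}n_{k,i}^2+\sum_{k=u+1}^x\sum_{i=1}^{f_k}n_{k,i}(n_{k,i}-1),\qquad G_{k,i}=\left[{2\left(w_k-\sum_{j=1}^in_{k,j}\right)+n_{k,i-1}+n_{k,i}\atop n_{k,i-1}-n_{k,i}}\right].$$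 Then, if $u>1$, $$\lim_{M,N\to\infty}R(N,M,r,p-r,s,p'-s)=\frac1{(q)_\infty}\sum q^{E}\,\frac1{(q)_{2n_{1,f_1}}}\prod_{i=2}^{f_1}\frac1{(q)_{n_{1,i-1}-n_{1,i}}}\prod_{k=2}^x\ \prod_{i=1+\delta_{2,k}}^{f_k}G_{k,i},$$ and if $u=1$, $$\lim_{M,N\to\infty}R(N,M,r,p-r,s,p'-s)=\frac1{(q)_\infty}\sum q^{E}\,\frac1{(q)_{2(n_{2,f_2}-1)}}\prod_{i=2}^{f_1}\frac1{(q)_{n_{1,i-1}-n_{1,i}}}\prod_{i=1}^{f_2}\frac1{(q)_{n_{2,i-1}-n_{2,i}}}\prod_{k=3}^x\ \prod_{i=1+\delta_{3,k}}^{f_k}G_{k,i},$$ where the sums are over all sequences described above and converge. The limit may be taken jointly, or with $M\to\infty$ first and then $N\to\infty$, or with $N\to\infty$ first and then $M\to\infty$: all these limits exist and agree. -/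

import Mathlib

open Filter Topology PowerSeries
open scoped PowerSeries.WithPiTopology

namespace Burge

/-! ### `q`-shifted factorials and Gaussian polynomials -/

/-- `(q)_n = (1 - q)(1 - q ^ 2) ⋯ (1 - q ^ n)`, as a power series in `q = X`. -/
noncomputable def qFac (n : ℕ) : ℤ⟦X⟧ :=
  ∏ i ∈ Finset.range n, (1 - (X : ℤ⟦X⟧) ^ (i + 1))

/-- `(q)_∞ = ∏_{n ≥ 1} (1 - q ^ n)`, for the topology of coefficientwise convergence. -/
noncomputable def qFacInf : ℤ⟦X⟧ :=
  ∏' i : ℕ, (1 - (X : ℤ⟦X⟧) ^ (i + 1))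

theorem hasProd_qFacInf :
    HasProd (fun i : ℕ => 1 - (X : ℤ⟦X⟧) ^ (i + 1)) qFacInf :=
  (PowerSeries.WithPiTopology.multipliable_one_sub_X_pow ℤ).hasProd

/-- `1 / (q)_n`. -/
noncomputable def qFacInv (n : ℕ) : ℤ⟦X⟧ := PowerSeries.invOfUnit (qFac n) 1

/-- `1 / (q)_∞`. -/
noncomputable def qFacInfInv : ℤ⟦X⟧ := PowerSeries.invOfUnit qFacInf 1

theorem constantCoeff_qFac (n : ℕ) : constantCoeff (qFac n) = 1 := by
  simp [qFac, map_prod]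

theorem tendsto_qFac : Tendsto qFac atTop (𝓝 qFacInf) :=
  hasProd_qFacInf.tendsto_prod_nat

theorem constantCoeff_qFacInf : constantCoeff qFacInf = 1 := by
  have h := ((PowerSeries.WithPiTopology.continuous_constantCoeff ℤ).tendsto qFacInf).comp
    tendsto_qFac
  refine tendsto_nhds_unique h ?_
  have h' : (⇑(constantCoeff (R := ℤ)) ∘ qFac) = fun _ => (1 : ℤ) :=
    funext fun n => constantCoeff_qFac n
  rw [h']
  exact tendsto_const_nhds

theorem qFac_mul_qFacInv (n : ℕ) : qFac n * qFacInv n = 1 :=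
  PowerSeries.mul_invOfUnit _ _ (by simp [constantCoeff_qFac])

theorem qFacInf_mul_qFacInfInv : qFacInf * qFacInfInv = 1 :=
  PowerSeries.mul_invOfUnit _ _ (by simp [constantCoeff_qFacInf])

/-- The Gaussian polynomial `[P; N] = (q)_P / ((q)_N (q)_{P-N})` if `N ≤ P`, and `0` otherwise. -/
noncomputable def gauss (P N : ℕ) : ℤ⟦X⟧ :=
  if N ≤ P then qFac P * qFacInv N * qFacInv (P - N) else 0

/-! ### Restricted partition pairs -/

/-- A partition in the box `(N, M)` is a sequence `0 ≤ p_1 ≤ p_2 ≤ ⋯ ≤ p_N ≤ M`; the part `p_i`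
(with `1 ≤ i ≤ N`) is `p ⟨i - 1, _⟩`. -/
def IsPartition {N M : ℕ} (p : Fin N → Fin (M + 1)) : Prop := Monotone p

/-- The sum of the parts. -/
def wt {N M : ℕ} (p : Fin N → Fin (M + 1)) : ℕ := ∑ i, (p i : ℕ)

/-- The part `p_i` for `1 ≤ i ≤ N`, extended by `p_0 = 0` and by `p_i = M` for `i > N`. -/
def boxPart {N M : ℕ} (p : Fin N → Fin (M + 1)) (i : ℕ) : ℕ :=
  if i = 0 then 0 else if h : i - 1 < N then (p ⟨i - 1, h⟩ : ℕ) else M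

/-- The pair `(q, p)` in `(N₁, M₁) × (N₂, M₂)` is restricted:
* `p_i - q_{i+1-a} ≥ 1 - α` for `max {1, a} ≤ i ≤ min {N₂, N₁ + a - 1}`;
* `q_i - p_{i+1-b} ≥ 1 - β` for `max {1, b} ≤ i ≤ min {N₁, N₂ + b - 1}`;
* if `a = 0` then `q_1 ≤ α - 1`, and if `b = 0` then `p_1 ≤ β - 1`;
* if `a = N₂ - N₁` then `p_{N₂} ≥ M₁ - α + 1`, and if `b = N₁ - N₂` then `q_{N₁} ≥ M₂ - β + 1`.
All inequalities are written without subtraction. -/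
structure IsRestricted {N₁ M₁ N₂ M₂ : ℕ} (a b α β : ℕ)
    (q : Fin N₁ → Fin (M₁ + 1)) (p : Fin N₂ → Fin (M₂ + 1)) : Prop where
  ineq_a : ∀ i, 1 ≤ i → a ≤ i → i ≤ N₂ → i + 1 ≤ N₁ + a →
    boxPart q (i + 1 - a) + 1 ≤ boxPart p i + α
  ineq_b : ∀ i, 1 ≤ i → b ≤ i → i ≤ N₁ → i + 1 ≤ N₂ + b →
    boxPart p (i + 1 - b) + 1 ≤ boxPart q i + β
  low_a : a = 0 → boxPart q 1 + 1 ≤ α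
  low_b : b = 0 → boxPart p 1 + 1 ≤ β
  high_a : N₁ + a = N₂ → M₁ + 1 ≤ boxPart p N₂ + α
  high_b : N₂ + b = N₁ → M₂ + 1 ≤ boxPart q N₁ + β

open scoped Classical in
/-- The generating function `R(N₁, M₁, N₂, M₂, a, b, α, β)`: the sum of `q ^ (wt q + wt p)` over
all restricted pairs `(q, p)` of partitions in `(N₁, M₁) × (N₂, M₂)`. -/
noncomputable def genFun (N₁ M₁ N₂ M₂ a b α β : ℕ) : Polynomial ℤ :=
  ∑ z : (Fin N₁ → Fin (M₁ + 1)) × (Fin N₂ → Fin (M₂ + 1)) with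
      IsPartition z.1 ∧ IsPartition z.2 ∧ IsRestricted a b α β z.1 z.2,
    Polynomial.X ^ (wt z.1 + wt z.2)

/-- `R(N, M, a, b, α, β) = R(N, M, N, M, a, b, α, β)`. -/
noncomputable def R (N M a b α β : ℕ) : Polynomial ℤ := genFun N M N M a b α β

/-! ### Continued fractions -/

/-- The continued fraction of the pair `(s : r)`: the empty list for `r = 0`; otherwise `c_1` is
the largest integer with `c_1 r ≤ s`, followed by the continued fraction of `(r : s - c_1 r)`. -/
def contFrac (s r : ℕ) : List ℕ :=
  if _h : r = 0 then [] else (s / r) :: contFrac r (s % r)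
termination_by r
decreasing_by exact Nat.mod_lt _ (Nat.pos_of_ne_zero _h)

/-- `l` is a continued fraction of the pair `(s : r)`, where `s` and `r` are positive and coprime
or `(s : r) = (1 : 0)`. Here `(c_1, …, c_{n-1}, 1)` with `n > 1` is equated with
`(c_1, …, c_{n-1} + 1)`. -/
def IsContFrac (l : List ℕ) (s r : ℕ) : Prop :=
  0 < s ∧ Nat.Coprime s r ∧
    (l = contFrac s r ∨ ∃ (l' : List ℕ) (c : ℕ), l = l' ++ [c, 1] ∧ contFrac s r = l' ++ [c + 1])

/-! ### The sequences of partitions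

The sequence `(c_1, …, c_t)` is given by a function `c : ℕ → ℕ`, of which only the values at
`1, …, t` are used. A sequence of partitions `n^{(1)}, …, n^{(x)}` is given by a list `ν` of lists;
the parts of each partition are listed in non-increasing order. -/

/-- `(f_1, …, f_{t+1}) = (c_1, …, c_{u-1}, d, c_u - d, c_{u+1}, …, c_t)`. -/
def fSeq (c : ℕ → ℕ) (u d k : ℕ) : ℕ :=
  if k < u then c k else if k = u then d else if k = u + 1 then c u - d else c (k - 1)

/-- The partition `n^{(k)}`, for `1 ≤ k ≤ x`. -/
def nth (ν : List (List ℕ)) (k : ℕ) : List ℕ := ν.getD (k - 1) []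

/-- The part `n_{k,i}`, for `1 ≤ k ≤ x` and `1 ≤ i ≤ f_k`. -/
def part (ν : List (List ℕ)) (k i : ℕ) : ℕ := (nth ν k).getD (i - 1) 0

/-- The pair `(w_k, n_{k,0})` for `k ≥ 1`; the value at `0` is not used. Subtraction in `ℕ∞`
satisfies `⊤ - m = ⊤` for `m : ℕ`, and it is never truncated for admissible sequences. -/
def bounds (c : ℕ → ℕ) (u d : ℕ) (ν : List (List ℕ)) : ℕ → ℕ∞ × ℕ∞
  | 0 => (⊤, ⊤)
  | 1 => (⊤, ⊤)
  | k + 2 =>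
    let w : ℕ∞ := (bounds c u d ν (k + 1)).1
    let n₀ : ℕ∞ := (bounds c u d ν (k + 1)).2
    let W : ℕ∞ := ((nth ν (k + 1)).sum : ℕ)
    let last : ℕ∞ :=
      if fSeq c u d (k + 1) = 0 then n₀ else (part ν (k + 1) (fSeq c u d (k + 1)) : ℕ)
    if k + 2 ≤ u then (last, w - W)
    else if k + 2 = u + 1 then (w - 1 - W, last + 1)
    else (last - 1, w + 1 - W)

/-- `w_k`. -/
def w (c : ℕ → ℕ) (u d : ℕ) (ν : List (List ℕ)) (k : ℕ) : ℕ∞ := (bounds c u d ν k).1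

/-- `n_{k,i}` for `0 ≤ i ≤ f_k`, including the bound `n_{k,0}`. -/
def n (c : ℕ → ℕ) (u d : ℕ) (ν : List (List ℕ)) (k i : ℕ) : ℕ∞ :=
  if i = 0 then (bounds c u d ν k).2 else (part ν k i : ℕ)

/-- The sequences `n^{(1)}, …, n^{(x)}` over which the sum is taken (`x` is the length of `ν`). -/
structure Admissible (t : ℕ) (c : ℕ → ℕ) (u d : ℕ) (ν : List (List ℕ)) : Prop where
  le_x : u ≤ ν.length
  x_le : ν.length ≤ t + 1
  /-- `n^{(k)}` has `f_k` parts. -/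
  length_eq : ∀ k, 1 ≤ k → k ≤ ν.length → (nth ν k).length = fSeq c u d k
  /-- The parts of `n^{(k)}` are non-increasing. -/
  sorted : ∀ k, 1 ≤ k → k ≤ ν.length → (nth ν k).Pairwise (· ≥ ·)
  /-- The parts of `n^{(k)}` are at most `n_{k,0}`. -/
  le_bound : ∀ k, 1 ≤ k → k ≤ ν.length → ∀ a ∈ nth ν k, (a : ℕ∞) ≤ n c u d ν k 0
  wt_le : ∀ k, 1 ≤ k → k ≤ ν.length → (((nth ν k).sum : ℕ) : ℕ∞) ≤ w c u d ν k
  wt_last : (((nth ν ν.length).sum : ℕ) : ℕ∞) = w c u d ν ν.length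
  wt_lt : u < ν.length → (((nth ν u).sum : ℕ) : ℕ∞) < w c u d ν u
  pos : ∀ k, u < k → k < ν.length → 0 < n c u d ν k (fSeq c u d k)
  last_eq_zero : ν.length < t + 1 → n c u d ν ν.length (fSeq c u d ν.length) = 0

/-! ### The summands -/

/-- `n_{u,d} + ∑_{k=1}^u ∑_i n_{k,i}^2 + ∑_{k=u+1}^x ∑_i n_{k,i} (n_{k,i} - 1)`. -/
def expo (c : ℕ → ℕ) (u d : ℕ) (ν : List (List ℕ)) : ℕ :=
  part ν u d
    + ∑ k ∈ Finset.Icc 1 u, ∑ i ∈ Finset.Icc 1 (fSeq c u d k), part ν k i ^ 2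
    + ∑ k ∈ Finset.Icc (u + 1) ν.length, ∑ i ∈ Finset.Icc 1 (fSeq c u d k),
        part ν k i * (part ν k i - 1)

/-- `1 / (q)_{n_{k,i-1} - n_{k,i}}`, used only when `n_{k,i-1}` is finite. -/
noncomputable def diffFactor (c : ℕ → ℕ) (u d : ℕ) (ν : List (List ℕ)) (k i : ℕ) : ℤ⟦X⟧ :=
  qFacInv (n c u d ν k (i - 1) - n c u d ν k i).toNat

/-- The Gaussian polynomial
`[2 (w_k - ∑_{j=1}^i n_{k,j}) + n_{k,i-1} + n_{k,i}; n_{k,i-1} - n_{k,i}]`,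
used only when `w_k` and `n_{k,i-1}` are finite. -/
noncomputable def gaussFactor (c : ℕ → ℕ) (u d : ℕ) (ν : List (List ℕ)) (k i : ℕ) : ℤ⟦X⟧ :=
  gauss
    (2 * (w c u d ν k - ((∑ j ∈ Finset.Icc 1 i, part ν k j : ℕ) : ℕ∞))
      + n c u d ν k (i - 1) + n c u d ν k i).toNat
    (n c u d ν k (i - 1) - n c u d ν k i).toNat

/-- The summand in the case `u > 1`. -/
noncomputable def termGt (c : ℕ → ℕ) (u d : ℕ) (ν : List (List ℕ)) : ℤ⟦X⟧ :=
  X ^ expo c u d ν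
    * qFacInv (2 * n c u d ν 1 (fSeq c u d 1)).toNat
    * (∏ i ∈ Finset.Icc 2 (fSeq c u d 1), diffFactor c u d ν 1 i)
    * ∏ k ∈ Finset.Icc 2 ν.length,
        ∏ i ∈ Finset.Icc (1 + if k = 2 then 1 else 0) (fSeq c u d k), gaussFactor c u d ν k i

/-- The summand in the case `u = 1`. -/
noncomputable def termOne (c : ℕ → ℕ) (d : ℕ) (ν : List (List ℕ)) : ℤ⟦X⟧ :=
  X ^ expo c 1 d ν
    * qFacInv (2 * (n c 1 d ν 2 (fSeq c 1 d 2) - 1)).toNat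
    * (∏ i ∈ Finset.Icc 2 (fSeq c 1 d 1), diffFactor c 1 d ν 1 i)
    * (∏ i ∈ Finset.Icc 1 (fSeq c 1 d 2), diffFactor c 1 d ν 2 i)
    * ∏ k ∈ Finset.Icc 3 ν.length,
        ∏ i ∈ Finset.Icc (1 + if k = 3 then 1 else 0) (fSeq c 1 d k), gaussFactor c 1 d ν k i

/-! ### Double limits -/

/-- `F N M` tends to `L`, coefficientwise, as `N, M → ∞` jointly, and also as `M → ∞` first and
then `N → ∞`, and as `N → ∞` first and then `M → ∞` (all inner limits exist). -/
structure HasDoubleLimit (F : ℕ → ℕ → ℤ⟦X⟧) (L : ℤ⟦X⟧) : Prop where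
  joint : Tendsto (fun z : ℕ × ℕ => F z.1 z.2) atTop (𝓝 L)
  first_M : ∃ A : ℕ → ℤ⟦X⟧,
    (∀ N, Tendsto (fun M => F N M) atTop (𝓝 (A N))) ∧ Tendsto A atTop (𝓝 L)
  first_N : ∃ B : ℕ → ℤ⟦X⟧,
    (∀ M, Tendsto (fun N => F N M) atTop (𝓝 (B M))) ∧ Tendsto B atTop (𝓝 L)

end Burge

namespace Burge

/-! ### Gaussian polynomials -/

/-! A restricted pair is a pair of lattice paths, each kept strictly on one side of a translate of
the other. Its generating function satisfies a recursion in the endpoints of the paths. An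
alternating sum of products of two Gaussian polynomials obeys the same recursion, with the same
zeros and initial values, so the two agree (`pairSumEqBoson`). The exponents of this sum may be
negative term by term, hence the work in the fraction field `QField`.

In equal boxes the alternating sum exhibits two relations. Exchanging the coordinates swaps `(N, a,
b)` with `(M, α, β)` (`pairR_transpose`). The q-Pfaff–Saalschütz sum, applied term by term,
expresses the function for `(a, b, α + a, β + b)` as a sum over `n` of `q ^ (n * n)` times a
Gaussian polynomial times the function for `(a, b, α, β)` in the box `(n, M - n)` (`pairR_burge`). A
third relation is combinatorial: for `a = 1`, `α = 0` one part is forced and can be removed, which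
leads to `a = α = 1` (`pairR_one_zero`).

Undoing the Burge transform subtracts `(a, b)` from `(α, β)`, and transposition exchanges the two;
together they run the Euclidean algorithm on `(s : r)` and `(p' : p)` simultaneously. The two
continued fractions share `c_1, …, c_{u-1}`, and after `d` further steps the first one ends at `a =
1`, `α = 0`. There a part is removed, and the algorithm continues with the remaining quotients `c_u
- d, c_{u+1}, …`, now removing a part after each step, which turns `n ^ 2` into `n (n - 1)`
(`shiftR_eq_sum`). The summation indices of one block of equal steps form the partition `n^{(k)}`;
the process stops at a Kronecker delta, which is the condition on the weight of the last partition.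
This gives an exact formula for finite `N` and `M` (`pairR_eq_sum`).

Every summand extends continuously to `ℕ∞ × ℕ∞`, and modulo each power of `q` only finitely many
summands matter, uniformly in the point. So the sum is continuous, and all the limits are its value
at `(⊤, ⊤)` (`exists_continuous_hasSum`, `hasDoubleLimit_of_continuous`). At that point the Gaussian
polynomials with an infinite entry degenerate to reciprocals of `(q)_m` (`seqTerm_eq_termGt`,
`seqTerm_eq_termOne`). -/

theorem qFac_zero : qFac 0 = 1 := by simp [qFac]

theorem qFac_succ (n : ℕ) : qFac (n + 1) = qFac n * (1 - (X : ℤ⟦X⟧) ^ (n + 1)) := by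
  simp [qFac, Finset.prod_range_succ]

theorem qFacInv_zero : qFacInv 0 = 1 := by
  have := qFac_mul_qFacInv 0
  rwa [qFac_zero, one_mul] at this

theorem qFac_ne_zero (n : ℕ) : qFac n ≠ 0 := by
  intro h
  have := constantCoeff_qFac n
  simp [h] at this

theorem gauss_of_lt {P N : ℕ} (h : P < N) : gauss P N = 0 := by
  simp [gauss, h]

theorem gauss_add (n m : ℕ) : gauss (n + m) n = qFac (n + m) * qFacInv n * qFacInv m := by
  simp [gauss]

theorem qFac_mul_qFac_mul_gauss (n m : ℕ) :
    qFac n * qFac m * gauss (n + m) n = qFac (n + m) := by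
  rw [gauss_add]
  linear_combination (qFac (n + m) * qFac m * qFacInv m) * qFac_mul_qFacInv n
    + qFac (n + m) * qFac_mul_qFacInv m

theorem gauss_symm (n m : ℕ) : gauss (n + m) n = gauss (n + m) m := by
  rw [gauss_add, add_comm n m, gauss_add]; ring

theorem gauss_zero_right (P : ℕ) : gauss P 0 = 1 := by
  simp [gauss, qFacInv_zero, qFac_mul_qFacInv]

theorem gauss_self (P : ℕ) : gauss P P = 1 := by
  simp [gauss, qFacInv_zero, qFac_mul_qFacInv]

/-- The q-Pascal rule: after clearing denominators it is `1 - q^{x+y} = (1 - q^x) + q^x (1 - q^y)`.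
The truncation in `P - N` is harmless because `gauss P N` is then zero. -/
theorem gauss_succ_succ (P N : ℕ) :
    gauss (P + 1) (N + 1) = gauss P (N + 1) + X ^ (P - N) * gauss P N := by
  rcases lt_trichotomy P N with h | rfl | h
  · simp [gauss_of_lt, h, Nat.lt_succ_of_lt h]
  · simp [gauss_self, gauss_of_lt]
  · obtain ⟨m, rfl⟩ := Nat.exists_eq_add_of_lt h
    have e1 := qFac_mul_qFac_mul_gauss (N + 1) (m + 1)
    have e2 := qFac_mul_qFac_mul_gauss (N + 1) m
    have e3 := qFac_mul_qFac_mul_gauss N (m + 1)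
    rw [show N + m + 1 - N = m + 1 by omega]
    refine mul_left_cancel₀ (mul_ne_zero (qFac_ne_zero (N + 1)) (qFac_ne_zero (m + 1))) ?_
    rw [show N + 1 + (m + 1) = N + m + 1 + 1 by ring] at e1
    rw [show N + 1 + m = N + m + 1 by ring] at e2
    rw [show N + (m + 1) = N + m + 1 by ring] at e3
    rw [e1, qFac_succ (N + m + 1)]
    have h1 : qFac (N + 1) * qFac (m + 1) * gauss (N + m + 1) (N + 1)
        = (1 - X ^ (m + 1)) * qFac (N + m + 1) := by
      rw [← e2, qFac_succ m]; ring
    have h2 : qFac (N + 1) * qFac (m + 1) * gauss (N + m + 1) N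
        = (1 - X ^ (N + 1)) * qFac (N + m + 1) := by
      rw [← e3, qFac_succ N]; ring
    rw [mul_add, h1, mul_left_comm, h2]
    ring

/-- The `q`-Vandermonde summation. -/
theorem gauss_vandermonde (l B A : ℕ) :
    gauss (B + l) A =
      ∑ j ∈ Finset.range (A + 1), X ^ (j * (B - (A - j))) * gauss l j * gauss B (A - j) := by
  induction l generalizing A with
  | zero =>
    rw [Finset.sum_range_succ', Finset.sum_eq_zero]
    · simp [gauss_zero_right]
    · intro j _
      rw [gauss_of_lt (Nat.succ_pos j)]; ring
  | succ l ih =>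
    cases A with
    | zero => simp [gauss_zero_right]
    | succ A =>
      rw [← add_assoc, gauss_succ_succ, ih (A + 1), ih A, Finset.sum_range_succ',
        Finset.sum_range_succ' _ (A + 1), Finset.mul_sum]
      rw [add_right_comm, ← Finset.sum_add_distrib]
      congr 1
      · refine Finset.sum_congr rfl fun j hj => ?_
        have hj' : j ≤ A := by simpa [Nat.lt_succ_iff] using hj
        rw [gauss_succ_succ, show A + 1 - (j + 1) = A - j by omega]
        -- The truncated exponents are meaningful only where the Gaussian polynomials do not vanish,
        -- so the vanishing cases are removed first.
        by_cases h1 : B < A - j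
        · rw [gauss_of_lt h1]; ring
        by_cases h2 : l < j
        · rw [gauss_of_lt h2]; ring
        obtain ⟨i, rfl⟩ := Nat.exists_eq_add_of_le hj'
        obtain ⟨x, rfl⟩ := Nat.exists_eq_add_of_le (not_lt.1 h2)
        rw [show j + i - j = i by omega] at h1 ⊢
        obtain ⟨y, rfl⟩ := Nat.exists_eq_add_of_le (not_lt.1 h1)
        rw [show i + y - i = y by omega, show i + y + (j + x) - (j + i) = x + y by omega,
          show j + x - j = x by omega]
        ring
      · simp [gauss_zero_right]

theorem gauss_mul_gauss (l n i : ℕ) :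
    gauss l n * gauss (l - n) i = gauss l (n + i) * gauss (n + i) n := by
  by_cases h : l < n + i
  · rw [gauss_of_lt h, zero_mul]
    by_cases h' : l < n
    · rw [gauss_of_lt h', zero_mul]
    · rw [gauss_of_lt (P := l - n) (by omega), mul_zero]
  · obtain ⟨z, rfl⟩ := Nat.exists_eq_add_of_le (not_lt.1 h)
    rw [show n + i + z - n = i + z by omega, gauss_add, gauss_add, gauss_add,
      add_assoc, gauss_add]
    linear_combination (qFac (n + (i + z)) * qFacInv n * qFacInv i * qFacInv z) *
      (qFac_mul_qFacInv (i + z) - qFac_mul_qFacInv (n + i))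

/-- Both sides are the q-trinomial `(q)_{m+A} / ((q)_{A-j} (q)_{j+c} (q)_{m-c})`. -/
theorem gauss_trinomial (m A j c : ℕ) (hj : j ≤ A) :
    gauss (m + A) (A - j) * gauss (m + j) (j + c)
      = gauss (A + m) (A + c) * gauss (A + c) (A - j) := by
  by_cases h : m < c
  · rw [gauss_of_lt (P := m + j) (by omega), gauss_of_lt (P := A + m) (by omega)]; ring
  · obtain ⟨z, rfl⟩ := Nat.exists_eq_add_of_le (not_lt.1 h)
    obtain ⟨y, rfl⟩ := Nat.exists_eq_add_of_le hj
    rw [show j + y - j = y by omega, show c + z + (j + y) = y + (c + z + j) by ring, gauss_add,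
      show c + z + j = (j + c) + z by ring, gauss_add,
      show j + y + (c + z) = (j + y + c) + z by ring, gauss_add,
      show j + y + c = y + (j + c) by ring, gauss_add,
      show y + (j + c) + z = y + (j + c + z) by ring]
    linear_combination (qFac (y + (j + c + z)) * qFacInv y * qFacInv (j + c) * qFacInv z) *
      (qFac_mul_qFacInv (j + c + z) - qFac_mul_qFacInv (y + (j + c)))

/-- The `q`-Pfaff–Saalschütz summation. -/
theorem gauss_saalschuetz (m l A c : ℕ) :
    ∑ n ∈ Finset.range (A + 1),
      X ^ (n * (n + c)) * gauss (m + l + A - n) (A - n) * gauss m (n + c) * gauss l n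
      = gauss (A + m) (A + c) * gauss (A + c + l) A := by
  -- Vandermonde expands the first factor of each term, and `gauss_mul_gauss` collects the
  -- dependence on `n` into `gauss j n * gauss m (n + c)`. After the two sums are exchanged, both
  -- the inner and the outer sum are again Vandermonde sums.
  have key : ∀ n ∈ Finset.range (A + 1),
      X ^ (n * (n + c)) * gauss (m + l + A - n) (A - n) * gauss m (n + c) * gauss l n
      = ∑ j ∈ Finset.Ico n (A + 1), X ^ (n * (n + c) + (j - n) * (m + j)) * gauss l j *
          gauss (m + A) (A - j) * (gauss j n * gauss m (n + c)) := by
    intro n hn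
    have hn' : n ≤ A := by simpa [Nat.lt_succ_iff] using hn
    by_cases h : l < n
    · rw [gauss_of_lt h, mul_zero, Finset.sum_eq_zero]
      intro j hj
      rw [Finset.mem_Ico] at hj
      rw [gauss_of_lt (show l < j by omega)]; ring
    rw [show m + l + A - n = (m + A) + (l - n) by omega, gauss_vandermonde,
      Finset.sum_Ico_eq_sum_range, show A + 1 - n = A - n + 1 by omega, Finset.mul_sum,
      Finset.sum_mul, Finset.sum_mul]
    refine Finset.sum_congr rfl fun i hi => ?_
    have hi' : i ≤ A - n := by simpa [Nat.lt_succ_iff] using hi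
    rw [show A - (n + i) = A - n - i by omega, show n + i - n = i by omega,
      show m + A - (A - n - i) = m + (n + i) by omega, pow_add]
    linear_combination X ^ (n * (n + c)) * X ^ (i * (m + (n + i))) * gauss m (n + c) *
      gauss (m + A) (A - n - i) * gauss_mul_gauss l n i
  rw [Finset.sum_congr rfl key, Finset.sum_comm' (t' := Finset.range (A + 1))
    (s' := fun j => Finset.range (j + 1)) (by intro x y; simp; omega)]
  rw [gauss_vandermonde l (A + c) A, Finset.mul_sum]
  refine Finset.sum_congr rfl fun j hj => ?_
  have hj' : j ≤ A := by simpa [Nat.lt_succ_iff] using hj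
  have hv := gauss_vandermonde j m (j + c)
  rw [show j + c + 1 = c + (j + 1) by ring] at hv
  have hin : X ^ (j * (j + c)) * gauss (m + j) (j + c) = ∑ n ∈ Finset.range (j + 1),
      X ^ (n * (n + c) + (j - n) * (m + j)) * (gauss j n * gauss m (n + c)) := by
    -- The top `c` terms vanish since `gauss j i = 0` for `i > j`; reversing the others matches the
    -- summation index with `n`.
    rw [hv, show c + (j + 1) = (j + 1) + c by ring, Finset.sum_range_add,
      Finset.sum_eq_zero (s := Finset.range c), add_zero, ← Finset.sum_range_reflect,
      Finset.mul_sum]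
    · refine Finset.sum_congr rfl fun n hn => ?_
      have hn' : n ≤ j := by simpa [Nat.lt_succ_iff] using hn
      obtain ⟨y, rfl⟩ := Nat.exists_eq_add_of_le hn'
      rw [show n + y + 1 - 1 - n = y by omega, show n + y + c - y = n + c by omega,
        show n + y - n = y by omega, ← gauss_symm n y]
      by_cases h : m < n + c
      · rw [gauss_of_lt h]; ring
      · obtain ⟨z, rfl⟩ := Nat.exists_eq_add_of_le (not_lt.1 h)
        rw [show n + c + z - (n + c) = z by omega]
        ring
    · intro x _
      rw [gauss_of_lt (show j < j + 1 + x by omega)]; ring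
  have ht := gauss_trinomial m A j c hj'
  rw [show A + c - (A - j) = j + c by omega]
  calc _ = gauss l j * gauss (m + A) (A - j) * ∑ n ∈ Finset.range (j + 1),
      X ^ (n * (n + c) + (j - n) * (m + j)) * (gauss j n * gauss m (n + c)) := by
        rw [Finset.mul_sum]; refine Finset.sum_congr rfl fun n _ => by ring
    _ = _ := by
        rw [← hin]
        linear_combination (X ^ (j * (j + c)) * gauss l j) * ht

/-! ### Restricted pairs as pairs of monotone functions -/

/-- A partition in the box `(N, M)`, extended by `f 0 = 0` and by `f i = M` for `i > N`. -/
structure IsBox (N M : ℕ) (f : ℕ → ℕ) : Prop where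
  zero : f 0 = 0
  mono : Monotone f
  tail : ∀ i, N < i → f i = M

theorem IsBox.le {N M : ℕ} {f : ℕ → ℕ} (h : IsBox N M f) (i : ℕ) : f i ≤ M :=
  (h.mono (show i ≤ max i (N + 1) from le_max_left _ _)).trans
    (h.tail _ (lt_of_lt_of_le (Nat.lt_succ_self N) (le_max_right _ _))).le

theorem isBox_boxPart {N M : ℕ} {q : Fin N → Fin (M + 1)} (hq : IsPartition q) :
    IsBox N M (boxPart q) := by
  refine ⟨by simp [boxPart], ?_, ?_⟩
  · intro i j hij
    unfold boxPart
    split_ifs with h1 h2 h3 h4 h5 h6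
    · exact le_rfl
    · exact Nat.zero_le _
    · exact Nat.zero_le _
    · omega
    · exact hq (by rw [Fin.le_def]; show i - 1 ≤ j - 1; omega)
    · exact Nat.lt_succ_iff.1 (Fin.is_lt _)
    · omega
    · omega
    · exact le_rfl
  · intro i hi
    unfold boxPart
    rw [if_neg (by omega), dif_neg (by omega)]

theorem boxPart_succ {N M : ℕ} (q : Fin N → Fin (M + 1)) (i : Fin N) :
    boxPart q (i + 1) = q i := by
  simp [boxPart]

theorem boxPart_injective {N M : ℕ} :
    Function.Injective (boxPart : (Fin N → Fin (M + 1)) → ℕ → ℕ) := by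
  intro q q' h
  funext i
  have := congrFun h (i + 1)
  rw [boxPart_succ, boxPart_succ] at this
  exact Fin.ext this

open scoped Classical in
/-- The finite set of all extended partitions in the box `(N, M)`. -/
noncomputable def boxSet (N M : ℕ) : Finset (ℕ → ℕ) :=
  (Finset.univ.filter fun q : Fin N → Fin (M + 1) => IsPartition q).image boxPart

theorem mem_boxSet {N M : ℕ} {f : ℕ → ℕ} : f ∈ boxSet N M ↔ IsBox N M f := by
  simp only [boxSet, Finset.mem_image, Finset.mem_filter, Finset.mem_univ, true_and]
  constructor
  · rintro ⟨q, hq, rfl⟩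
    exact isBox_boxPart hq
  · intro h
    refine ⟨fun i => ⟨f (i + 1), Nat.lt_succ_of_le (h.le _)⟩, ?_, ?_⟩
    · intro i j hij
      exact h.mono (Nat.succ_le_succ hij)
    · funext i
      unfold boxPart
      split_ifs with h1 h2
      · rw [h1, h.zero]
      · show f (i - 1 + 1) = f i
        congr 1; omega
      · rw [h.tail]; omega

/-- The sum of the parts `f 1, …, f N`. -/
def boxWt (N : ℕ) (f : ℕ → ℕ) : ℕ := ∑ i ∈ Finset.range N, f (i + 1)

theorem boxWt_boxPart {N M : ℕ} (q : Fin N → Fin (M + 1)) : boxWt N (boxPart q) = wt q := by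
  rw [boxWt, wt, ← Fin.sum_univ_eq_sum_range (fun i => boxPart q (i + 1))]
  exact Finset.sum_congr rfl fun i _ => boxPart_succ q i

/-- The lattice path of `f`, translated by `(a, -α)`, stays strictly below the path of `g`. -/
def Avoids (N₁ N₂ a α : ℕ) (f g : ℕ → ℕ) : Prop :=
  ∀ j, j ≤ N₁ → j + a ≤ N₂ → f (j + 1) + 1 ≤ g (j + a) + α

/-- With the conventions `p_0 = 0` and `p_{N+1} = M`, all six conditions are instances of two
families of inequalities: `j + a = 0` gives the condition on the first part, and `j = N₁` the one on
the last. By `ha` the latter index occurs only if `N₁ + a = N₂`. -/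
theorem isRestricted_iff {N₁ M₁ N₂ M₂ a b α β : ℕ} (ha : N₂ ≤ N₁ + a) (hb : N₁ ≤ N₂ + b)
    {q : Fin N₁ → Fin (M₁ + 1)} {p : Fin N₂ → Fin (M₂ + 1)}
    (hq : IsPartition q) (hp : IsPartition p) :
    IsRestricted a b α β q p ↔
      Avoids N₁ N₂ a α (boxPart q) (boxPart p) ∧ Avoids N₂ N₁ b β (boxPart p) (boxPart q) := by
  have hq' := isBox_boxPart hq
  have hp' := isBox_boxPart hp
  constructor
  · intro h
    constructor
    · intro j hj1 hj2
      rcases Nat.eq_zero_or_pos (j + a) with h0 | h0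
      · obtain ⟨rfl, rfl⟩ := Nat.add_eq_zero_iff.1 h0
        rw [hp'.zero, zero_add, zero_add]; exact h.low_a rfl
      rcases Nat.lt_or_ge j N₁ with h1 | h1
      · have := h.ineq_a (j + a) h0 (by omega) hj2 (by omega)
        rwa [show j + a + 1 - a = j + 1 by omega] at this
      · have hj : j = N₁ := by omega
        subst hj
        rw [hq'.tail _ (Nat.lt_succ_self _), show j + a = N₂ by omega]
        exact h.high_a (by omega)
    · intro j hj1 hj2
      rcases Nat.eq_zero_or_pos (j + b) with h0 | h0
      · obtain ⟨rfl, rfl⟩ := Nat.add_eq_zero_iff.1 h0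
        rw [hq'.zero, zero_add, zero_add]; exact h.low_b rfl
      rcases Nat.lt_or_ge j N₂ with h1 | h1
      · have := h.ineq_b (j + b) h0 (by omega) hj2 (by omega)
        rwa [show j + b + 1 - b = j + 1 by omega] at this
      · have hj : j = N₂ := by omega
        subst hj
        rw [hp'.tail _ (Nat.lt_succ_self _), show j + b = N₁ by omega]
        exact h.high_b (by omega)
  · rintro ⟨hA, hB⟩
    refine ⟨?_, ?_, ?_, ?_, ?_, ?_⟩
    · intro i h1 h2 h3 h4
      have := hA (i - a) (by omega) (by omega)
      rwa [show i - a + 1 = i + 1 - a by omega, show i - a + a = i by omega] at this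
    · intro i h1 h2 h3 h4
      have := hB (i - b) (by omega) (by omega)
      rwa [show i - b + 1 = i + 1 - b by omega, show i - b + b = i by omega] at this
    · rintro rfl
      have := hA 0 (by omega) (by omega)
      rwa [hp'.zero, zero_add, zero_add] at this
    · rintro rfl
      have := hB 0 (by omega) (by omega)
      rwa [hq'.zero, zero_add, zero_add] at this
    · intro h
      have := hA N₁ le_rfl (by omega)
      rwa [hq'.tail _ (Nat.lt_succ_self _), h] at this
    · intro h
      have := hB N₂ le_rfl (by omega)
      rwa [hp'.tail _ (Nat.lt_succ_self _), h] at this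

open scoped Classical in
/-- The contribution of the pair `(f, g)` to the generating function. -/
noncomputable def pairTerm (N₁ N₂ a b α β : ℕ) (f g : ℕ → ℕ) : ℤ⟦X⟧ :=
  if Avoids N₁ N₂ a α f g ∧ Avoids N₂ N₁ b β g f then X ^ (boxWt N₁ f + boxWt N₂ g) else 0

/-- The generating function of restricted pairs of extended partitions. -/
noncomputable def pairSum (N₁ M₁ N₂ M₂ a b α β : ℕ) : ℤ⟦X⟧ :=
  ∑ f ∈ boxSet N₁ M₁, ∑ g ∈ boxSet N₂ M₂, pairTerm N₁ N₂ a b α β f g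

theorem coe_genFun {N₁ M₁ N₂ M₂ a b α β : ℕ} (ha : N₂ ≤ N₁ + a) (hb : N₁ ≤ N₂ + b) :
    (genFun N₁ M₁ N₂ M₂ a b α β : ℤ⟦X⟧) = pairSum N₁ M₁ N₂ M₂ a b α β := by
  classical
  have : ∀ s : Finset ((Fin N₁ → Fin (M₁ + 1)) × (Fin N₂ → Fin (M₂ + 1))),
      ((∑ z ∈ s, (Polynomial.X : Polynomial ℤ) ^ (wt z.1 + wt z.2) : Polynomial ℤ) : ℤ⟦X⟧)
        = ∑ z ∈ s, (X : ℤ⟦X⟧) ^ (wt z.1 + wt z.2) := by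
    intro s
    rw [← Polynomial.coeToPowerSeries.ringHom_apply, map_sum]
    simp
  rw [genFun, this, pairSum, boxSet, boxSet,
    Finset.sum_image (fun x _ y _ h => boxPart_injective h)]
  have h2 : ∀ q : Fin N₁ → Fin (M₁ + 1),
      ∑ g ∈ (Finset.univ.filter fun q : Fin N₂ → Fin (M₂ + 1) => IsPartition q).image boxPart,
        pairTerm N₁ N₂ a b α β (boxPart q) g =
      ∑ p ∈ Finset.univ.filter fun q : Fin N₂ → Fin (M₂ + 1) => IsPartition q,
        pairTerm N₁ N₂ a b α β (boxPart q) (boxPart p) := fun q =>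
    Finset.sum_image (fun x _ y _ h => boxPart_injective h)
  simp only [h2]
  rw [← Finset.sum_product', Finset.sum_filter, ← Finset.univ_product_univ,
    ← Finset.filter_product, Finset.sum_filter]
  refine Finset.sum_congr rfl fun z _ => ?_
  by_cases h : IsPartition z.1 ∧ IsPartition z.2
  · rw [if_pos h, pairTerm, boxWt_boxPart, boxWt_boxPart]
    refine if_congr ?_ rfl rfl
    rw [← isRestricted_iff ha hb h.1 h.2]
    exact ⟨fun h' => h'.2.2, fun h' => ⟨h.1, h.2, h'⟩⟩
  · rw [if_neg h, if_neg fun h' => h ⟨h'.1, h'.2.1⟩]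

theorem pairSum_swap (N₁ M₁ N₂ M₂ a b α β : ℕ) :
    pairSum N₁ M₁ N₂ M₂ a b α β = pairSum N₂ M₂ N₁ M₁ b a β α := by
  rw [pairSum, pairSum, Finset.sum_comm]
  refine Finset.sum_congr rfl fun f _ => Finset.sum_congr rfl fun g _ => ?_
  rw [pairTerm, pairTerm]
  classical
  exact if_congr and_comm (by rw [add_comm]) rfl

/-- Increase the tail of an extended partition in the box `(N, M)` to `M + 1`. -/
def raise (N M : ℕ) (f : ℕ → ℕ) (i : ℕ) : ℕ := if i ≤ N then f i else M + 1

theorem isBox_raise {N M : ℕ} {f : ℕ → ℕ} (h : IsBox N M f) : IsBox N (M + 1) (raise N M f) := by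
  refine ⟨by simp [raise, h.zero], ?_, fun i hi => by simp [raise, not_le.2 hi]⟩
  intro i j hij
  unfold raise
  split_ifs with h1 h2
  · exact h.mono hij
  · exact (h.le i).trans (Nat.le_succ M)
  · omega
  · exact le_rfl

theorem raise_injOn (N M : ℕ) : Set.InjOn (raise N M) {f | IsBox N M f} := by
  intro f hf g hg h
  funext i
  by_cases hi : i ≤ N
  · simpa [raise, hi] using congrFun h i
  · rw [hf.tail i (not_le.1 hi), hg.tail i (not_le.1 hi)]

theorem exists_raise_eq {N M : ℕ} {f : ℕ → ℕ} (h : IsBox N (M + 1) f) (hN : f N ≤ M) :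
    ∃ g, IsBox N M g ∧ raise N M g = f := by
  refine ⟨fun i => if i ≤ N then f i else M, ⟨by simp [h.zero], ?_, ?_⟩, ?_⟩
  · intro i j hij
    show (if i ≤ N then f i else M) ≤ (if j ≤ N then f j else M)
    split_ifs with h1 h2
    · exact h.mono hij
    · exact (h.mono h1).trans hN
    · omega
    · exact le_rfl
  · intro i hi
    simp [not_le.2 hi]
  · funext i
    by_cases hi : i ≤ N
    · simp [raise, hi]
    · simp [raise, hi, h.tail i (not_le.1 hi)]

/-! ### Recursion in the endpoint of the first path -/

theorem isBox_succ_left_iff {N M : ℕ} {f : ℕ → ℕ} :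
    IsBox N M f ↔ IsBox (N + 1) M f ∧ f (N + 1) = M := by
  constructor
  · intro h
    exact ⟨⟨h.zero, h.mono, fun i hi => h.tail i (by omega)⟩, h.tail _ (Nat.lt_succ_self N)⟩
  · rintro ⟨h, h'⟩
    refine ⟨h.zero, h.mono, fun i hi => ?_⟩
    rcases eq_or_lt_of_le (Nat.succ_le_of_lt hi) with rfl | h2
    · exact h'
    · exact h.tail i h2

/-- The last part either equals the height of the box, and then the same function already lies in
the box with one part fewer, or it is smaller, and then only the tail of the function changes when
the height is lowered. -/
theorem sum_boxSet_succ_succ {K : Type*} [AddCommMonoid K] (N M : ℕ) (H : (ℕ → ℕ) → K) :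
    ∑ f ∈ boxSet (N + 1) (M + 1), H f =
      ∑ f ∈ boxSet N (M + 1), H f + ∑ f ∈ boxSet (N + 1) M, H (raise (N + 1) M f) := by
  classical
  rw [← Finset.sum_image (f := H) (g := raise (N + 1) M) (s := boxSet (N + 1) M)
    (fun x hx y hy h => raise_injOn _ _ (mem_boxSet.1 hx) (mem_boxSet.1 hy) h),
    ← Finset.sum_union]
  · refine Finset.sum_congr ?_ fun _ _ => rfl
    ext f
    simp only [Finset.mem_union, Finset.mem_image, mem_boxSet]
    constructor
    · intro h
      rcases Nat.lt_or_ge M (f (N + 1)) with h1 | h1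
      · exact Or.inl (isBox_succ_left_iff.2 ⟨h, le_antisymm (h.le _) h1⟩)
      · exact Or.inr (exists_raise_eq h h1)
    · rintro (h | ⟨g, hg, rfl⟩)
      · exact (isBox_succ_left_iff.1 h).1
      · exact isBox_raise hg
  · rw [Finset.disjoint_left]
    intro f hf hf'
    simp only [Finset.mem_image, mem_boxSet] at hf hf'
    obtain ⟨g, hg, rfl⟩ := hf'
    have h1 := (isBox_succ_left_iff.1 hf).2
    have h2 := hg.le (N + 1)
    simp only [raise, le_refl, if_true] at h1
    omega

theorem boxSet_succ_zero (N : ℕ) : boxSet (N + 1) 0 = boxSet N 0 := by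
  ext f
  rw [mem_boxSet, mem_boxSet, isBox_succ_left_iff (N := N)]
  exact ⟨fun h => ⟨h, Nat.le_zero.1 (h.le _)⟩, fun h => h.1⟩

theorem sum_boxSet_zero_succ {K : Type*} [AddCommMonoid K] (M : ℕ) (H : (ℕ → ℕ) → K) :
    ∑ f ∈ boxSet 0 (M + 1), H f = ∑ f ∈ boxSet 0 M, H (raise 0 M f) := by
  classical
  rw [← Finset.sum_image (f := H) (g := raise 0 M) (s := boxSet 0 M)
    (fun x hx y hy h => raise_injOn _ _ (mem_boxSet.1 hx) (mem_boxSet.1 hy) h)]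
  refine Finset.sum_congr ?_ fun _ _ => rfl
  ext f
  simp only [Finset.mem_image, mem_boxSet]
  constructor
  · intro h
    exact exists_raise_eq h (by simp [h.zero])
  · rintro ⟨g, hg, rfl⟩
    exact isBox_raise hg

theorem boxSet_zero_right (N : ℕ) : boxSet N 0 = {fun _ => 0} := by
  ext f
  rw [mem_boxSet, Finset.mem_singleton]
  constructor
  · intro h
    funext i
    exact Nat.le_zero.1 (h.le i)
  · rintro rfl
    exact ⟨rfl, fun _ _ _ => le_rfl, fun _ _ => rfl⟩

theorem boxSet_zero_left (M : ℕ) : boxSet 0 M = {fun i => if i = 0 then 0 else M} := by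
  ext f
  rw [mem_boxSet, Finset.mem_singleton]
  constructor
  · intro h
    funext i
    split_ifs with hi
    · rw [hi, h.zero]
    · exact h.tail i (Nat.pos_of_ne_zero hi)
  · rintro rfl
    refine ⟨rfl, ?_, fun i hi => if_neg (by omega)⟩
    intro i j hij
    show (if i = 0 then 0 else M) ≤ (if j = 0 then 0 else M)
    split_ifs
    · exact le_rfl
    · exact Nat.zero_le _
    · omega
    · exact le_rfl

/-- Dropping a last part `M₁` loses only inequalities that are void or automatic: by `h₁` the index
`N₁ + 1` is out of range for the first family, and by `h₂` a bound by `M₁ + β` always holds. -/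
theorem pairTerm_succ_left {N₁ M₁ N₂ M₂ a b α β : ℕ} (h₁ : N₂ < N₁ + 1 + a) (h₂ : M₂ < M₁ + β)
    {f g : ℕ → ℕ} (hf : IsBox N₁ M₁ f) (hg : IsBox N₂ M₂ g) :
    pairTerm (N₁ + 1) N₂ a b α β f g = X ^ M₁ * pairTerm N₁ N₂ a b α β f g := by
  classical
  rw [pairTerm, pairTerm, mul_ite, mul_zero, ← pow_add]
  have hw : boxWt (N₁ + 1) f = boxWt N₁ f + M₁ := by
    rw [boxWt, Finset.sum_range_succ, hf.tail _ (Nat.lt_succ_self _), boxWt]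
  refine if_congr (and_congr ?_ ?_) (by rw [hw]; congr 1; ring) rfl
  · exact ⟨fun h j hj hj' => h j (by omega) hj', fun h j hj hj' => h j (by omega) hj'⟩
  · refine ⟨fun h j hj hj' => h j hj (by omega), fun h j hj hj' => ?_⟩
    rcases Nat.lt_or_ge N₁ (j + b) with h3 | h3
    · rw [hf.tail _ h3]
      have := hg.le (j + 1)
      omega
    · exact h j hj h3

/-- By `h₁` no inequality reaches beyond the index `N₁`, so the tail is never seen. -/
theorem pairTerm_raise {N₁ M₁ N₂ a b α β : ℕ} (h₁ : N₂ < N₁ + a) (f g : ℕ → ℕ) :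
    pairTerm N₁ N₂ a b α β (raise N₁ M₁ f) g = pairTerm N₁ N₂ a b α β f g := by
  have hr : ∀ i ≤ N₁, raise N₁ M₁ f i = f i := fun i hi => by simp [raise, hi]
  classical
  rw [pairTerm, pairTerm]
  have hw : boxWt N₁ (raise N₁ M₁ f) = boxWt N₁ f :=
    Finset.sum_congr rfl fun i hi => hr _ (Nat.succ_le_of_lt (Finset.mem_range.1 hi))
  refine if_congr (and_congr ?_ ?_) (by rw [hw]) rfl
  · refine forall_congr' fun j => ⟨fun h hj hj' => ?_, fun h hj hj' => ?_⟩
    · have := h hj hj'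
      rwa [hr _ (by omega)] at this
    · rw [hr _ (by omega)]
      exact h hj hj'
  · refine forall_congr' fun j => ⟨fun h hj hj' => ?_, fun h hj hj' => ?_⟩
    · have := h hj hj'
      rwa [hr _ (by omega)] at this
    · rw [hr _ (by omega)]
      exact h hj hj'

theorem pairSum_succ_succ {N₁ M₁ N₂ M₂ a b α β : ℕ} (h₁ : N₂ < N₁ + 1 + a)
    (h₂ : M₂ < M₁ + 1 + β) :
    pairSum (N₁ + 1) (M₁ + 1) N₂ M₂ a b α β =
      X ^ (M₁ + 1) * pairSum N₁ (M₁ + 1) N₂ M₂ a b α β + pairSum (N₁ + 1) M₁ N₂ M₂ a b α β := by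
  rw [pairSum, sum_boxSet_succ_succ, pairSum, pairSum, Finset.mul_sum]
  congr 1
  · refine Finset.sum_congr rfl fun f hf => ?_
    rw [Finset.mul_sum]
    exact Finset.sum_congr rfl fun g hg =>
      pairTerm_succ_left h₁ h₂ (mem_boxSet.1 hf) (mem_boxSet.1 hg)
  · exact Finset.sum_congr rfl fun f _ => Finset.sum_congr rfl fun g _ => pairTerm_raise h₁ f g

theorem pairSum_succ_zero {N₁ N₂ M₂ a b α β : ℕ} (h₁ : N₂ < N₁ + 1 + a) (h₂ : M₂ < β) :
    pairSum (N₁ + 1) 0 N₂ M₂ a b α β = pairSum N₁ 0 N₂ M₂ a b α β := by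
  rw [pairSum, boxSet_succ_zero, pairSum]
  refine Finset.sum_congr rfl fun f hf => Finset.sum_congr rfl fun g hg => ?_
  rw [pairTerm_succ_left h₁ (by rwa [zero_add]) (mem_boxSet.1 hf) (mem_boxSet.1 hg), pow_zero,
    one_mul]

theorem pairSum_zero_succ {M₁ N₂ M₂ a b α β : ℕ} (h₁ : N₂ < a) :
    pairSum 0 (M₁ + 1) N₂ M₂ a b α β = pairSum 0 M₁ N₂ M₂ a b α β := by
  rw [pairSum, sum_boxSet_zero_succ, pairSum]
  exact Finset.sum_congr rfl fun f _ => Finset.sum_congr rfl fun g _ =>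
    pairTerm_raise (by rwa [zero_add]) f g

/-- The inequality at the last index compares the two endpoints, and these collide. -/
theorem pairSum_eq_zero {N₁ M₁ N₂ M₂ a b α β : ℕ} (h₁ : N₂ = N₁ + a) (h₂ : M₂ + α = M₁) :
    pairSum N₁ M₁ N₂ M₂ a b α β = 0 := by
  refine Finset.sum_eq_zero fun f hf => Finset.sum_eq_zero fun g hg => ?_
  rw [pairTerm, if_neg]
  rintro ⟨h, -⟩
  have h3 := h N₁ le_rfl h₁.ge
  rw [(mem_boxSet.1 hf).tail _ (Nat.lt_succ_self _)] at h3
  have := (mem_boxSet.1 hg).le (N₁ + a)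
  omega

/-! ### Initial values of the generating function -/

theorem pairSum_zero_zero_zero {M a b α β : ℕ} (ha : a = 0 → M < α) (hb : b = 0 → 0 < β) :
    pairSum 0 M 0 0 a b α β = 1 := by
  rw [pairSum, boxSet_zero_left, boxSet_zero_left, Finset.sum_singleton, Finset.sum_singleton,
    pairTerm, if_pos]
  · simp [boxWt]
  · constructor
    · intro j hj hj'
      have : a = 0 := by omega
      have := ha this
      simp
      omega
    · intro j hj hj'
      have : b = 0 := by omega
      have := hb this
      simp
      omega

theorem pairSum_zero_right_zero_zero {N a b α β : ℕ} (ha : a = 0 → 0 < α) (hb : N < b) :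
    pairSum N 0 0 0 a b α β = 1 := by
  rw [pairSum, boxSet_zero_right, boxSet_zero_right, Finset.sum_singleton, Finset.sum_singleton,
    pairTerm, if_pos]
  · simp [boxWt]
  · constructor
    · intro j hj hj'
      have : a = 0 := by omega
      have := ha this
      show 0 + 1 ≤ 0 + α
      omega
    · intro j hj hj'
      omega

/-! ### Alternating sums for restricted pairs -/

/-- The field in which the alternating sums are evaluated. -/
abbrev QField : Type := FractionRing ℤ⟦X⟧

/-- The variable `q` of `QField`. -/
noncomputable def qVar : QField := algebraMap ℤ⟦X⟧ QField X

theorem qVar_ne_zero : qVar ≠ 0 := by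
  rw [qVar, Ne, FaithfulSMul.algebraMap_eq_zero_iff]
  exact X_ne_zero

/-- The generating function of the lattice paths from `(0, 0)` to `(x, y)`. -/
noncomputable def pathSum (x y : ℤ) : ℤ⟦X⟧ :=
  if 0 ≤ x ∧ 0 ≤ y then gauss (x.toNat + y.toNat) x.toNat else 0

theorem pathSum_of_neg_left {x y : ℤ} (h : x < 0) : pathSum x y = 0 :=
  if_neg fun h' => absurd h'.1 (not_le.2 h)

theorem pathSum_of_neg_right {x y : ℤ} (h : y < 0) : pathSum x y = 0 :=
  if_neg fun h' => absurd h'.2 (not_le.2 h)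

theorem pathSum_symm (x y : ℤ) : pathSum x y = pathSum y x := by
  unfold pathSum
  exact if_congr and_comm (by rw [gauss_symm, add_comm]) rfl

theorem pathSum_zero_left {y : ℤ} (h : 0 ≤ y) : pathSum 0 y = 1 := by
  rw [pathSum, if_pos ⟨le_rfl, h⟩]
  exact gauss_zero_right _

theorem pathSum_zero_right {x : ℤ} (h : 0 ≤ x) : pathSum x 0 = 1 := by
  rw [pathSum_symm, pathSum_zero_left h]

theorem pathSum_eq_gauss (x l : ℕ) : pathSum x ((l : ℤ) - x) = gauss l x := by
  by_cases h : l < x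
  · rw [pathSum_of_neg_right (by omega), gauss_of_lt h]
  · obtain ⟨y, rfl⟩ := Nat.exists_eq_add_of_le (not_lt.1 h)
    rw [pathSum, if_pos (by omega)]
    congr 1; omega

/-- The image of `pathSum x y` in `QField`. -/
noncomputable def pathVal (x y : ℤ) : QField := algebraMap ℤ⟦X⟧ QField (pathSum x y)

theorem pathVal_of_neg_left {x y : ℤ} (h : x < 0) : pathVal x y = 0 := by
  rw [pathVal, pathSum_of_neg_left h, map_zero]

theorem pathVal_of_neg_right {x y : ℤ} (h : y < 0) : pathVal x y = 0 := by
  rw [pathVal, pathSum_of_neg_right h, map_zero]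

/-- Extended by zero outside the quadrant, the path count satisfies the q-Pascal rule on the whole
plane except at the origin, where the left side is 1 and the right side 0. -/
theorem pathVal_step {x y : ℤ} (h : ¬(x = 0 ∧ y = 0)) :
    pathVal x y = qVar ^ y * pathVal (x - 1) y + pathVal x (y - 1) := by
  rcases lt_or_ge x 0 with hx | hx
  · rw [pathVal_of_neg_left hx, pathVal_of_neg_left hx, pathVal_of_neg_left (by omega)]
    simp
  rcases lt_or_ge y 0 with hy | hy
  · rw [pathVal_of_neg_right hy, pathVal_of_neg_right hy, pathVal_of_neg_right (by omega)]
    simp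
  obtain ⟨n, rfl⟩ := Int.eq_ofNat_of_zero_le hx
  obtain ⟨m, rfl⟩ := Int.eq_ofNat_of_zero_le hy
  cases n with
  | zero =>
    have hm : m ≠ 0 := fun h' => h ⟨rfl, by rw [h']; rfl⟩
    rw [pathVal_of_neg_left (x := ((0 : ℕ) : ℤ) - 1) (by norm_num), mul_zero, zero_add, pathVal,
      pathVal]
    rw [Int.natCast_zero, pathSum_zero_left hy, pathSum_zero_left (by omega)]
  | succ n =>
    cases m with
    | zero =>
      rw [pathVal_of_neg_right (y := ((0 : ℕ) : ℤ) - 1) (by norm_num), pathVal, pathVal,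
        Int.natCast_zero, pathSum_zero_right hx, pathSum_zero_right (by push_cast; omega)]
      simp
    | succ m =>
      have h1 : pathSum ((n + 1 : ℕ) : ℤ) ((m + 1 : ℕ) : ℤ) = gauss (n + m + 1 + 1) (n + 1) := by
        rw [← pathSum_eq_gauss]; congr 1; push_cast; ring
      have h2 : pathSum (((n + 1 : ℕ) : ℤ) - 1) ((m + 1 : ℕ) : ℤ) = gauss (n + m + 1) n := by
        rw [← pathSum_eq_gauss]; congr 1 <;> push_cast <;> ring
      have h3 : pathSum ((n + 1 : ℕ) : ℤ) (((m + 1 : ℕ) : ℤ) - 1) = gauss (n + m + 1) (n + 1) := by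
        rw [← pathSum_eq_gauss]; congr 1; push_cast; ring
      rw [pathVal, pathVal, pathVal, h1, h2, h3, gauss_succ_succ,
        show n + m + 1 - n = m + 1 by omega, map_add, map_mul, map_pow, zpow_natCast, qVar, add_comm]

section Boson

variable (a b α β N₁ M₁ N₂ M₂ : ℤ)

/-- The terms of the first alternating sum. -/
noncomputable def evenTerm (k : ℤ) : QField :=
  qVar ^ (k * (α + β) * (N₂ - N₁) + k * k * (a + b) * (α + β)
      + k * (α * (a + b) - a * (α + β)))
    * pathVal (N₁ - k * (a + b)) (M₁ + k * (α + β))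
    * pathVal (N₂ + k * (a + b)) (M₂ - k * (α + β))

/-- The terms of the second alternating sum. -/
noncomputable def oddTerm (k : ℤ) : QField :=
  qVar ^ ((α + k * (α + β)) * (N₁ - N₂) + (k * (a + b) + a) * (k * (α + β) + α))
    * pathVal (N₂ - a - k * (a + b)) (M₂ + α + k * (α + β))
    * pathVal (N₁ + a + k * (a + b)) (M₁ - α - k * (α + β))

/-- The alternating sum for restricted pairs. -/
noncomputable def boson : QField :=
  ∑ᶠ k, evenTerm a b α β N₁ M₁ N₂ M₂ k - ∑ᶠ k, oddTerm a b α β N₁ M₁ N₂ M₂ k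

end Boson

/-! ### Recursion, symmetry and special values of the alternating sum -/

section BosonLemmas

variable {a b α β N₁ M₁ N₂ M₂ : ℤ}

theorem le_mul_of_one_le {k p : ℤ} (hk : 1 ≤ k) (hp : 0 ≤ p) : p ≤ k * p := by nlinarith

theorem mul_le_neg_of_le_neg_one {k p : ℤ} (hk : k ≤ -1) (hp : 0 ≤ p) : k * p ≤ -p := by nlinarith

theorem finite_support_evenTerm (hp : 0 < a + b) :
    (Function.support (evenTerm a b α β N₁ M₁ N₂ M₂)).Finite := by
  refine (Set.finite_Icc (-|N₂|) |N₁|).subset fun k hk => ?_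
  rw [Function.mem_support, evenTerm] at hk
  have h1 : 0 ≤ N₁ - k * (a + b) := by
    by_contra h
    exact hk (by rw [pathVal_of_neg_left (not_le.1 h)]; ring)
  have h2 : 0 ≤ N₂ + k * (a + b) := by
    by_contra h
    exact hk (by rw [pathVal_of_neg_left (x := N₂ + _) (not_le.1 h)]; ring)
  constructor
  · have := le_abs_self N₂
    nlinarith [abs_nonneg N₂]
  · have := le_abs_self N₁
    nlinarith [abs_nonneg N₁]

theorem finite_support_oddTerm (hp : 0 < a + b) :
    (Function.support (oddTerm a b α β N₁ M₁ N₂ M₂)).Finite := by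
  refine (Set.finite_Icc (-(|N₁| + |a|)) (|N₂| + |a|)).subset fun k hk => ?_
  rw [Function.mem_support, oddTerm] at hk
  have h1 : 0 ≤ N₂ - a - k * (a + b) := by
    by_contra h
    exact hk (by rw [pathVal_of_neg_left (not_le.1 h)]; ring)
  have h2 : 0 ≤ N₁ + a + k * (a + b) := by
    by_contra h
    exact hk (by rw [pathVal_of_neg_left (x := N₁ + _ + _) (not_le.1 h)]; ring)
  constructor
  · have := le_abs_self N₁
    have := le_abs_self a
    nlinarith [abs_nonneg N₁, abs_nonneg a]
  · have := le_abs_self N₂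
    have := neg_abs_le a
    nlinarith [abs_nonneg N₂, abs_nonneg a]

/-- The q-Pascal rule produces `q ^ (M₁ + k (α + β))`. Lowering `N₁` raises the prefactor of the
term by exactly `q ^ (k (α + β))`, so `q ^ M₁`, independent of `k`, remains; this makes the rule
compatible with the sum over `k`. -/
theorem evenTerm_step {k : ℤ} (h : ¬(N₁ - k * (a + b) = 0 ∧ M₁ + k * (α + β) = 0)) :
    evenTerm a b α β N₁ M₁ N₂ M₂ k =
      qVar ^ M₁ * evenTerm a b α β (N₁ - 1) M₁ N₂ M₂ k
        + evenTerm a b α β N₁ (M₁ - 1) N₂ M₂ k := by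
  rw [evenTerm, pathVal_step h, evenTerm, evenTerm,
    show N₁ - k * (a + b) - 1 = N₁ - 1 - k * (a + b) by ring,
    show M₁ + k * (α + β) - 1 = M₁ - 1 + k * (α + β) by ring,
    show k * (α + β) * (N₂ - (N₁ - 1)) + k * k * (a + b) * (α + β)
      + k * (α * (a + b) - a * (α + β)) = k * (α + β) * (N₂ - N₁) + k * k * (a + b) * (α + β)
      + k * (α * (a + b) - a * (α + β)) + k * (α + β) by ring,
    zpow_add₀ qVar_ne_zero M₁, zpow_add₀ qVar_ne_zero _ (k * (α + β))]
  ring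

theorem oddTerm_step {k : ℤ} (h : ¬(N₁ + a + k * (a + b) = 0 ∧ M₁ - α - k * (α + β) = 0)) :
    oddTerm a b α β N₁ M₁ N₂ M₂ k =
      qVar ^ M₁ * oddTerm a b α β (N₁ - 1) M₁ N₂ M₂ k
        + oddTerm a b α β N₁ (M₁ - 1) N₂ M₂ k := by
  have e : qVar ^ ((α + k * (α + β)) * (N₁ - N₂) + (k * (a + b) + a) * (k * (α + β) + α))
      = qVar ^ ((α + k * (α + β)) * (N₁ - 1 - N₂) + (k * (a + b) + a) * (k * (α + β) + α))
        * qVar ^ (α + k * (α + β)) := by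
    rw [← zpow_add₀ qVar_ne_zero]; congr 1; ring
  have e2 : qVar ^ (α + k * (α + β)) * qVar ^ (M₁ - α - k * (α + β)) = qVar ^ M₁ := by
    rw [← zpow_add₀ qVar_ne_zero]; congr 1; ring
  rw [oddTerm, pathVal_step h, oddTerm, oddTerm,
    show N₁ + a + k * (a + b) - 1 = N₁ - 1 + a + k * (a + b) by ring,
    show M₁ - α - k * (α + β) - 1 = M₁ - 1 - α - k * (α + β) by ring, mul_add]
  congr 1
  rw [e, ← e2]
  ring

theorem finsum_mul_add_distrib {f g : ℤ → QField} (c : QField) (hf : (Function.support f).Finite)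
    (hg : (Function.support g).Finite) :
    ∑ᶠ k, (c * f k + g k) = c * ∑ᶠ k, f k + ∑ᶠ k, g k := by
  have hc : (Function.support fun k => c * f k).Finite :=
    hf.subset (Function.support_const_smul_subset c f)
  rw [finsum_add_distrib hc hg, mul_finsum' f c hf]

/-- The rule could fail only for a term in which the moved endpoint is the origin. The case `k = 0`
of the first sum is excluded by `h0`; in the second sum `k = 0` is excluded by `h₁` and `k < 0` by
`h₂`; all other `k` have a positive coordinate. -/
theorem boson_step (hp : 0 < a + b) (ha : 0 ≤ a)
    (hp' : 0 < α + β) (hN₁ : 0 ≤ N₁) (hM₁ : 0 ≤ M₁) (hN₂ : 0 ≤ N₂) (hM₂ : 0 ≤ M₂)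
    (h0 : ¬(N₁ = 0 ∧ M₁ = 0)) (h₁ : N₂ < N₁ + a) (h₂ : M₂ < M₁ + β) :
    boson a b α β N₁ M₁ N₂ M₂ =
      qVar ^ M₁ * boson a b α β (N₁ - 1) M₁ N₂ M₂ + boson a b α β N₁ (M₁ - 1) N₂ M₂ := by
  have hev : ∀ k, evenTerm a b α β N₁ M₁ N₂ M₂ k =
      qVar ^ M₁ * evenTerm a b α β (N₁ - 1) M₁ N₂ M₂ k
        + evenTerm a b α β N₁ (M₁ - 1) N₂ M₂ k := by
    intro k
    refine evenTerm_step ?_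
    rcases lt_trichotomy k 0 with hk | rfl | hk
    · have := mul_le_neg_of_le_neg_one (show k ≤ -1 by omega) hp.le
      omega
    · omega
    · have := le_mul_of_one_le (show 1 ≤ k by omega) hp'.le
      omega
  have hod : ∀ k, oddTerm a b α β N₁ M₁ N₂ M₂ k =
      qVar ^ M₁ * oddTerm a b α β (N₁ - 1) M₁ N₂ M₂ k
        + oddTerm a b α β N₁ (M₁ - 1) N₂ M₂ k := by
    intro k
    refine oddTerm_step ?_
    rcases lt_trichotomy k 0 with hk | rfl | hk
    · have := mul_le_neg_of_le_neg_one (show k ≤ -1 by omega) hp'.le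
      omega
    · omega
    · have := le_mul_of_one_le (show 1 ≤ k by omega) hp.le
      omega
  rw [boson, finsum_congr hev, finsum_congr hod,
    finsum_mul_add_distrib _ (finite_support_evenTerm hp) (finite_support_evenTerm hp),
    finsum_mul_add_distrib _ (finite_support_oddTerm hp) (finite_support_oddTerm hp),
    boson, boson]
  ring

/-- For each `k` one of the two path counts has a negative coordinate. This makes the recursion
consistent at the edge of the range. -/
theorem boson_eq_zero_of_neg_left (ha : 0 ≤ a) (hb : 0 ≤ b) (hN₁ : N₁ < 0) (hN₂ : N₂ < a) :
    boson a b α β N₁ M₁ N₂ M₂ = 0 := by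
  rw [boson, finsum_eq_zero_of_forall_eq_zero, finsum_eq_zero_of_forall_eq_zero, sub_zero]
  all_goals
    intro k
    rcases lt_or_ge k 0 with hk | hk
  · have := mul_le_neg_of_le_neg_one (show k ≤ -1 by omega) (show 0 ≤ a + b by omega)
    rw [oddTerm, pathVal_of_neg_left (x := N₁ + _ + _) (by omega)]; ring
  · have : 0 ≤ k * (a + b) := mul_nonneg hk (by omega)
    rw [oddTerm, pathVal_of_neg_left (x := N₂ - _ - _) (by omega)]; ring
  · have := mul_le_neg_of_le_neg_one (show k ≤ -1 by omega) (show 0 ≤ a + b by omega)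
    rw [evenTerm, pathVal_of_neg_left (x := N₂ + _) (by omega)]; ring
  · have : 0 ≤ k * (a + b) := mul_nonneg hk (by omega)
    rw [evenTerm, pathVal_of_neg_left (x := N₁ - _) (by omega)]; ring

theorem boson_eq_zero_of_neg_right (hα : 0 ≤ α) (hβ : 0 ≤ β) (hM₁ : M₁ < 0) (hM₂ : M₂ < β) :
    boson a b α β N₁ M₁ N₂ M₂ = 0 := by
  rw [boson, finsum_eq_zero_of_forall_eq_zero, finsum_eq_zero_of_forall_eq_zero, sub_zero]
  all_goals
    intro k
    rcases lt_trichotomy k 0 with hk | rfl | hk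
  · have := mul_le_neg_of_le_neg_one (show k ≤ -1 by omega) (show 0 ≤ α + β by omega)
    rw [oddTerm, pathVal_of_neg_right (y := M₂ + _ + _) (by omega)]; ring
  · rw [oddTerm, pathVal_of_neg_right (y := M₁ - _ - _) (by omega)]; ring
  · have := le_mul_of_one_le (show 1 ≤ k by omega) (show 0 ≤ α + β by omega)
    rw [oddTerm, pathVal_of_neg_right (y := M₁ - _ - _) (by omega)]; ring
  · have := mul_le_neg_of_le_neg_one (show k ≤ -1 by omega) (show 0 ≤ α + β by omega)
    rw [evenTerm, pathVal_of_neg_right (y := M₁ + _) (by omega)]; ring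
  · rw [evenTerm, pathVal_of_neg_right (y := M₁ + _) (by omega)]; ring
  · have := le_mul_of_one_le (show 1 ≤ k by omega) (show 0 ≤ α + β by omega)
    rw [evenTerm, pathVal_of_neg_right (y := M₂ - _) (by omega)]; ring

/-- When the endpoints collide, the two sums agree term by term. -/
theorem boson_eq_zero (hN : N₂ = N₁ + a) (hM : M₁ = M₂ + α) :
    boson a b α β N₁ M₁ N₂ M₂ = 0 := by
  subst hN hM
  rw [boson, sub_eq_zero]
  refine finsum_congr fun k => ?_
  rw [evenTerm, oddTerm, show N₁ + a - a - k * (a + b) = N₁ - k * (a + b) by ring,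
    show M₂ + α - α - k * (α + β) = M₂ - k * (α + β) by ring]
  congr 3
  ring

/-- The symmetry is `k ↦ -k` in the first sum and `k ↦ -1 - k` in the second. -/
theorem boson_swap : boson a b α β N₁ M₁ N₂ M₂ = boson b a β α N₂ M₂ N₁ M₁ := by
  rw [boson, boson]
  congr 1
  · rw [← finsum_comp_equiv (Equiv.neg ℤ)]
    refine finsum_congr fun k => ?_
    rw [Equiv.neg_apply, evenTerm, evenTerm, mul_right_comm (qVar ^ _)]
    refine congrArg₂ _ (congrArg₂ _ (congrArg _ ?_) (congrArg₂ _ ?_ ?_)) (congrArg₂ _ ?_ ?_)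
    all_goals ring
  · rw [← finsum_comp_equiv (Equiv.subLeft (-1 : ℤ))]
    refine finsum_congr fun k => ?_
    rw [Equiv.subLeft_apply, oddTerm, oddTerm, mul_right_comm (qVar ^ _)]
    refine congrArg₂ _ (congrArg₂ _ (congrArg _ ?_) (congrArg₂ _ ?_ ?_)) (congrArg₂ _ ?_ ?_)
    all_goals ring

theorem boson_zero_zero_zero (hp : 0 < a + b) (ha : 0 ≤ a) (hb : 0 ≤ b)
    (h₁ : a = 0 → M₁ < α) (h₂ : b = 0 → 0 < β) (hM : 0 ≤ M₁) :
    boson a b α β 0 M₁ 0 0 = 1 := by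
  rw [boson, finsum_eq_single _ 0, finsum_eq_zero_of_forall_eq_zero, sub_zero, evenTerm]
  · simp [pathVal, pathSum_zero_left, hM]
  · intro k
    rcases lt_or_ge 0 (a + k * (a + b)) with h | h
    · rw [oddTerm, pathVal_of_neg_left (x := 0 - a - _) (by omega)]; ring
    rcases lt_or_ge (a + k * (a + b)) 0 with h' | h'
    · rw [oddTerm, pathVal_of_neg_left (x := 0 + a + _) (by omega)]; ring
    -- Here `a + k (a + b) = 0` with `0 ≤ a ≤ a + b`, so either `k = 0 = a`, or `k = -1` and `b =
    -- 0`.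
    have hk : k = 0 ∨ k = -1 := by
      rcases lt_trichotomy k 0 with hk | rfl | hk
      · right
        by_contra hk'
        have := mul_le_neg_of_le_neg_one (show k + 1 ≤ -1 by omega) hp.le
        have : (k + 1) * (a + b) = k * (a + b) + (a + b) := by ring
        omega
      · left; rfl
      · have := le_mul_of_one_le (show 1 ≤ k by omega) hp.le
        omega
    rcases hk with rfl | rfl
    · rw [oddTerm, pathVal_of_neg_right (y := M₁ - α - _)]
      · ring
      · have := h₁ (by omega); omega
    · rw [oddTerm, pathVal_of_neg_right (y := 0 + α + _)]
      · ring
      · have := h₂ (by omega); omega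
  · intro k hk
    rcases lt_or_gt_of_ne hk with hk | hk
    · have := mul_le_neg_of_le_neg_one (show k ≤ -1 by omega) hp.le
      rw [evenTerm, pathVal_of_neg_left (x := 0 + _) (by omega)]; ring
    · have := le_mul_of_one_le (show 1 ≤ k by omega) hp.le
      rw [evenTerm, pathVal_of_neg_left (x := 0 - _) (by omega)]; ring

theorem boson_zero_right_zero_zero (hp : 0 < a + b) (hp' : 0 < α + β) (ha : 0 ≤ a)
    (h₁ : a = 0 → 0 < α) (hN : 0 ≤ N₁) (h₂ : N₁ < b) :
    boson a b α β N₁ 0 0 0 = 1 := by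
  rw [boson, finsum_eq_single _ 0, finsum_eq_zero_of_forall_eq_zero, sub_zero, evenTerm]
  · simp [pathVal, pathSum_zero_right, hN]
  · intro k
    rcases lt_trichotomy k 0 with hk | rfl | hk
    · have := mul_le_neg_of_le_neg_one (show k ≤ -1 by omega) hp.le
      rw [oddTerm, pathVal_of_neg_left (x := N₁ + a + _) (by omega)]; ring
    · rcases ha.lt_or_eq with h | h
      · rw [oddTerm, pathVal_of_neg_left (x := 0 - a - _) (by omega)]; ring
      · have := h₁ h.symm
        rw [oddTerm, pathVal_of_neg_right (y := 0 - α - _) (by omega)]; ring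
    · have := le_mul_of_one_le (show 1 ≤ k by omega) hp.le
      rw [oddTerm, pathVal_of_neg_left (x := 0 - a - _) (by omega)]; ring
  · intro k hk
    rcases lt_or_gt_of_ne hk with hk | hk
    · have := mul_le_neg_of_le_neg_one (show k ≤ -1 by omega) hp.le
      rw [evenTerm, pathVal_of_neg_left (x := 0 + _) (by omega)]; ring
    · have := le_mul_of_one_le (show 1 ≤ k by omega) hp'.le
      rw [evenTerm, pathVal_of_neg_right (y := 0 - _) (by omega)]; ring

end BosonLemmas

/-- The image of `pairSum` in `QField` agrees with the alternating sum. -/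
def PairSumEqBoson (N₁ M₁ N₂ M₂ a b α β : ℕ) : Prop :=
  algebraMap ℤ⟦X⟧ QField (pairSum N₁ M₁ N₂ M₂ a b α β) = boson a b α β N₁ M₁ N₂ M₂

/-! ### Agreement of the generating function with the alternating sum -/

theorem PairSumEqBoson.swap {N₁ M₁ N₂ M₂ a b α β : ℕ} (h : PairSumEqBoson N₂ M₂ N₁ M₁ b a β α) :
    PairSumEqBoson N₁ M₁ N₂ M₂ a b α β := by
  rw [PairSumEqBoson, pairSum_swap, boson_swap]
  exact h

theorem pairSumEqBoson_step {N₁ M₁ N₂ M₂ a b α β : ℕ} (hp : 0 < a + b) (hp' : 0 < α + β)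
    (h₁ : N₂ < N₁ + a) (h₂ : M₂ < M₁ + β) (h0 : ¬(N₁ = 0 ∧ M₁ = 0))
    (ihN : ∀ n, N₁ = n + 1 → PairSumEqBoson n M₁ N₂ M₂ a b α β)
    (ihM : ∀ m, M₁ = m + 1 → PairSumEqBoson N₁ m N₂ M₂ a b α β) :
    PairSumEqBoson N₁ M₁ N₂ M₂ a b α β := by
  unfold PairSumEqBoson at ihN ihM ⊢
  rw [boson_step (by omega) (by omega) (by omega) (by omega) (by omega)
    (by omega) (by omega) (by omega) (by omega) (by omega)]
  cases N₁ with
  | zero =>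
    cases M₁ with
    | zero => exact absurd ⟨rfl, rfl⟩ h0
    | succ m =>
      rw [boson_eq_zero_of_neg_left (N₁ := ((0 : ℕ) : ℤ) - 1) (by omega) (by omega) (by omega)
        (by omega), pairSum_zero_succ (by omega), ihM m rfl]
      push_cast
      simp
  | succ n =>
    cases M₁ with
    | zero =>
      rw [boson_eq_zero_of_neg_right (M₁ := ((0 : ℕ) : ℤ) - 1) (by omega) (by omega) (by omega)
        (by omega), pairSum_succ_zero h₁ (by omega), ihN n rfl]
      push_cast
      simp
    | succ m =>
      rw [pairSum_succ_succ h₁ h₂, map_add, map_mul, map_pow, ihN n rfl, ihM m rfl, ← qVar,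
        zpow_natCast]
      push_cast
      simp

/-- Induction on the sum of the coordinates of the endpoints. The inequalities say that the
endpoints have not crossed. If they collide, both sides vanish; otherwise one of the paths can be
shortened without leaving this range, unless an endpoint has reached the origin. -/
theorem pairSumEqBoson (n : ℕ) : ∀ {N₁ M₁ N₂ M₂ a b α β : ℕ}, N₁ + M₁ + N₂ + M₂ = n →
    0 < a + b → 0 < α + β → N₂ ≤ N₁ + a → N₁ ≤ N₂ + b → M₁ ≤ M₂ + α → M₂ ≤ M₁ + β →
    PairSumEqBoson N₁ M₁ N₂ M₂ a b α β := by
  induction n using Nat.strong_induction_on with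
  | _ n ih =>
  intro N₁ M₁ N₂ M₂ a b α β hn hp hp' h₁ h₂ h₃ h₄
  have zero : ∀ {N₁ M₁ N₂ M₂ a b α β : ℕ}, N₂ = N₁ + a → M₁ = M₂ + α →
      PairSumEqBoson N₁ M₁ N₂ M₂ a b α β := fun hN hM => by
    rw [PairSumEqBoson, pairSum_eq_zero hN hM.symm, map_zero,
      boson_eq_zero (by omega) (by omega)]
  have base : ∀ {N₁ M₁ a b α β : ℕ}, 0 < a + b → 0 < α + β → ¬(0 = N₁ + a ∧ M₁ = 0 + α) →
      ¬(N₁ = 0 + b ∧ 0 = M₁ + β) → M₁ ≤ α → N₁ ≤ b → 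
      (N₁ + a = 0 ∨ M₁ + β = 0 ∨ (N₁ = 0 ∧ M₁ = 0)) → PairSumEqBoson N₁ M₁ 0 0 a b α β := by
    intro N₁ M₁ a b α β hp hp' hF1 hF2 hM hN h
    by_cases hN0 : N₁ = 0 ∧ (a = 0 ∨ M₁ = 0)
    · obtain ⟨rfl, hh⟩ := hN0
      rw [PairSumEqBoson, pairSum_zero_zero_zero (by omega) (by omega), map_one]
      exact (boson_zero_zero_zero (by omega) (by omega) (by omega) (by omega) (by omega)
        (by omega)).symm
    · obtain rfl : M₁ = 0 := by omega
      rw [PairSumEqBoson, pairSum_zero_right_zero_zero (by omega) (by omega), map_one]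
      exact (boson_zero_right_zero_zero (by omega) (by omega) (by omega) (by omega) (by omega)
        (by omega)).symm
  by_cases hF1 : N₂ = N₁ + a ∧ M₁ = M₂ + α
  · exact zero hF1.1 hF1.2
  by_cases hF2 : N₁ = N₂ + b ∧ M₂ = M₁ + β
  · exact (zero hF2.1 hF2.2).swap
  by_cases hq : N₂ < N₁ + a ∧ M₂ < M₁ + β ∧ ¬(N₁ = 0 ∧ M₁ = 0)
  · refine pairSumEqBoson_step hp hp' hq.1 hq.2.1 hq.2.2 ?_ ?_
    · rintro k rfl
      exact ih (k + M₁ + N₂ + M₂) (by omega) rfl hp hp' (by omega) (by omega) (by omega) (by omega)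
    · rintro k rfl
      exact ih (N₁ + k + N₂ + M₂) (by omega) rfl hp hp' (by omega) (by omega) (by omega) (by omega)
  by_cases hq' : N₁ < N₂ + b ∧ M₁ < M₂ + α ∧ ¬(N₂ = 0 ∧ M₂ = 0)
  · refine (pairSumEqBoson_step (by omega) (by omega) hq'.1 hq'.2.1 hq'.2.2 ?_ ?_).swap
    · rintro k rfl
      exact ih (k + M₂ + N₁ + M₁) (by omega) rfl (by omega) (by omega) (by omega) (by omega)
        (by omega) (by omega)
    · rintro k rfl
      exact ih (N₂ + k + N₁ + M₁) (by omega) rfl (by omega) (by omega) (by omega) (by omega)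
        (by omega) (by omega)
  -- Neither path can be shortened and the endpoints do not collide, so one of them is the origin.
  by_cases hE : N₂ = 0 ∧ M₂ = 0
  · obtain ⟨rfl, rfl⟩ := hE
    exact base hp hp' hF1 hF2 (by omega) (by omega) (by omega)
  · obtain ⟨rfl, rfl⟩ : N₁ = 0 ∧ M₁ = 0 := by omega
    exact (base (by omega) (by omega) (by omega) (by omega) (by omega) (by omega) (by omega)).swap

/-! ### The Burge transform and the transposition of restricted pairs -/

/-- The generating function of restricted pairs in two equal boxes. -/
noncomputable def pairR (N M a b α β : ℕ) : ℤ⟦X⟧ := pairSum N M N M a b α β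

theorem coe_R (N M a b α β : ℕ) : (R N M a b α β : ℤ⟦X⟧) = pairR N M a b α β :=
  coe_genFun (Nat.le_add_right _ _) (Nat.le_add_right _ _)

theorem algebraMap_pairR {N M a b α β : ℕ} (hp : 0 < a + b) (hp' : 0 < α + β) :
    algebraMap ℤ⟦X⟧ QField (pairR N M a b α β) = boson a b α β N M N M :=
  pairSumEqBoson _ rfl hp hp' (Nat.le_add_right _ _) (Nat.le_add_right _ _)
    (Nat.le_add_right _ _) (Nat.le_add_right _ _)

theorem pathVal_symm (x y : ℤ) : pathVal x y = pathVal y x := by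
  rw [pathVal, pathSum_symm, pathVal]

/-- For equal boxes the terms with `N₁ - N₂` drop out of the exponents. The rest is symmetric under
reflection of the paths, with `k ↦ -k` in the first sum and the two factors exchanged in the second.
-/
theorem boson_transpose (a b α β N M : ℤ) :
    boson a b α β N M N M = boson α β a b M N M N := by
  rw [boson, boson]
  congr 1
  · rw [← finsum_comp_equiv (Equiv.neg ℤ)]
    refine finsum_congr fun k => ?_
    rw [Equiv.neg_apply, evenTerm, evenTerm, pathVal_symm (N - _), pathVal_symm (N + _)]
    refine congrArg₂ _ (congrArg₂ _ (congrArg _ ?_) (congrArg₂ _ ?_ ?_)) (congrArg₂ _ ?_ ?_)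
    all_goals ring
  · refine finsum_congr fun k => ?_
    rw [oddTerm, oddTerm, pathVal_symm (N - _ - _), pathVal_symm (N + _ + _),
      mul_right_comm (qVar ^ _)]
    refine congrArg₂ _ (congrArg₂ _ (congrArg _ ?_) (congrArg₂ _ ?_ ?_)) (congrArg₂ _ ?_ ?_)
    all_goals ring

theorem pairR_transpose {N M a b α β : ℕ} (hp : 0 < a + b) (hp' : 0 < α + β) :
    pairR N M a b α β = pairR M N α β a b := by
  apply FaithfulSMul.algebraMap_injective ℤ⟦X⟧ QField
  rw [algebraMap_pairR hp hp', algebraMap_pairR hp' hp, boson_transpose]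

/-- This is `gauss_saalschuetz` with `A = N - x`, `c = 2 x`, `m = M + x - y` and `l = M - x + y`,
summed over `n - x`. Outside `x ≤ N`, `x + y ≤ M` both sides vanish. -/
theorem pathSum_saalschuetz (x y N M : ℕ) :
    ∑ n ∈ Finset.range (N + 1), X ^ (n * n) * gauss (2 * M + N - n) (N - n) *
        (pathSum ((n : ℤ) - x) ((M : ℤ) - n + y) * pathSum ((n : ℤ) + x) ((M : ℤ) - n - y))
      = X ^ (x * x) * (pathSum ((N : ℤ) - x) ((M : ℤ) + (x + y))
          * pathSum ((N : ℤ) + x) ((M : ℤ) - (x + y))) := by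
  rcases Nat.lt_or_ge M (x + y) with h | h
  · rw [pathSum_of_neg_right (y := (M : ℤ) - (x + y)) (by omega), Finset.sum_eq_zero]
    · ring
    · intro n _
      rcases Nat.lt_or_ge n x with h' | h'
      · rw [pathSum_of_neg_left (x := (n : ℤ) - x) (by omega)]; ring
      · rw [pathSum_of_neg_right (y := (M : ℤ) - n - y) (by omega)]; ring
  rcases Nat.lt_or_ge N x with h' | h'
  · rw [pathSum_of_neg_left (x := (N : ℤ) - x) (by omega), Finset.sum_eq_zero]
    · ring
    · intro n hn
      rw [Finset.mem_range] at hn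
      rw [pathSum_of_neg_left (x := (n : ℤ) - x) (by omega)]; ring
  obtain ⟨A, rfl⟩ := Nat.exists_eq_add_of_le h'
  obtain ⟨z, rfl⟩ := Nat.exists_eq_add_of_le h
  rw [show x + A + 1 = x + (A + 1) by ring, Finset.sum_range_add, Finset.sum_eq_zero, zero_add]
  · have h1 : pathSum (((x + A : ℕ) : ℤ) - x) (((x + y + z : ℕ) : ℤ) + (x + y))
        = gauss (A + 2 * x + (2 * y + z)) A := by
      rw [← pathSum_eq_gauss]; congr 1 <;> push_cast <;> ring
    have h2 : pathSum (((x + A : ℕ) : ℤ) + x) (((x + y + z : ℕ) : ℤ) - (x + y))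
        = gauss (A + (2 * x + z)) (A + 2 * x) := by
      rw [← pathSum_eq_gauss]; congr 1 <;> push_cast <;> ring
    rw [h1, h2, mul_comm (gauss (A + 2 * x + (2 * y + z)) A), ← gauss_saalschuetz, Finset.mul_sum]
    refine Finset.sum_congr rfl fun i _ => ?_
    have h3 : pathSum (((x + i : ℕ) : ℤ) - x) (((x + y + z : ℕ) : ℤ) - ((x + i : ℕ) : ℤ) + y)
        = gauss (2 * y + z) i := by
      rw [← pathSum_eq_gauss]; congr 1 <;> push_cast <;> ring
    have h4 : pathSum (((x + i : ℕ) : ℤ) + x) (((x + y + z : ℕ) : ℤ) - ((x + i : ℕ) : ℤ) - y)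
        = gauss (2 * x + z) (i + 2 * x) := by
      rw [← pathSum_eq_gauss]; congr 1 <;> push_cast <;> ring
    rw [h3, h4, show 2 * (x + y + z) + (x + A) - (x + i)
      = 2 * x + z + (2 * y + z) + A - i by omega, show x + A - (x + i) = A - i by omega]
    ring
  · intro n hn
    rw [Finset.mem_range] at hn
    rw [pathSum_of_neg_left (x := (n : ℤ) - x) (by omega)]; ring

/-- The weight of the Burge transform. -/
noncomputable def burgeWeight (N M n : ℕ) : ℤ⟦X⟧ := X ^ (n * n) * gauss (2 * M + N - n) (N - n)

/-- Changing the sign of both shifts only exchanges the two path counts, so shifts of equal sign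
suffice. -/
theorem pathVal_saalschuetz {x y : ℤ} (h : (0 ≤ x ∧ 0 ≤ y) ∨ (x ≤ 0 ∧ y ≤ 0)) (N M : ℕ) :
    ∑ n ∈ Finset.range (N + 1), algebraMap ℤ⟦X⟧ QField (burgeWeight N M n) *
        (pathVal ((n : ℤ) - x) ((M : ℤ) - n + y) * pathVal ((n : ℤ) + x) ((M : ℤ) - n - y))
      = qVar ^ (x * x) * (pathVal ((N : ℤ) - x) ((M : ℤ) + (x + y))
          * pathVal ((N : ℤ) + x) ((M : ℤ) - (x + y))) := by
  have key : ∀ x y : ℕ, ∑ n ∈ Finset.range (N + 1), algebraMap ℤ⟦X⟧ QField (burgeWeight N M n) *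
        (pathVal ((n : ℤ) - x) ((M : ℤ) - n + y) * pathVal ((n : ℤ) + x) ((M : ℤ) - n - y))
      = qVar ^ ((x : ℤ) * x) * (pathVal ((N : ℤ) - x) ((M : ℤ) + (x + y))
          * pathVal ((N : ℤ) + x) ((M : ℤ) - (x + y))) := by
    intro x y
    have := congrArg (algebraMap ℤ⟦X⟧ QField) (pathSum_saalschuetz x y N M)
    rw [map_sum, map_mul, map_mul, map_pow] at this
    rw [← Nat.cast_mul, zpow_natCast, qVar]
    refine Eq.trans (Finset.sum_congr rfl fun n _ => ?_) this
    rw [map_mul, map_mul _ (pathSum _ _)]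
    rfl
  rcases h with ⟨hx, hy⟩ | ⟨hx, hy⟩
  · obtain ⟨x, rfl⟩ := Int.eq_ofNat_of_zero_le hx
    obtain ⟨y, rfl⟩ := Int.eq_ofNat_of_zero_le hy
    exact key x y
  · obtain ⟨x', hx'⟩ := Int.eq_ofNat_of_zero_le (neg_nonneg.2 hx)
    obtain ⟨y', hy'⟩ := Int.eq_ofNat_of_zero_le (neg_nonneg.2 hy)
    obtain rfl : x = -x' := by omega
    obtain rfl : y = -y' := by omega
    rw [neg_mul_neg, mul_comm (pathVal ((N : ℤ) - -x') _)]
    refine Eq.trans (Finset.sum_congr rfl fun n _ => ?_) ((key x' y').trans ?_)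
    · rw [mul_comm (pathVal ((n : ℤ) - -x') _)]
      congr 3 <;> ring
    · congr 3 <;> ring

/-- The shifts in every term of the alternating sums have the form `k p + a`, `k p' + α`; this is
where non-negativity of the four parameters enters the Burge transform. -/
theorem same_sign {p p' a α k : ℤ} (ha : 0 ≤ a) (hap : a ≤ p) (hα : 0 ≤ α) (hαp : α ≤ p') :
    (0 ≤ k * p + a ∧ 0 ≤ k * p' + α) ∨ (k * p + a ≤ 0 ∧ k * p' + α ≤ 0) := by
  rcases lt_or_ge k 0 with hk | hk
  · right
    have := mul_le_neg_of_le_neg_one (show k ≤ -1 by omega) (show 0 ≤ p by omega)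
    have := mul_le_neg_of_le_neg_one (show k ≤ -1 by omega) (show 0 ≤ p' by omega)
    omega
  · left
    have := mul_nonneg hk (show 0 ≤ p by omega)
    have := mul_nonneg hk (show 0 ≤ p' by omega)
    omega

/-- With shifts `x = k (a + b)` and `y = k (α + β)`, the second shift becomes `x + y`, which amounts
to `(α, β) ↦ (α + a, β + b)`, and the factor `q ^ (x * x)` is exactly the change of the exponent. -/
theorem evenTerm_burge {a b α β : ℤ} (ha : 0 ≤ a) (hb : 0 ≤ b) (hα : 0 ≤ α) (hβ : 0 ≤ β)
    (N M : ℕ) (k : ℤ) :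
    ∑ n ∈ Finset.range (N + 1), algebraMap ℤ⟦X⟧ QField (burgeWeight N M n) *
        evenTerm a b α β n (M - n) n (M - n) k = evenTerm a b (α + a) (β + b) N M N M k := by
  have h := pathVal_saalschuetz (x := k * (a + b)) (y := k * (α + β))
    (by
      have h1 : 0 ≤ a + b := by omega
      have h2 : 0 ≤ α + β := by omega
      simpa using same_sign (k := k) (le_refl 0) h1 (le_refl 0) h2) N M
  have e : qVar ^ (k * (α + a + (β + b)) * ((N : ℤ) - N) + k * k * (a + b) * (α + a + (β + b))
      + k * ((α + a) * (a + b) - a * (α + a + (β + b))))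
      = qVar ^ (k * k * (a + b) * (α + β) + k * (α * (a + b) - a * (α + β)))
        * qVar ^ (k * (a + b) * (k * (a + b))) := by
    rw [← zpow_add₀ qVar_ne_zero]; congr 1; ring
  rw [evenTerm, e, show k * (α + a + (β + b)) = k * (a + b) + k * (α + β) by ring,
    mul_assoc, mul_assoc, ← h, Finset.mul_sum]
  refine Finset.sum_congr rfl fun n _ => ?_
  rw [evenTerm, sub_self, mul_zero, zero_add]
  ring

theorem oddTerm_burge {a b α β : ℤ} (ha : 0 ≤ a) (hb : 0 ≤ b) (hα : 0 ≤ α) (hβ : 0 ≤ β)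
    (N M : ℕ) (k : ℤ) :
    ∑ n ∈ Finset.range (N + 1), algebraMap ℤ⟦X⟧ QField (burgeWeight N M n) *
        oddTerm a b α β n (M - n) n (M - n) k = oddTerm a b (α + a) (β + b) N M N M k := by
  have h := pathVal_saalschuetz (x := k * (a + b) + a) (y := k * (α + β) + α)
    (same_sign ha (by omega) hα (by omega)) N M
  have e : qVar ^ ((α + a + k * (α + a + (β + b))) * ((N : ℤ) - N)
      + (k * (a + b) + a) * (k * (α + a + (β + b)) + (α + a)))
      = qVar ^ ((k * (a + b) + a) * (k * (α + β) + α))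
        * qVar ^ ((k * (a + b) + a) * (k * (a + b) + a)) := by
    rw [← zpow_add₀ qVar_ne_zero]; congr 1; ring
  rw [oddTerm, e, mul_assoc, mul_assoc,
    show (N : ℤ) - a - k * (a + b) = N - (k * (a + b) + a) by ring,
    show (N : ℤ) + a + k * (a + b) = N + (k * (a + b) + a) by ring,
    show (M : ℤ) + (α + a) + k * (α + a + (β + b))
      = M + (k * (a + b) + a + (k * (α + β) + α)) by ring,
    show (M : ℤ) - (α + a) - k * (α + a + (β + b))
      = M - (k * (a + b) + a + (k * (α + β) + α)) by ring, ← h, Finset.mul_sum]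
  refine Finset.sum_congr rfl fun n _ => ?_
  rw [oddTerm, sub_self, mul_zero, zero_add,
    show (n : ℤ) - a - k * (a + b) = n - (k * (a + b) + a) by ring,
    show (n : ℤ) + a + k * (a + b) = n + (k * (a + b) + a) by ring,
    show (M : ℤ) - n + α + k * (α + β) = M - n + (k * (α + β) + α) by ring,
    show (M : ℤ) - n - α - k * (α + β) = M - n - (k * (α + β) + α) by ring]
  ring

theorem boson_burge {a b α β : ℤ} (hp : 0 < a + b) (ha : 0 ≤ a) (hb : 0 ≤ b) (hα : 0 ≤ α)
    (hβ : 0 ≤ β) (N M : ℕ) :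
    ∑ n ∈ Finset.range (N + 1), algebraMap ℤ⟦X⟧ QField (burgeWeight N M n) *
        boson a b α β n (M - n) n (M - n) = boson a b (α + a) (β + b) N M N M := by
  have hfe : ∀ n : ℕ, (Function.support fun k => algebraMap ℤ⟦X⟧ QField (burgeWeight N M n) *
      evenTerm a b α β n (M - n) n (M - n) k).Finite := fun n =>
    (finite_support_evenTerm hp).subset fun _ hk => right_ne_zero_of_mul hk
  have hfo : ∀ n : ℕ, (Function.support fun k => algebraMap ℤ⟦X⟧ QField (burgeWeight N M n) *
      oddTerm a b α β n (M - n) n (M - n) k).Finite := fun n =>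
    (finite_support_oddTerm hp).subset fun _ hk => right_ne_zero_of_mul hk
  rw [boson, ← finsum_congr (evenTerm_burge ha hb hα hβ N M),
    ← finsum_congr (oddTerm_burge ha hb hα hβ N M), finsum_sum_comm _ _ fun n _ => hfe n,
    finsum_sum_comm _ _ fun n _ => hfo n, ← Finset.sum_sub_distrib]
  refine Finset.sum_congr rfl fun n _ => ?_
  rw [boson, mul_sub, mul_finsum' _ _ (finite_support_evenTerm hp),
    mul_finsum' _ _ (finite_support_oddTerm hp)]

/-- The Burge transform. -/
theorem pairR_burge {a b α β : ℕ} (hp : 0 < a + b) (hp' : 0 < α + β) (N M : ℕ) :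
    pairR N M a b (α + a) (β + b) = ∑ n ∈ Finset.range (N + 1),
      if n ≤ M then burgeWeight N M n * pairR n (M - n) a b α β else 0 := by
  apply FaithfulSMul.algebraMap_injective ℤ⟦X⟧ QField
  rw [algebraMap_pairR hp (by omega), map_sum]
  push_cast
  rw [← boson_burge (by omega) (by omega) (by omega) (by omega) (by omega)]
  refine Finset.sum_congr rfl fun n _ => ?_
  split_ifs with h
  · rw [map_mul, algebraMap_pairR hp hp', Nat.cast_sub h]
  -- The alternating sum vanishes for `n > M`, where the box `(n, M - n)` does not exist.
  · rw [boson_eq_zero_of_neg_right (by omega) (by omega) (by omega) (by omega), mul_zero, map_zero]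

/-! ### Removing a fixed part -/

/-- Prepend a vanishing part. -/
def unshift (f : ℕ → ℕ) (i : ℕ) : ℕ := if i = 0 then 0 else f (i - 1)

theorem unshift_succ (f : ℕ → ℕ) (i : ℕ) : unshift f (i + 1) = f i := by simp [unshift]

theorem unshift_injective : Function.Injective unshift := by
  intro f g h
  funext i
  rw [← unshift_succ f, h, unshift_succ]

theorem isBox_unshift {N M : ℕ} {f : ℕ → ℕ} (h : IsBox N M f) : IsBox (N + 1) M (unshift f) := by
  refine ⟨rfl, ?_, fun i hi => ?_⟩
  · intro i j hij
    unfold unshift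
    split_ifs with h1 h2
    · exact le_rfl
    · exact Nat.zero_le _
    · omega
    · exact h.mono (by omega)
  · rw [unshift, if_neg (by omega)]
    exact h.tail _ (by omega)

theorem exists_unshift_eq {N M : ℕ} {f : ℕ → ℕ} (h : IsBox (N + 1) M f) (h1 : f 1 = 0) :
    ∃ g, IsBox N M g ∧ unshift g = f := by
  refine ⟨fun i => f (i + 1), ⟨h1, fun i j hij => h.mono (by omega), fun i hi =>
    h.tail _ (by omega)⟩, ?_⟩
  funext i
  cases i with
  | zero => exact h.zero.symm
  | succ i => exact unshift_succ _ i

/-- For `a = 0`, `α = 1` the first family reads `f (j + 1) ≤ g j`. Its ends force the first part of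
`f` to be `0` and the last part of `g` to be `M`. Deleting both shifts the indices by one: `a`
becomes `1`, `b + 1` becomes `b`, and the weight drops by `M`. -/
theorem pairTerm_unshift {N M b β : ℕ} {f g : ℕ → ℕ} (hf : IsBox N M f) (hg : IsBox N M g) :
    pairTerm (N + 1) (N + 1) 0 (b + 1) 1 β (unshift f) g
      = X ^ M * pairTerm N N 1 b 1 β f g := by
  classical
  rw [pairTerm, pairTerm, mul_ite, mul_zero, ← pow_add]
  have h1 : boxWt (N + 1) (unshift f) = boxWt N f := by
    simp only [boxWt, unshift_succ]
    rw [Finset.sum_range_succ', hf.zero, add_zero]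
  have h2 : boxWt (N + 1) g = boxWt N g + M := by
    rw [boxWt, Finset.sum_range_succ, hg.tail _ (Nat.lt_succ_self _), boxWt]
  refine if_congr (and_congr ⟨fun h j hj hj' => ?_, fun h j hj hj' => ?_⟩
    ⟨fun h j hj hj' => ?_, fun h j hj hj' => ?_⟩) (by rw [h1, h2]; congr 1; ring) rfl
  · have := h (j + 1) (by omega) (by omega)
    rwa [unshift_succ] at this
  · rw [unshift_succ, add_zero]
    rcases Nat.eq_zero_or_pos j with rfl | h0
    · rw [hf.zero]; omega
    rcases Nat.lt_or_ge N j with h3 | h3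
    · rw [hf.tail _ h3, hg.tail _ h3]
    · have := h (j - 1) (by omega) (by omega)
      rwa [show j - 1 + 1 = j by omega] at this
  · have := h j (by omega) (by omega)
    rwa [← add_assoc, unshift_succ] at this
  · rw [← add_assoc, unshift_succ]
    exact h j (by omega) (by omega)

theorem pairR_succ_zero_one (N M b β : ℕ) :
    pairR (N + 1) M 0 (b + 1) 1 β = X ^ M * pairR N M 1 b 1 β := by
  classical
  have hs : (boxSet N M).image unshift ⊆ boxSet (N + 1) M := by
    intro f hf
    obtain ⟨g, hg, rfl⟩ := Finset.mem_image.1 hf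
    exact mem_boxSet.2 (isBox_unshift (mem_boxSet.1 hg))
  have hs' : boxSet N M ⊆ boxSet (N + 1) M := fun f hf =>
    mem_boxSet.2 (isBox_succ_left_iff.1 (mem_boxSet.1 hf)).1
  rw [pairR, pairSum, ← Finset.sum_subset hs, Finset.sum_image fun _ _ _ _ h =>
    unshift_injective h, pairR, pairSum, Finset.mul_sum]
  · refine Finset.sum_congr rfl fun f hf => ?_
    rw [← Finset.sum_subset hs', Finset.mul_sum]
    · exact Finset.sum_congr rfl fun g hg =>
        pairTerm_unshift (mem_boxSet.1 hf) (mem_boxSet.1 hg)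
    · intro g hg hg'
      rw [pairTerm, if_neg]
      rintro ⟨h, -⟩
      have h1 := h (N + 1) le_rfl le_rfl
      rw [unshift_succ, (mem_boxSet.1 hf).tail _ (Nat.lt_succ_self _), add_zero] at h1
      exact hg' (mem_boxSet.2 (isBox_succ_left_iff.2 ⟨mem_boxSet.1 hg,
        le_antisymm ((mem_boxSet.1 hg).le _) (by omega)⟩))
  · intro f hf hf'
    refine Finset.sum_eq_zero fun g hg => ?_
    rw [pairTerm, if_neg]
    rintro ⟨h, -⟩
    have h1 := h 0 (by omega) (by omega)
    rw [(mem_boxSet.1 hg).zero] at h1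
    obtain ⟨f', hf1, rfl⟩ := exists_unshift_eq (mem_boxSet.1 hf) (by rw [zero_add] at h1; omega)
    exact hf' (Finset.mem_image_of_mem _ (mem_boxSet.2 hf1))

theorem pairR_zero_zero_one (M b β : ℕ) :
    pairR 0 M 0 (b + 1) 1 β = if M = 0 then 1 else 0 := by
  rw [pairR, pairSum, boxSet_zero_left, Finset.sum_singleton, Finset.sum_singleton, pairTerm]
  classical
  refine if_congr ⟨fun h => ?_, fun h => ⟨fun j hj hj' => ?_, fun j hj hj' => ?_⟩⟩
    (by simp [boxWt]) rfl
  · have := h.1 0 le_rfl le_rfl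
    simpa using this
  · obtain rfl : j = 0 := by omega
    simp [h]
  · omega

theorem pairR_one_zero_one_one (N M : ℕ) :
    pairR N M 1 0 1 1 = if M = 0 then 1 else 0 := by
  split_ifs with hM
  · subst hM
    rw [pairR, pairSum, boxSet_zero_right, Finset.sum_singleton, Finset.sum_singleton, pairTerm,
      if_pos]
    · simp [boxWt]
    · exact ⟨fun _ _ _ => le_rfl, fun _ _ _ => le_rfl⟩
  · refine Finset.sum_eq_zero fun f hf => Finset.sum_eq_zero fun g hg => ?_
    rw [pairTerm, if_neg]
    rintro ⟨hA, hB⟩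
    -- The inequalities interlace: `f (j + 1) ≤ g (j + 1) ≤ f j`, starting from `f 0 = 0`. At the
    -- end of the chain stands `g (N + 1) = M`.
    have key : ∀ j ≤ N, f j = 0 := by
      intro j
      induction j with
      | zero => exact fun _ => (mem_boxSet.1 hf).zero
      | succ j ih =>
        intro hj
        have h1 := hA j (by omega) hj
        have h2 := hB j (by omega) (by omega)
        rw [add_zero, ih (by omega)] at h2
        omega
    have h2 := hB N le_rfl le_rfl
    rw [add_zero, key N le_rfl, (mem_boxSet.1 hg).tail _ (Nat.lt_succ_self _)] at h2
    omega

/-! ### Nested sums over partitions -/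

/-- `(q)_x`, for finite or infinite `x`. -/
noncomputable def qFacE (x : ℕ∞) : ℤ⟦X⟧ := if x = ⊤ then qFacInf else qFac x.toNat

/-- `1 / (q)_x`, for finite or infinite `x`. -/
noncomputable def qFacInvE (x : ℕ∞) : ℤ⟦X⟧ := if x = ⊤ then qFacInfInv else qFacInv x.toNat

/-- The Gaussian polynomial `[2 (M - n) + N + n; N - n]`, for finite or infinite `N` and `M`. -/
noncomputable def gaussE (N M n : ℕ∞) : ℤ⟦X⟧ :=
  qFacE (2 * M + N - n) * qFacInvE (N - n) * qFacInvE (2 * M)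

@[simp] theorem qFacE_coe (n : ℕ) : qFacE n = qFac n := by simp [qFacE]

@[simp] theorem qFacInvE_coe (n : ℕ) : qFacInvE n = qFacInv n := by simp [qFacInvE]

theorem gaussE_coe {N M n : ℕ} (h : n ≤ N) :
    gaussE N M n = gauss (2 * M + N - n) (N - n) := by
  have h1 : (2 * (M : ℕ∞) + N - n) = ((2 * M + N - n : ℕ) : ℕ∞) := by push_cast; rfl
  have h2 : (N : ℕ∞) - n = ((N - n : ℕ) : ℕ∞) := by push_cast; rfl
  have h3 : 2 * (M : ℕ∞) = ((2 * M : ℕ) : ℕ∞) := by push_cast; rfl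
  rw [gaussE, h1, h2, h3, qFacE_coe, qFacInvE_coe, qFacInvE_coe,
    show 2 * M + N - n = (N - n) + 2 * M by omega, gauss_add]

/-- The weight of one partition `n_1 ≥ n_2 ≥ ⋯` with `n_1 ≤ N` and `n_1 + n_2 + ⋯ ≤ M`. -/
noncomputable def levelWeight (e : ℕ) : ℕ∞ → ℕ∞ → List ℕ → ℤ⟦X⟧
  | _, _, [] => 1
  | N, M, n :: l =>
    if (n : ℕ∞) ≤ N ∧ (n : ℕ∞) ≤ M then
      X ^ (n * n - e * n) * gaussE N M n * levelWeight e n (M - n) l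
    else 0

/-- The last part of a partition, or the bound `N` for its parts if there is no part. -/
def lastPart : ℕ∞ → List ℕ → ℕ∞
  | N, [] => N
  | _, n :: l => lastPart n l

/-- The contribution of the partitions that follow the partition `l`. -/
noncomputable def contWith (V : ℕ → ℕ∞ → ℕ∞ → ℤ⟦X⟧) (u : ℕ) (N M : ℕ∞) (l : List ℕ) : ℤ⟦X⟧ :=
  match u with
  | 0 => if lastPart N l ≠ 0 then V 0 (M - (l.sum : ℕ) + 1) (lastPart N l - 1) else 0
  | 1 => if ((l.sum : ℕ) : ℕ∞) < M then
      X ^ (l.getLastD 0) * V 0 (lastPart N l + 1) (M - 1 - (l.sum : ℕ)) else 0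
  | u + 2 => V (u + 1) (M - (l.sum : ℕ)) (lastPart N l)

/-- The condition under which the partition `l` may be the last one. -/
def IsTerminal (u : ℕ) (fs : List ℕ) (N M : ℕ∞) (l : List ℕ) : Prop :=
  u ≤ 1 ∧ ((l.sum : ℕ) : ℕ∞) = M ∧ (fs = [] ∨ lastPart N l = 0)

open scoped Classical in
/-- The weight of a sequence of partitions, of which the first `u` are of the first kind. -/
noncomputable def seqWeight : ℕ → List ℕ → ℕ∞ → ℕ∞ → List (List ℕ) → ℤ⟦X⟧
  | _, [], _, _, _ => 0
  | _, _ :: _, _, _, [] => 0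
  | u, f :: fs, N, M, l :: ν =>
    if l.length = f then
      levelWeight (if u = 0 then 1 else 0) N M l *
        ((if ν = [] ∧ IsTerminal u fs N M l then 1 else 0)
          + contWith (fun u N M => seqWeight u fs N M ν) u N M l)
    else 0

/-- Prepending an element to a list, as an embedding. -/
def consEmbedding (α : Type*) : α × List α ↪ List α where
  toFun z := z.1 :: z.2
  inj' _ _ h := Prod.ext (List.cons.inj h).1 (List.cons.inj h).2

@[simp] theorem consEmbedding_apply {α : Type*} (z : α × List α) :
    consEmbedding α z = z.1 :: z.2 := rfl

/-- The lists of length `f` with entries at most `B`. -/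
def listBox (B : ℕ) : ℕ → Finset (List ℕ)
  | 0 => {[]}
  | f + 1 => ((Finset.range (B + 1)) ×ˢ listBox B f).map
      (consEmbedding _)

/-- The sequences of lists of lengths given by an initial segment of `fs`, with entries at
most `B`. -/
def seqBox (B : ℕ) : List ℕ → Finset (List (List ℕ))
  | [] => {[]}
  | f :: fs => Finset.cons [] ((listBox B f ×ˢ seqBox B fs).map
      (consEmbedding _))
      (by simp)

/-! ### Nested sums over finite boxes -/

theorem mem_listBox {B f : ℕ} {l : List ℕ} :
    l ∈ listBox B f ↔ l.length = f ∧ ∀ n ∈ l, n ≤ B := by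
  induction f generalizing l with
  | zero => simp [listBox]; rintro rfl; simp
  | succ f ih =>
    cases l with
    | nil => simp [listBox]
    | cons n l => simp [listBox, ih]; tauto

theorem nil_mem_seqBox (B : ℕ) (fs : List ℕ) : [] ∈ seqBox B fs := by
  cases fs <;> simp [seqBox]

theorem cons_mem_seqBox {B f : ℕ} {fs l : List ℕ} {ν : List (List ℕ)} :
    l :: ν ∈ seqBox B (f :: fs) ↔ (l.length = f ∧ ∀ n ∈ l, n ≤ B) ∧ ν ∈ seqBox B fs := by
  simp [seqBox, mem_listBox]

theorem sum_listBox_succ (B f : ℕ) (F : List ℕ → ℤ⟦X⟧) :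
    ∑ l ∈ listBox B (f + 1), F l =
      ∑ n ∈ Finset.range (B + 1), ∑ l ∈ listBox B f, F (n :: l) := by
  rw [listBox, Finset.sum_map, Finset.sum_product]
  rfl

theorem sum_seqBox_cons (B f : ℕ) (fs : List ℕ) (F : List (List ℕ) → ℤ⟦X⟧) :
    ∑ ν ∈ seqBox B (f :: fs), F ν =
      F [] + ∑ l ∈ listBox B f, ∑ ν ∈ seqBox B fs, F (l :: ν) := by
  rw [seqBox, Finset.sum_cons, Finset.sum_map, Finset.sum_product]
  rfl

theorem seqWeight_nil (u : ℕ) (fs : List ℕ) (N M : ℕ∞) : seqWeight u fs N M [] = 0 := by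
  cases fs <;> rfl

theorem sum_contWith {ι : Type*} (s : Finset ι) (V : ι → ℕ → ℕ∞ → ℕ∞ → ℤ⟦X⟧) (u : ℕ) (N M : ℕ∞)
    (l : List ℕ) :
    ∑ i ∈ s, contWith (V i) u N M l = contWith (fun u N M => ∑ i ∈ s, V i u N M) u N M l := by
  match u with
  | 0 => simp only [contWith]; split_ifs <;> simp
  | 1 => simp only [contWith]; split_ifs <;> simp [Finset.mul_sum]
  | u + 2 => rfl

open scoped Classical in
-- Splitting off the first partition gives the recursion matched by the generating functions: either
-- the sequence ends there, or its continuation is summed with new bounds.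
theorem sum_seqWeight_cons (B u f : ℕ) (fs : List ℕ) (N M : ℕ∞) :
    ∑ ν ∈ seqBox B (f :: fs), seqWeight u (f :: fs) N M ν =
      ∑ l ∈ listBox B f, levelWeight (if u = 0 then 1 else 0) N M l *
        ((if IsTerminal u fs N M l then 1 else 0)
          + contWith (fun u N M => ∑ ν ∈ seqBox B fs, seqWeight u fs N M ν) u N M l) := by
  rw [sum_seqBox_cons, seqWeight_nil, zero_add]
  refine Finset.sum_congr rfl fun l hl => ?_
  simp only [seqWeight, if_pos (mem_listBox.1 hl).1]
  rw [← Finset.mul_sum, Finset.sum_add_distrib, sum_contWith]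
  congr 2
  rw [Finset.sum_eq_single_of_mem [] (nil_mem_seqBox B fs)]
  · simp
  · intro ν _ hν
    simp [hν]

theorem lastPart_le_of_levelWeight_ne_zero {e : ℕ} {N M : ℕ∞} {l : List ℕ}
    (h : levelWeight e N M l ≠ 0) : lastPart N l ≤ N ∧ ((l.sum : ℕ) : ℕ∞) ≤ M := by
  induction l generalizing N M with
  | nil => simp [lastPart]
  | cons n l ih =>
    rw [levelWeight] at h
    split_ifs at h with h1
    · obtain ⟨h2, h3⟩ := ih (right_ne_zero_of_mul h)
      refine ⟨h2.trans h1.1, ?_⟩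
      rw [List.sum_cons, Nat.cast_add]
      calc (n : ℕ∞) + (l.sum : ℕ) ≤ n + (M - n) := add_le_add_right h3 _
        _ = M := add_tsub_cancel_of_le h1.2
    · exact absurd rfl h

theorem exists_lastPart_eq (N : ℕ) (l : List ℕ) : ∃ n : ℕ, lastPart N l = n := by
  induction l generalizing N with
  | nil => exact ⟨N, rfl⟩
  | cons n l ih => exact ih n

/-- Iterating a recursion of Burge type `f` times: each summation index bounds the next one and is
subtracted from `M`, so the indices form a partition. Any range up to `B ≥ N` may be used because
`levelWeight` vanishes outside the bounds. -/
theorem sum_levelWeight {e B : ℕ} (F : ℕ → ℕ∞ → ℕ∞ → ℤ⟦X⟧)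
    (hF : ∀ f N M : ℕ, F (f + 1) N M = ∑ n ∈ Finset.range (N + 1), if n ≤ M then
      X ^ (n * n - e * n) * gauss (2 * M + N - n) (N - n) * F f n (M - n : ℕ) else 0) (f : ℕ) :
    ∀ N M : ℕ, N ≤ B → F f N M = ∑ l ∈ listBox B f,
      levelWeight e N M l * F 0 (lastPart N l) ((M : ℕ∞) - (l.sum : ℕ)) := by
  induction f with
  | zero =>
    intro N M _
    simp [listBox, levelWeight, lastPart]
  | succ f ih =>
    intro N M hN
    rw [hF, sum_listBox_succ, ← Finset.sum_subset (Finset.range_mono (Nat.succ_le_succ hN))]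
    · refine Finset.sum_congr rfl fun n hn => ?_
      have hn' : n ≤ N := by simpa [Nat.lt_succ_iff] using hn
      split_ifs with hM
      · rw [ih n (M - n) (hn'.trans hN), Finset.mul_sum]
        refine Finset.sum_congr rfl fun l _ => ?_
        rw [levelWeight, if_pos ⟨by exact_mod_cast hn', by exact_mod_cast hM⟩, gaussE_coe hn',
          lastPart, List.sum_cons, ENat.natCast_sub, Nat.cast_add, tsub_add_eq_tsub_tsub]
        ring
      · symm
        refine Finset.sum_eq_zero fun l _ => ?_
        rw [levelWeight, if_neg, zero_mul]
        rintro ⟨-, h⟩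
        exact hM (by exact_mod_cast h)
    · intro n _ hn
      refine Finset.sum_eq_zero fun l _ => ?_
      rw [levelWeight, if_neg, zero_mul]
      rintro ⟨h, -⟩
      have : n ≤ N := by exact_mod_cast h
      exact hn (by simpa [Nat.lt_succ_iff] using this)

/-! ### The finite summation formula -/

/-- Transposition turns `α = 0`, `a = 1` into `a = 0`, `α = 1`, where a part can be removed;
transposing back gives the factor `q ^ n` and lowers `m` by one. -/
theorem pairR_one_zero (n m b β : ℕ) :
    pairR n m 1 b 0 (β + 1) =
      if m = 0 then (if n = 0 then 1 else 0) else X ^ n * pairR n (m - 1) 1 b 1 β := by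
  rw [pairR_transpose (by omega) (by omega)]
  cases m with
  | zero => rw [if_pos rfl, pairR_zero_zero_one]
  | succ m =>
    rw [if_neg (Nat.succ_ne_zero m), pairR_succ_zero_one, pairR_transpose (by omega) (by omega)]
    rfl

/-- The generating function with `a = α = 1`, with shifted argument `N`. -/
noncomputable def shiftR (N M b β : ℕ) : ℤ⟦X⟧ :=
  if N = 0 then (if M = 0 then 1 else 0) else pairR (N - 1) M 1 b 1 β

/-- One Burge step ending at `α = 0`, followed by the removal of a part. Its weight `q ^ (n * n +
n)` is that of `n + 1` on the right, which explains the shifted argument. The new index `0` carries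
the delta at `M = 0`. -/
theorem shiftR_burge (N M b β : ℕ) :
    shiftR N M b (β + 1 + b) = ∑ n ∈ Finset.range (N + 1), if n ≤ M then
      X ^ (n * n - 1 * n) * gauss (2 * M + N - n) (N - n) * shiftR n (M - n) b β else 0 := by
  cases N with
  | zero => simp [shiftR, gauss_zero_right]
  | succ N =>
    rw [shiftR, if_neg (Nat.succ_ne_zero N), Nat.add_sub_cancel, Finset.sum_range_succ']
    have := pairR_burge (a := 1) (b := b) (α := 0) (β := β + 1) (by omega) (by omega) N M
    rw [zero_add] at this
    rw [this]
    have h0 : (if 0 ≤ M then X ^ (0 * 0 - 1 * 0) * gauss (2 * M + (N + 1) - 0) (N + 1 - 0) *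
        shiftR 0 (M - 0) b β else (0 : ℤ⟦X⟧)) = if M = 0 then 1 else 0 := by
      rw [if_pos (Nat.zero_le M), shiftR, if_pos rfl]
      by_cases hM : M = 0
      · subst hM; simp [gauss_self]
      · simp [hM]
    have h1 : (if M = 0 then (1 : ℤ⟦X⟧) else 0)
        = ∑ n ∈ Finset.range (N + 1), if n = 0 ∧ M = 0 then 1 else 0 := by
      rw [Finset.sum_eq_single_of_mem 0 (by simp)]
      · simp
      · intro n _ hn; simp [hn]
    rw [h0, h1, ← Finset.sum_add_distrib]
    refine Finset.sum_congr rfl fun n hn => ?_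
    have hn' : n ≤ N := by simpa [Nat.lt_succ_iff] using hn
    rw [pairR_one_zero, burgeWeight]
    rcases lt_trichotomy n M with h | rfl | h
    · rw [if_pos h.le, if_neg (by omega), if_pos (show n + 1 ≤ M from h), if_neg (by omega),
        shiftR, if_neg (Nat.succ_ne_zero n), Nat.add_sub_cancel,
        show (n + 1) * (n + 1) - 1 * (n + 1) = n * n + n by
          rw [one_mul, Nat.add_mul, one_mul, Nat.add_sub_cancel]; ring,
        show 2 * M + (N + 1) - (n + 1) = 2 * M + N - n by omega,
        show N + 1 - (n + 1) = N - n by omega, show M - n - 1 = M - (n + 1) by omega]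
      ring
    · rw [if_pos le_rfl, if_pos (show n - n = 0 by omega), if_neg (show ¬n + 1 ≤ n by omega), zero_add]
      by_cases hn0 : n = 0
      · subst hn0; simp [gauss_self]
      · simp [hn0]
    · rw [if_neg (by omega), if_neg (by omega), if_neg (by omega)]; ring

/-- The pair of positive integers with continued fraction `(c_1, …, c_{n-1}, c_n + 2)`. -/
def bumpFrac : List ℕ → ℕ × ℕ
  | [] => (1, 1)
  | [c] => (c + 2, 1)
  | c :: c' :: l => (c * (bumpFrac (c' :: l)).1 + (bumpFrac (c' :: l)).2, (bumpFrac (c' :: l)).1)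

theorem bumpFrac_pos (l : List ℕ) : 0 < (bumpFrac l).1 ∧ 0 < (bumpFrac l).2 := by
  induction l with
  | nil => simp [bumpFrac]
  | cons c l ih =>
    cases l with
    | nil => simp [bumpFrac]
    | cons c' l => exact ⟨Nat.add_pos_right _ ih.2, ih.1⟩

/-- A block of `f` steps subtracts `f (b + 1)` from `β`, a division step for the pair `(β + 1, b +
1)`. Transposition then exchanges `b` and `β`, hence the roles of the two bounds, and the next
quotient takes over. -/
theorem shiftR_eq_sum (fs : List ℕ) : ∀ {b β N M B : ℕ}, fs ≠ [] → bumpFrac fs = (β + 1, b + 1) →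
    N + M ≤ B → shiftR N M b β = ∑ ν ∈ seqBox B fs, seqWeight 0 fs N M ν := by
  classical
  induction fs with
  | nil => intro _ _ _ _ _ h; exact absurd rfl h
  | cons f fs ih =>
    intro b β N M B _ hb hB
    obtain ⟨β₀, hβ, hstep⟩ : ∃ β₀, β = β₀ + f * (b + 1) ∧ ∀ l : List ℕ, l ∈ listBox B f →
        levelWeight 1 N M l * shiftR (lastPart N l).toNat ((M : ℕ∞) - (l.sum : ℕ)).toNat b β₀
        = levelWeight 1 N M l * ((if IsTerminal 0 fs N M l then 1 else 0)
          + contWith (fun u N M => ∑ ν ∈ seqBox B fs, seqWeight u fs N M ν) 0 N M l) := by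
      cases fs with
      | nil =>
        rw [bumpFrac, Prod.mk.injEq] at hb
        obtain rfl : b = 0 := by omega
        -- The last quotient is `f + 2`, so `f` steps end at `b = 0`, `β = 1`, where the generating
        -- function is a delta in `M`.
        refine ⟨1, by omega, fun l _ => ?_⟩
        by_cases h0 : levelWeight 1 N M l = 0
        · rw [h0, zero_mul, zero_mul]
        congr 1
        have hsum := (lastPart_le_of_levelWeight_ne_zero h0).2
        have hsum' : l.sum ≤ M := by exact_mod_cast hsum
        rw [show ((M : ℕ∞) - (l.sum : ℕ)) = ((M - l.sum : ℕ) : ℕ∞) by push_cast; rfl,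
          ENat.toNat_natCast]
        have hc : contWith (fun u N M => ∑ ν ∈ seqBox B [], seqWeight u [] N M ν) 0 N M l = 0 := by
          simp [contWith, seqBox, seqWeight]
        have hs : ∀ n, shiftR n (M - l.sum) 0 1 = if M - l.sum = 0 then 1 else 0 := by
          intro n
          rw [shiftR, pairR_one_zero_one_one]
          split_ifs <;> rfl
        rw [hc, hs, add_zero]
        refine if_congr ?_ rfl rfl
        simp only [IsTerminal, true_or, and_true, Nat.zero_le, true_and, Nat.cast_inj]
        omega
      | cons g fs =>
        rw [bumpFrac, Prod.mk.injEq] at hb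
        obtain ⟨β₀, hβ₀⟩ : ∃ β₀, (bumpFrac (g :: fs)).2 = β₀ + 1 :=
          ⟨_, (Nat.succ_pred_eq_of_pos (bumpFrac_pos _).2).symm⟩
        have hb' : bumpFrac (g :: fs) = (b + 1, β₀ + 1) := Prod.ext hb.2 hβ₀
        rw [hb'] at hb
        refine ⟨β₀, by have := hb.1; simp only at this; omega, fun l _ => ?_⟩
        by_cases h0 : levelWeight 1 N M l = 0
        · rw [h0, zero_mul, zero_mul]
        congr 1
        obtain ⟨hlast, hsum⟩ := lastPart_le_of_levelWeight_ne_zero h0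
        have hsum' : l.sum ≤ M := by exact_mod_cast hsum
        obtain ⟨n, hn⟩ := exists_lastPart_eq N l
        rw [hn] at hlast
        have hlast' : n ≤ N := by exact_mod_cast hlast
        rw [show ((M : ℕ∞) - (l.sum : ℕ)) = ((M - l.sum : ℕ) : ℕ∞) by push_cast; rfl,
          ENat.toNat_natCast, hn, ENat.toNat_natCast, contWith, hn]
        cases n with
        | zero =>
          rw [shiftR, if_pos rfl, if_neg (show ¬((0 : ℕ) : ℕ∞) ≠ 0 by simp), add_zero]
          refine if_congr ?_ rfl rfl
          simp only [IsTerminal, hn, Nat.cast_zero, or_true, and_true, Nat.zero_le, true_and,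
            Nat.cast_inj]
          omega
        | succ n =>
          rw [shiftR, if_neg (Nat.succ_ne_zero n), Nat.add_sub_cancel,
            if_pos (show ((n + 1 : ℕ) : ℕ∞) ≠ 0 by exact_mod_cast Nat.succ_ne_zero n), if_neg, zero_add,
            pairR_transpose (by omega) (by omega)]
          -- After transposition, undoing the shift of `shiftR` adds one to the new first bound; the
          -- new second bound is the last part minus one.
          · have := ih (N := M - l.sum + 1) (M := n) (B := B) (by simp) hb' (by omega)
            rw [shiftR, if_neg (Nat.succ_ne_zero _), Nat.add_sub_cancel] at this
            rw [this]
            refine Finset.sum_congr rfl fun ν _ => ?_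
            push_cast
            rfl
          · rintro ⟨-, -, h | h⟩
            · simp at h
            · rw [hn] at h
              exact absurd h (by exact_mod_cast Nat.succ_ne_zero n)
    rw [sum_seqWeight_cons, if_pos rfl, ← Finset.sum_congr rfl hstep, hβ]
    refine sum_levelWeight (e := 1) (B := B) (fun f N M => shiftR N.toNat M.toNat b (β₀ + f * (b + 1)))
      ?_ f N M (by omega) |>.trans ?_
    · intro f N M
      simp only [ENat.toNat_natCast]
      rw [show β₀ + (f + 1) * (b + 1) = (β₀ + f * (b + 1)) + 1 + b by ring, shiftR_burge]
    · simp

/-- The parameters `(a, b, α, β)` of the generating function for given data. -/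
def quad (d : ℕ) (gs : List ℕ) : List ℕ → ℕ × ℕ × ℕ × ℕ
  | [] => (1, (bumpFrac gs).2 - 1, d, (bumpFrac gs).1 + d * ((bumpFrac gs).2 - 1))
  | c :: l => ((quad d gs l).2.2.1, (quad d gs l).2.2.2,
      (quad d gs l).1 + c * (quad d gs l).2.2.1, (quad d gs l).2.1 + c * (quad d gs l).2.2.2)

theorem quad_pos (d : ℕ) (gs l : List ℕ) :
    0 < (quad d gs l).1 + (quad d gs l).2.1 ∧ 0 < (quad d gs l).2.2.1 + (quad d gs l).2.2.2 := by
  induction l with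
  | nil =>
    have := bumpFrac_pos gs
    simp only [quad]
    omega
  | cons c l ih =>
    simp only [quad]
    omega

theorem sum_levelWeight_pairR {a b α β B : ℕ} (hp : 0 < a + b) (hp' : 0 < α + β) (f : ℕ)
    {N M : ℕ} (hN : N ≤ B) :
    pairR N M a b (α + f * a) (β + f * b) = ∑ l ∈ listBox B f, levelWeight 0 N M l *
      pairR (lastPart N l).toNat ((M : ℕ∞) - (l.sum : ℕ)).toNat a b α β := by
  refine (sum_levelWeight (e := 0) (B := B)
    (fun f N M => pairR N.toNat M.toNat a b (α + f * a) (β + f * b)) ?_ f N M hN).trans ?_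
  · intro f N M
    simp only [ENat.toNat_natCast]
    rw [show α + (f + 1) * a = (α + f * a) + a by ring,
      show β + (f + 1) * b = (β + f * b) + b by ring, pairR_burge hp (by omega)]
    refine Finset.sum_congr rfl fun n _ => ?_
    rw [burgeWeight]
    simp
  · simp

theorem lastPart_eq_getLastD (N : ℕ∞) {l : List ℕ} (hl : l ≠ []) :
    lastPart N l = (l.getLastD 0 : ℕ) := by
  induction l generalizing N with
  | nil => exact absurd rfl hl
  | cons n l ih =>
    cases l with
    | nil => rfl
    | cons m l => rw [lastPart, ih _ (by simp)]; rfl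

/-- Each quotient in `l` is a block of Burge steps followed by a transposition, and the block of
length `d` ends at `a = 1`, `α = 0`. There `pairR_one_zero` yields the single factor `q ^ n_{u,d}`
and passes to `shiftR_eq_sum`. -/
theorem pairR_eq_sum {d : ℕ} (hd : 1 ≤ d) (gs : List ℕ) (hgs : gs ≠ []) (l : List ℕ) :
    ∀ {N M B : ℕ}, N + M ≤ B →
      pairR N M (quad d gs l).1 (quad d gs l).2.1 (quad d gs l).2.2.1 (quad d gs l).2.2.2
      = ∑ ν ∈ seqBox B (l ++ d :: gs), seqWeight (l.length + 1) (l ++ d :: gs) N M ν := by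
  classical
  induction l with
  | nil =>
    intro N M B hB
    obtain ⟨b, hb⟩ : ∃ b, (bumpFrac gs).2 = b + 1 :=
      ⟨_, (Nat.succ_pred_eq_of_pos (bumpFrac_pos gs).2).symm⟩
    obtain ⟨β, hβ⟩ : ∃ β, (bumpFrac gs).1 = β + 1 :=
      ⟨_, (Nat.succ_pred_eq_of_pos (bumpFrac_pos gs).1).symm⟩
    simp only [quad, hb, hβ, Nat.add_sub_cancel, List.nil_append, List.length_nil, zero_add]
    have := sum_levelWeight_pairR (a := 1) (b := b) (α := 0) (β := β + 1) (by omega) (by omega) d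
      (N := N) (M := M) (B := B) (by omega)
    rw [zero_add, mul_one] at this
    rw [this, sum_seqWeight_cons, if_neg one_ne_zero]
    refine Finset.sum_congr rfl fun l hl => ?_
    by_cases h0 : levelWeight 0 N M l = 0
    · rw [h0, zero_mul, zero_mul]
    congr 1
    obtain ⟨hlast, hsum⟩ := lastPart_le_of_levelWeight_ne_zero h0
    have hsum' : l.sum ≤ M := by exact_mod_cast hsum
    obtain ⟨n, hn⟩ := exists_lastPart_eq N l
    rw [hn] at hlast
    have hlast' : n ≤ N := by exact_mod_cast hlast
    rw [show ((M : ℕ∞) - (l.sum : ℕ)) = ((M - l.sum : ℕ) : ℕ∞) by push_cast; rfl,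
      ENat.toNat_natCast, hn, ENat.toNat_natCast, contWith, hn, pairR_one_zero]
    -- Since `d ≥ 1`, the bound left by this block is a genuine last part and not the initial `N`.
    have hl0 : l ≠ [] := by
      rintro rfl
      have := (mem_listBox.1 hl).1
      simp at this
      omega
    have hD : l.getLastD 0 = n := by
      have := lastPart_eq_getLastD N hl0
      rw [hn] at this
      exact_mod_cast this.symm
    rcases Nat.eq_or_lt_of_le hsum' with h | h
    · rw [if_pos (by omega), if_neg (show ¬((l.sum : ℕ) : ℕ∞) < M by rw [h]; exact lt_irrefl _),
        add_zero]
      refine if_congr ?_ rfl rfl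
      simp [IsTerminal, hn, h, hgs]
    · rw [if_neg (by omega), if_pos (show ((l.sum : ℕ) : ℕ∞) < M by exact_mod_cast h), if_neg,
        zero_add, hD]
      · have := shiftR_eq_sum gs (N := n + 1) (M := M - l.sum - 1) (B := B) hgs
          (Prod.ext hβ hb) (by omega)
        rw [shiftR, if_neg (Nat.succ_ne_zero _), Nat.add_sub_cancel] at this
        rw [this, show M - l.sum - 1 = M - 1 - l.sum by omega]
        congr 1
      · rintro ⟨-, h', -⟩
        have h' : l.sum = M := by exact_mod_cast h'
        omega
  | cons c l ih =>
    intro N M B hB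
    obtain ⟨h1, h2⟩ := quad_pos d gs l
    have := sum_levelWeight_pairR (N := N) (M := M) (B := B) h2 h1 c (by omega)
    simp only [quad, List.cons_append, List.length_cons]
    rw [this, sum_seqWeight_cons, if_neg (Nat.succ_ne_zero _)]
    refine Finset.sum_congr rfl fun l' _ => ?_
    by_cases h0 : levelWeight 0 N M l' = 0
    · rw [h0, zero_mul, zero_mul]
    congr 1
    obtain ⟨hlast, hsum⟩ := lastPart_le_of_levelWeight_ne_zero h0
    have hsum' : l'.sum ≤ M := by exact_mod_cast hsum
    obtain ⟨n, hn⟩ := exists_lastPart_eq N l'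
    rw [hn] at hlast
    have hlast' : n ≤ N := by exact_mod_cast hlast
    rw [show ((M : ℕ∞) - (l'.sum : ℕ)) = ((M - l'.sum : ℕ) : ℕ∞) by push_cast; rfl,
      ENat.toNat_natCast, hn, ENat.toNat_natCast, pairR_transpose h2 h1, ih (B := B) (by omega), if_neg,
      zero_add, contWith, hn]
    · push_cast
      rfl
    · rintro ⟨h, -⟩
      omega

/-! ### Continuity of the nested sums -/

/-- The only point of `ℕ∞` that is not isolated is `⊤`. -/
theorem continuous_of_tendsto_natCast {Y : Type*} [TopologicalSpace Y] {F : ℕ∞ → Y}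
    (h : Tendsto (fun n : ℕ => F n) atTop (𝓝 (F ⊤))) : Continuous F := by
  rw [continuous_iff_continuousAt]
  intro x
  by_cases hx : x = ⊤
  · subst hx
    intro U hU
    have hU' := h hU
    rw [mem_map, mem_atTop_sets] at hU'
    obtain ⟨n, hn⟩ := hU'
    rw [mem_map]
    filter_upwards [lt_mem_nhds (ENat.natCast_lt_top n)] with y hy
    rw [Set.mem_preimage]
    by_cases hy' : y = ⊤
    · subst hy'; exact mem_of_mem_nhds hU
    · lift y to ℕ using hy'
      have : n < y := by simpa using hy
      exact hn y this.le
  · rw [ContinuousAt, ENat.nhds_eq_pure hx]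
    exact tendsto_pure_nhds _ _

theorem qFacInv_eq (n : ℕ) : qFacInv n = qFacInv (n + 1) - qFacInv (n + 1) * X ^ (n + 1) := by
  have h1 := qFac_mul_qFacInv n
  have h2 := qFac_mul_qFacInv (n + 1)
  rw [qFac_succ] at h2
  linear_combination (qFacInv (n + 1) * (1 - X ^ (n + 1))) * h1 - qFacInv n * h2

/-- Consecutive reciprocals differ by a multiple of `X ^ (n + 1)`, so each coefficient is eventually
constant. -/
theorem coeff_qFacInv {d n : ℕ} (h : d ≤ n) : coeff d (qFacInv n) = coeff d (qFacInv d) := by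
  induction n, h using Nat.le_induction with
  | base => rfl
  | succ n hn ih =>
    rw [← ih, qFacInv_eq n, map_sub, coeff_mul_X_pow', if_neg (by omega), sub_zero]

theorem tendsto_qFacInv : Tendsto qFacInv atTop (𝓝 qFacInfInv) := by
  have h : Tendsto qFacInv atTop (𝓝 (PowerSeries.mk fun d => coeff d (qFacInv d))) := by
    rw [PowerSeries.WithPiTopology.tendsto_iff_coeff_tendsto]
    intro d
    rw [coeff_mk]
    refine tendsto_const_nhds.congr' ?_
    filter_upwards [eventually_ge_atTop d] with n hn
    exact (coeff_qFacInv hn).symm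
  have h1 := tendsto_qFac.mul h
  simp only [qFac_mul_qFacInv] at h1
  have h2 := tendsto_nhds_unique h1 tendsto_const_nhds
  have h3 : (PowerSeries.mk fun d => coeff d (qFacInv d)) = qFacInfInv := by
    linear_combination qFacInfInv * h2
      - (PowerSeries.mk fun d => coeff d (qFacInv d)) * qFacInf_mul_qFacInfInv
  rwa [h3] at h

theorem continuous_qFacE : Continuous qFacE :=
  continuous_of_tendsto_natCast (by
    simp only [qFacE_coe]
    rw [qFacE, if_pos rfl]
    exact tendsto_qFac)

theorem continuous_qFacInvE : Continuous qFacInvE :=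
  continuous_of_tendsto_natCast (by
    simp only [qFacInvE_coe]
    rw [qFacInvE, if_pos rfl]
    exact tendsto_qFacInv)

section

variable {Y : Type*} [TopologicalSpace Y] {N M : Y → ℕ∞}

theorem continuous_gaussE (hN : Continuous N) (hM : Continuous M) (n : ℕ) :
    Continuous fun y => gaussE (N y) (M y) n := by
  have h2 : Continuous fun y => 2 * M y := continuous_const.mul hM
  have hn : ∀ y : Y, (n : ℕ∞) ≠ ⊤ := fun _ => ENat.natCast_ne_top n
  exact ((continuous_qFacE.comp ((h2.add hN).enatSub continuous_const fun y => Or.inr (hn y))).mul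
    (continuous_qFacInvE.comp (hN.enatSub continuous_const fun y => Or.inr (hn y)))).mul
    (continuous_qFacInvE.comp h2)

/-- All case distinctions in the nested sums compare a bound with a finite number, a clopen
condition on `ℕ∞`, so they preserve continuity. -/
theorem continuous_ite_of_isClopen {Z : Type*} [TopologicalSpace Z] {p : Y → Prop}
    [DecidablePred p] (hp : IsClopen {y | p y}) {f g : Y → Z} (hf : Continuous f)
    (hg : Continuous g) : Continuous fun y => if p y then f y else g y :=
  Continuous.if (fun a ha => by simp [hp.frontier_eq] at ha) hf hg

theorem isClopen_natCast_lt (hN : Continuous N) (n : ℕ) : IsClopen {y | (n : ℕ∞) < N y} := by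
  refine ⟨?_, isOpen_lt continuous_const hN⟩
  have : {y | (n : ℕ∞) < N y} = {y | ((n + 1 : ℕ) : ℕ∞) ≤ N y} := by
    ext y
    simp only [Set.mem_ofPred_eq]
    push_cast
    exact (ENat.add_one_le_iff (ENat.natCast_ne_top n)).symm
  rw [this]
  exact isClosed_le continuous_const hN

theorem isClopen_natCast_le (hN : Continuous N) (n : ℕ) : IsClopen {y | (n : ℕ∞) ≤ N y} := by
  cases n with
  | zero => simp [isClopen_univ]
  | succ n =>
    have : {y | ((n + 1 : ℕ) : ℕ∞) ≤ N y} = {y | (n : ℕ∞) < N y} := by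
      ext y
      simp only [Set.mem_ofPred_eq]
      push_cast
      exact ENat.add_one_le_iff (ENat.natCast_ne_top n)
    rw [this]
    exact isClopen_natCast_lt hN n

theorem isClopen_eq_natCast (hN : Continuous N) (n : ℕ) : IsClopen {y | N y = n} :=
  ⟨isClosed_eq hN continuous_const, (ENat.isOpen_singleton (ENat.natCast_ne_top n)).preimage hN⟩

theorem isClopen_const_prop (p : Prop) : IsClopen {_y : Y | p} := by
  by_cases h : p <;> simp [h, isClopen_univ, isClopen_empty]

theorem continuous_levelWeight (e : ℕ) (l : List ℕ) : ∀ {N M : Y → ℕ∞}, Continuous N →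
    Continuous M → Continuous fun y => levelWeight e (N y) (M y) l := by
  induction l with
  | nil => intro N M _ _; exact continuous_const
  | cons n l ih =>
    intro N M hN hM
    refine continuous_ite_of_isClopen (p := fun y => (n : ℕ∞) ≤ N y ∧ (n : ℕ∞) ≤ M y)
      ((isClopen_natCast_le hN n).inter (isClopen_natCast_le hM n))
      ((continuous_const.mul (continuous_gaussE hN hM n)).mul (ih continuous_const ?_))
      continuous_const
    exact hM.enatSub continuous_const fun y => Or.inr (ENat.natCast_ne_top n)

theorem continuous_lastPart (l : List ℕ) (hN : Continuous N) :
    Continuous fun y => lastPart (N y) l := by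
  cases l with
  | nil => exact hN
  | cons n l => exact continuous_const

theorem continuous_contWith {V : ℕ → ℕ∞ → ℕ∞ → ℤ⟦X⟧} (hV : ∀ (u : ℕ) {N M : Y → ℕ∞},
    Continuous N → Continuous M → Continuous fun y => V u (N y) (M y)) (u : ℕ) (l : List ℕ)
    (hN : Continuous N) (hM : Continuous M) :
    Continuous fun y => contWith V u (N y) (M y) l := by
  have hl := continuous_lastPart l hN
  have hs : ∀ y : Y, ((l.sum : ℕ) : ℕ∞) ≠ ⊤ := fun _ => ENat.natCast_ne_top _
  have h1 : ∀ y : Y, (1 : ℕ∞) ≠ ⊤ := fun _ => ENat.one_ne_top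
  match u with
  | 0 =>
    refine continuous_ite_of_isClopen (isClopen_eq_natCast hl 0).compl ?_ continuous_const
    exact hV 0 ((hM.enatSub continuous_const fun y => Or.inr (hs y)).add continuous_const)
      (hl.enatSub continuous_const fun y => Or.inr (h1 y))
  | 1 =>
    refine continuous_ite_of_isClopen (isClopen_natCast_lt hM _) (continuous_const.mul ?_)
      continuous_const
    exact hV 0 (hl.add continuous_const) ((hM.enatSub continuous_const fun y =>
      Or.inr (h1 y)).enatSub continuous_const fun y => Or.inr (hs y))
  | u + 2 => exact hV (u + 1) (hM.enatSub continuous_const fun y => Or.inr (hs y)) hl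

theorem continuous_seqWeight (fs : List ℕ) : ∀ (ν : List (List ℕ)) (u : ℕ) {N M : Y → ℕ∞},
    Continuous N → Continuous M → Continuous fun y => seqWeight u fs (N y) (M y) ν := by
  classical
  induction fs with
  | nil => intro ν u N M _ _; exact continuous_const
  | cons f fs ih =>
    intro ν u N M hN hM
    cases ν with
    | nil => exact continuous_const
    | cons l ν =>
      have hc : IsClopen {y | ν = [] ∧ IsTerminal u fs (N y) (M y) l} := by
        have h1 : IsClopen {y | ((l.sum : ℕ) : ℕ∞) = M y} := by
          simp only [eq_comm (a := ((l.sum : ℕ) : ℕ∞))]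
          exact isClopen_eq_natCast hM _
        have h2 : IsClopen {y | fs = [] ∨ lastPart (N y) l = 0} :=
          (isClopen_const_prop _).union (isClopen_eq_natCast (continuous_lastPart l hN) 0)
        exact (isClopen_const_prop _).inter ((isClopen_const_prop _).inter (h1.inter h2))
      by_cases hl : l.length = f
      · simp only [seqWeight, if_pos hl]
        exact (continuous_levelWeight _ l hN hM).mul (Continuous.add
          (continuous_ite_of_isClopen (p := fun y => ν = [] ∧ IsTerminal u fs (N y) (M y) l) hc
            continuous_const continuous_const)
          (continuous_contWith (ih ν) u l hN hM))
      · simp only [seqWeight, if_neg hl]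
        exact continuous_const

end

/-! ### Finiteness -/

theorem le_of_levelWeight_ne_zero {e : ℕ} {N M : ℕ∞} {l : List ℕ} (h : levelWeight e N M l ≠ 0) :
    ∀ n ∈ l, (n : ℕ∞) ≤ N ∧ (n : ℕ∞) ≤ M := by
  induction l generalizing N M with
  | nil => simp
  | cons m l ih =>
    rw [levelWeight] at h
    split_ifs at h with h1
    · intro n hn
      rcases List.mem_cons.1 hn with rfl | hn
      · exact h1
      · obtain ⟨h2, h3⟩ := ih (right_ne_zero_of_mul h) n hn
        exact ⟨h2.trans h1.1, h3.trans tsub_le_self⟩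
    · exact absurd rfl h

theorem lastPart_le_sum (N : ℕ∞) {l : List ℕ} (hl : l ≠ []) :
    lastPart N l ≤ ((l.sum : ℕ) : ℕ∞) := by
  rw [lastPart_eq_getLastD N hl]
  have : l.getLastD 0 ∈ l := by
    rw [List.getLastD_eq_getLast?, List.getLast?_eq_some_getLast hl]
    exact List.getLast_mem hl
  exact_mod_cast List.single_le_sum (fun _ _ => Nat.zero_le _) _ this

/-- The passage to the next partition moves units between the two bounds but keeps their sum, in
each of the three cases. -/
theorem exists_of_contWith_ne_zero {V : ℕ → ℕ∞ → ℕ∞ → ℤ⟦X⟧} {u : ℕ} {N M : ℕ∞} {l : List ℕ}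
    (h : contWith V u N M l ≠ 0) : ∃ u' N' M', V u' N' M' ≠ 0 ∧
      N' + M' = (M - (l.sum : ℕ)) + lastPart N l := by
  match u with
  | 0 =>
    rw [contWith] at h
    split_ifs at h with h1
    · refine ⟨_, _, _, h, ?_⟩
      rw [add_assoc, add_tsub_cancel_of_le (Order.one_le_iff_ne_zero.2 h1)]
    · exact absurd rfl h
  | 1 =>
    rw [contWith] at h
    split_ifs at h with h1
    · refine ⟨_, _, _, right_ne_zero_of_mul h, ?_⟩
      rw [add_assoc, tsub_right_comm, add_tsub_cancel_of_le, add_comm]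
      exact Order.one_le_iff_ne_zero.2 (tsub_pos_of_lt h1).ne'
    · exact absurd rfl h
  | u + 2 => exact ⟨_, _, _, h, rfl⟩

theorem eq_cons_of_seqWeight_ne_zero {u f : ℕ} {fs : List ℕ} {N M : ℕ∞} {ν : List (List ℕ)}
    (h : seqWeight u (f :: fs) N M ν ≠ 0) : ∃ l ν', ν = l :: ν' ∧ l.length = f ∧
      levelWeight (if u = 0 then 1 else 0) N M l ≠ 0 ∧
      (ν' = [] ∨ contWith (fun u N M => seqWeight u fs N M ν') u N M l ≠ 0) := by
  cases ν with
  | nil => exact absurd rfl h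
  | cons l ν =>
    rw [seqWeight] at h
    by_cases h1 : l.length = f
    · rw [if_pos h1] at h
      refine ⟨l, ν, rfl, h1, left_ne_zero_of_mul h, ?_⟩
      by_cases h2 : ν = []
      · exact Or.inl h2
      · rw [if_neg (show ¬(ν = [] ∧ IsTerminal u fs N M l) from fun h' => h2 h'.1), zero_add] at h
        exact Or.inr (right_ne_zero_of_mul h)
    · exact absurd (if_neg h1) h

/-- The sum of the two bounds never increases along the sequence, so it bounds every part. -/
theorem mem_seqBox_of_add_le {D : ℕ} (fs : List ℕ) : ∀ {u : ℕ} {N M : ℕ∞} {ν : List (List ℕ)},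
    N + M ≤ D → seqWeight u fs N M ν ≠ 0 → ν ∈ seqBox D fs := by
  induction fs with
  | nil => intro u N M ν _ h; exact absurd rfl h
  | cons f fs ih =>
    intro u N M ν hD h
    obtain ⟨l, ν, rfl, hl, hw, h'⟩ := eq_cons_of_seqWeight_ne_zero h
    refine cons_mem_seqBox.2 ⟨⟨hl, fun n hn => ?_⟩, ?_⟩
    · have := ((le_of_levelWeight_ne_zero hw n hn).1.trans le_self_add).trans hD
      exact_mod_cast this
    · rcases h' with rfl | h'
      · exact nil_mem_seqBox _ _
      · obtain ⟨u', N', M', h1, h2⟩ := exists_of_contWith_ne_zero h'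
        refine ih ?_ h1
        rw [h2, add_comm]
        exact (add_le_add (lastPart_le_of_levelWeight_ne_zero hw).1 tsub_le_self).trans hD

/-- The lengths `fs` start with a positive length, if there is more than one. -/
def HeadPos : List ℕ → Prop
  | f :: _ :: _ => 0 < f
  | _ => True

/-- If the first partition is non-empty, its last part is at most its weight, so the sum of the next
bounds is at most `M` even if `N = ⊤`. An empty partition would let an infinite `N` through. -/
theorem mem_seqBox_of_le {D : ℕ} {fs : List ℕ} (hfs : HeadPos fs) {u : ℕ} {N M : ℕ∞}
    {ν : List (List ℕ)} (hD : M ≤ D) (h : seqWeight u fs N M ν ≠ 0) : ν ∈ seqBox D fs := by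
  cases fs with
  | nil => exact absurd rfl h
  | cons f fs =>
    obtain ⟨l, ν, rfl, hl, hw, h'⟩ := eq_cons_of_seqWeight_ne_zero h
    refine cons_mem_seqBox.2 ⟨⟨hl, fun n hn => ?_⟩, ?_⟩
    · have := (le_of_levelWeight_ne_zero hw n hn).2.trans hD
      exact_mod_cast this
    · rcases h' with rfl | h'
      · exact nil_mem_seqBox _ _
      · obtain ⟨u', N', M', h1, h2⟩ := exists_of_contWith_ne_zero h'
        cases fs with
        | nil => exact absurd rfl h1
        | cons g fs =>
          refine mem_seqBox_of_add_le _ ?_ h1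
          have hl0 : l ≠ [] := by
            rintro rfl
            have : 0 < f := hfs
            simp at hl
            omega
          rw [h2]
          refine le_trans (le_trans (add_le_add_right (lastPart_le_sum N hl0) _) ?_) hD
          rw [tsub_add_cancel_of_le (lastPart_le_of_levelWeight_ne_zero hw).2]

theorem mem_seqBox_of_le_left {D f : ℕ} {fs : List ℕ} (hfs : HeadPos fs) {N M : ℕ∞}
    {ν : List (List ℕ)} (hD : N ≤ D) (h : seqWeight 0 (f :: fs) N M ν ≠ 0) :
    ν ∈ seqBox D (f :: fs) := by
  obtain ⟨l, ν, rfl, hl, hw, h'⟩ := eq_cons_of_seqWeight_ne_zero h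
  refine cons_mem_seqBox.2 ⟨⟨hl, fun n hn => ?_⟩, ?_⟩
  · have := (le_of_levelWeight_ne_zero hw n hn).1.trans hD
    exact_mod_cast this
  · rcases h' with rfl | h'
    · exact nil_mem_seqBox _ _
    · rw [contWith] at h'
      split_ifs at h' with h1
      · exact mem_seqBox_of_le hfs ((tsub_le_self.trans
          (lastPart_le_of_levelWeight_ne_zero hw).1).trans hD) h'
      · exact absurd rfl h'

theorem X_pow_dvd_levelWeight {N M : ℕ∞} {l : List ℕ} :
    ∀ n ∈ l, (X : ℤ⟦X⟧) ^ (n * n) ∣ levelWeight 0 N M l := by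
  induction l generalizing N M with
  | nil => simp
  | cons m l ih =>
    intro n hn
    rw [levelWeight]
    split_ifs
    · rcases List.mem_cons.1 hn with rfl | hn
      · rw [zero_mul, Nat.sub_zero, mul_assoc]
        exact dvd_mul_right _ _
      · exact (ih n hn).mul_left _
    · exact dvd_zero _

/-- With no bound at all, the factors `q ^ (n * n)` limit the parts of the first partition modulo `q
^ D`. For `u ≥ 2` its last part bounds the next weight; for `u = 1` it bounds only the next parts,
so one more partition must pass before everything is bounded, and the non-emptiness condition moves
one place further. -/
theorem mem_seqBox_of_not_dvd {D u f : ℕ} {fs : List ℕ} (hu : u ≠ 0) (hf : 0 < f)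
    (hfs : if u = 1 then HeadPos fs.tail else HeadPos fs) {N M : ℕ∞} {ν : List (List ℕ)}
    (h : ¬ (X : ℤ⟦X⟧) ^ D ∣ seqWeight u (f :: fs) N M ν) : ν ∈ seqBox D (f :: fs) := by
  have h0 : seqWeight u (f :: fs) N M ν ≠ 0 := fun h' => h (h' ▸ dvd_zero _)
  obtain ⟨l, ν, rfl, hl, hw, h'⟩ := eq_cons_of_seqWeight_ne_zero h0
  have hlt : ∀ n ∈ l, n < D := by
    intro n hn
    by_contra hnD
    refine h ?_
    rw [seqWeight, if_pos hl, if_neg hu]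
    refine Dvd.dvd.mul_right ((pow_dvd_pow _ ?_).trans (X_pow_dvd_levelWeight n hn)) _
    rcases Nat.eq_zero_or_pos n with rfl | hn0
    · omega
    · exact (not_lt.1 hnD).trans (Nat.le_mul_of_pos_left n hn0)
  have hl0 : l ≠ [] := by
    rintro rfl
    simp at hl
    omega
  have hlast : lastPart N l + 1 ≤ D := by
    rw [lastPart_eq_getLastD N hl0]
    have : l.getLastD 0 ∈ l := by
      rw [List.getLastD_eq_getLast?, List.getLast?_eq_some_getLast hl0]
      exact List.getLast_mem hl0
    exact_mod_cast hlt _ this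
  refine cons_mem_seqBox.2 ⟨⟨hl, fun n hn => (hlt n hn).le⟩, ?_⟩
  rcases h' with rfl | h'
  · exact nil_mem_seqBox _ _
  · match u with
    | 0 => exact absurd rfl hu
    | 1 =>
      rw [contWith] at h'
      split_ifs at h' with h1
      · cases fs with
        | nil => exact absurd (by simp [seqWeight]) h'
        | cons g fs => exact mem_seqBox_of_le_left hfs hlast (right_ne_zero_of_mul h')
      · exact absurd rfl h'
    | u + 2 => exact mem_seqBox_of_le hfs (le_self_add.trans hlast) h'

/-! ### Limits of the nested sums -/

/-- A coefficient of the sum depends on finitely many indices, the same for all `y`, and is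
therefore a finite sum of continuous functions. -/
theorem exists_continuous_hasSum {Y ι : Type*} [TopologicalSpace Y] {F : Y → ι → ℤ⟦X⟧}
    (hF : ∀ i, Continuous fun y => F y i)
    (hfin : ∀ D : ℕ, ∃ s : Finset ι, ∀ y i, i ∉ s → (X : ℤ⟦X⟧) ^ D ∣ F y i) :
    ∃ S : Y → ℤ⟦X⟧, Continuous S ∧ ∀ y, HasSum (F y) (S y) := by
  choose s hs using hfin
  refine ⟨fun y => PowerSeries.mk fun d => ∑ i ∈ s (d + 1), coeff d (F y i), ?_, fun y => ?_⟩
  · rw [continuous_iff_continuousAt]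
    intro y
    rw [ContinuousAt, PowerSeries.WithPiTopology.tendsto_iff_coeff_tendsto]
    intro d
    simp only [coeff_mk]
    refine tendsto_finsetSum _ fun i _ => ?_
    exact ((PowerSeries.WithPiTopology.continuous_coeff ℤ d).comp (hF i)).tendsto y
  · rw [PowerSeries.WithPiTopology.hasSum_iff_hasSum_coeff]
    intro d
    rw [coeff_mk]
    refine hasSum_sum_of_ne_finset_zero fun i hi => ?_
    exact X_pow_dvd_iff.1 (hs (d + 1) y i hi) d (Nat.lt_succ_self d)

/-- The inner limits are the values of `S` on the two edges at infinity, and continuity at the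
corner gives the rest. -/
theorem hasDoubleLimit_of_continuous {F : ℕ → ℕ → ℤ⟦X⟧} {S : ℕ∞ × ℕ∞ → ℤ⟦X⟧} (hS : Continuous S)
    (h : ∀ N M : ℕ, F N M = S (N, M)) : HasDoubleLimit F (S (⊤, ⊤)) := by
  have ht := ENat.tendsto_natCast_nhds_top
  refine ⟨?_, ⟨fun N => S (N, ⊤), fun N => ?_, ?_⟩, ⟨fun M => S (⊤, M), fun M => ?_, ?_⟩⟩
  · simp only [h]
    rw [← prod_atTop_atTop_eq]
    exact (hS.tendsto (⊤, ⊤)).comp ((ht.comp tendsto_fst).prodMk_nhds (ht.comp tendsto_snd))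
  · simp only [h]
    exact (hS.tendsto (N, ⊤)).comp (tendsto_const_nhds.prodMk_nhds ht)
  · exact (hS.tendsto (⊤, ⊤)).comp (ht.prodMk_nhds tendsto_const_nhds)
  · simp only [h]
    exact (hS.tendsto (⊤, M)).comp (ht.prodMk_nhds tendsto_const_nhds)
  · exact (hS.tendsto (⊤, ⊤)).comp (tendsto_const_nhds.prodMk_nhds ht)

theorem hasDoubleLimit_pairR {d : ℕ} (hd : 1 ≤ d) {gs : List ℕ} (hgs : gs ≠ []) {l : List ℕ}
    (hl : HeadPos (l ++ d :: gs))
    (hl' : if l = [] then HeadPos gs.tail else HeadPos (l ++ d :: gs).tail) :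
    ∃ L, HasSum (fun ν => seqWeight (l.length + 1) (l ++ d :: gs) ⊤ ⊤ ν) L ∧
      HasDoubleLimit (fun N M => pairR N M (quad d gs l).1 (quad d gs l).2.1
        (quad d gs l).2.2.1 (quad d gs l).2.2.2) L := by
  obtain ⟨S, hS, hsum⟩ := exists_continuous_hasSum (Y := ℕ∞ × ℕ∞)
    (F := fun z ν => seqWeight (l.length + 1) (l ++ d :: gs) z.1 z.2 ν)
    (fun ν => continuous_seqWeight _ ν _ continuous_fst continuous_snd) (fun D => by
      refine ⟨seqBox D (l ++ d :: gs), fun z ν hν => ?_⟩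
      by_contra hdvd
      refine hν ?_
      cases l with
      | nil =>
        exact mem_seqBox_of_not_dvd (u := 1) one_ne_zero hd (by simpa using hl') hdvd
      | cons c l =>
        refine mem_seqBox_of_not_dvd (u := l.length + 2) (by omega) ?_ ?_ hdvd
        · cases l <;> exact hl
        · rw [if_neg (by omega)]
          simpa using hl')
  refine ⟨_, hsum (⊤, ⊤), hasDoubleLimit_of_continuous hS fun N M => ?_⟩
  -- For finite `N` and `M` the infinite family is supported in the box of size `N + M`, so its sum
  -- is the finite formula.
  rw [pairR_eq_sum hd gs hgs l (le_refl (N + M))]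
  refine HasSum.unique (hasSum_sum_of_ne_finset_zero fun ν hν => ?_) (hsum (N, M))
  by_contra h
  exact hν (mem_seqBox_of_add_le _ (by push_cast; exact le_rfl) h)

/-! ### The nested sums in closed form -/

/-- The part before the part with index `i` (counted from `0`). -/
def prevPart (N : ℕ∞) (l : List ℕ) (i : ℕ) : ℕ∞ := if i = 0 then N else (l.getD (i - 1) 0 : ℕ)

/-- The exponent in `levelWeight`. -/
def levelExp (e : ℕ) (l : List ℕ) : ℕ :=
  ∑ i ∈ Finset.range l.length, (l.getD i 0 * l.getD i 0 - e * l.getD i 0)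

/-- The product of Gaussian polynomials in `levelWeight`. -/
noncomputable def levelGauss (N M : ℕ∞) (l : List ℕ) : ℤ⟦X⟧ :=
  ∏ i ∈ Finset.range l.length,
    gaussE (prevPart N l i) (M - ((l.take i).sum : ℕ)) (l.getD i 0 : ℕ)

/-- The partition `l` has parts at most `N` and weight at most `M`. -/
structure IsLevel (N M : ℕ∞) (l : List ℕ) : Prop where
  sorted : l.Pairwise (· ≥ ·)
  le_bound : ∀ a ∈ l, (a : ℕ∞) ≤ N
  wt_le : ((l.sum : ℕ) : ℕ∞) ≤ M

theorem isLevel_cons {N M : ℕ∞} {n : ℕ} {l : List ℕ} :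
    IsLevel N M (n :: l) ↔ ((n : ℕ∞) ≤ N ∧ (n : ℕ∞) ≤ M) ∧ IsLevel n (M - n) l := by
  constructor
  · rintro ⟨h1, h2, h3⟩
    rw [List.pairwise_cons] at h1
    rw [List.sum_cons, Nat.cast_add] at h3
    refine ⟨⟨h2 n (by simp), le_self_add.trans h3⟩, h1.2, fun a ha => ?_, ?_⟩
    · exact_mod_cast h1.1 a ha
    · exact ENat.le_sub_of_add_le_left (ENat.natCast_ne_top n) h3
  · rintro ⟨⟨h1, h2⟩, h3, h4, h5⟩
    refine ⟨List.pairwise_cons.2 ⟨fun a ha => by exact_mod_cast h4 a ha, h3⟩, fun a ha => ?_, ?_⟩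
    · rcases List.mem_cons.1 ha with rfl | ha
      · exact h1
      · exact (h4 a ha).trans h1
    · rw [List.sum_cons, Nat.cast_add]
      calc (n : ℕ∞) + (l.sum : ℕ) ≤ n + (M - n) := add_le_add_right h5 _
        _ = M := add_tsub_cancel_of_le h2

open scoped Classical in
theorem levelWeight_eq (e : ℕ) (l : List ℕ) : ∀ (N M : ℕ∞), levelWeight e N M l =
    if IsLevel N M l then X ^ levelExp e l * levelGauss N M l else 0 := by
  induction l with
  | nil =>
    intro N M
    rw [if_pos ⟨List.Pairwise.nil, by simp, by simp⟩]
    simp [levelWeight, levelExp, levelGauss]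
  | cons n l ih =>
    intro N M
    rw [levelWeight, ih]
    by_cases h1 : (n : ℕ∞) ≤ N ∧ (n : ℕ∞) ≤ M
    · by_cases h2 : IsLevel n (M - n) l
      · rw [if_pos h1, if_pos h2, if_pos (isLevel_cons.2 ⟨h1, h2⟩)]
        have hE : levelExp e (n :: l) = levelExp e l + (n * n - e * n) := by
          rw [levelExp, List.length_cons, Finset.sum_range_succ']
          rfl
        have hG : levelGauss N M (n :: l) = levelGauss n (M - n) l * gaussE N M n := by
          rw [levelGauss, List.length_cons, Finset.prod_range_succ', levelGauss]
          congr 1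
          · refine Finset.prod_congr rfl fun i _ => ?_
            congr 1
            · cases i <;> simp [prevPart]
            · rw [List.take_succ_cons, List.sum_cons, Nat.cast_add, tsub_add_eq_tsub_tsub]
          · simp [prevPart]
        rw [hE, hG, pow_add]
        ring
      · rw [if_pos h1, if_neg h2, if_neg fun h => h2 (isLevel_cons.1 h).2, mul_zero]
    · rw [if_neg h1, if_neg fun h => h1 (isLevel_cons.1 h).1]

/-! ### Bounds and admissibility with general initial values -/

theorem add_one_sub_natCast {M : ℕ∞} {n : ℕ} (h : (n : ℕ∞) ≤ M) : M + 1 - n = M - n + 1 := by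
  induction M using ENat.recTopCoe with
  | top => simp
  | coe M =>
    have h : n ≤ M := by exact_mod_cast h
    norm_cast
    omega

/-- The pair `(w_k, n_{k,0})`, with general initial values. -/
def boundsFrom (w₁ n₁ : ℕ∞) (f : ℕ → ℕ) (u : ℕ) (ν : List (List ℕ)) : ℕ → ℕ∞ × ℕ∞
  | 0 => (⊤, ⊤)
  | 1 => (w₁, n₁)
  | k + 2 =>
    let w : ℕ∞ := (boundsFrom w₁ n₁ f u ν (k + 1)).1
    let n₀ : ℕ∞ := (boundsFrom w₁ n₁ f u ν (k + 1)).2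
    let W : ℕ∞ := ((nth ν (k + 1)).sum : ℕ)
    let last : ℕ∞ := if f (k + 1) = 0 then n₀ else (part ν (k + 1) (f (k + 1)) : ℕ)
    if k + 2 ≤ u then (last, w - W)
    else if k + 2 = u + 1 then (w - 1 - W, last + 1)
    else (last - 1, w + 1 - W)

/-- The last part `n_{k,f_k}`, with `n_{k,0}` read as the bound for the parts. -/
def lastFrom (w₁ n₁ : ℕ∞) (f : ℕ → ℕ) (u : ℕ) (ν : List (List ℕ)) (k : ℕ) : ℕ∞ :=
  if f k = 0 then (boundsFrom w₁ n₁ f u ν k).2 else (part ν k (f k) : ℕ)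

theorem nth_cons_succ (l : List ℕ) (ν : List (List ℕ)) (k : ℕ) :
    nth (l :: ν) (k + 2) = nth ν (k + 1) := rfl

theorem boundsFrom_succ_succ (w₁ n₁ : ℕ∞) (f : ℕ → ℕ) (u : ℕ) (ν : List (List ℕ)) (k : ℕ) :
    boundsFrom w₁ n₁ f u ν (k + 2) =
      if k + 2 ≤ u then
        (lastFrom w₁ n₁ f u ν (k + 1),
          (boundsFrom w₁ n₁ f u ν (k + 1)).1 - ((nth ν (k + 1)).sum : ℕ))
      else if k + 2 = u + 1 then
        ((boundsFrom w₁ n₁ f u ν (k + 1)).1 - 1 - ((nth ν (k + 1)).sum : ℕ),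
          lastFrom w₁ n₁ f u ν (k + 1) + 1)
      else (lastFrom w₁ n₁ f u ν (k + 1) - 1,
        (boundsFrom w₁ n₁ f u ν (k + 1)).1 + 1 - ((nth ν (k + 1)).sum : ℕ)) := rfl

/-- Deleting the first partition restarts the same recursion from the bounds it leaves behind. This
is why general initial values are needed for the induction in `seqWeight_eq`. -/
theorem boundsFrom_cons (w₁ n₁ : ℕ∞) (f : ℕ → ℕ) (u : ℕ) (l : List ℕ) (ν : List (List ℕ))
    (k : ℕ) : boundsFrom w₁ n₁ f u (l :: ν) (k + 2) =
      boundsFrom (boundsFrom w₁ n₁ f u (l :: ν) 2).1 (boundsFrom w₁ n₁ f u (l :: ν) 2).2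
        (fun i => f (i + 1)) (u - 1) ν (k + 1) := by
  induction k with
  | zero => rfl
  | succ k ih =>
    have h1 : (k + 1 + 2 ≤ u) = (k + 2 ≤ u - 1) := by rw [eq_iff_iff]; omega
    have h2 : (k + 1 + 2 = u + 1) = (k + 2 = u - 1 + 1) := by rw [eq_iff_iff]; omega
    refine (boundsFrom_succ_succ w₁ n₁ f u (l :: ν) (k + 1)).trans
      (Eq.trans ?_ (boundsFrom_succ_succ _ _ _ _ _ k).symm)
    simp only [h1, h2, lastFrom, part, nth_cons_succ, ih]

theorem lastFrom_cons (w₁ n₁ : ℕ∞) (f : ℕ → ℕ) (u : ℕ) (l : List ℕ) (ν : List (List ℕ))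
    (k : ℕ) : lastFrom w₁ n₁ f u (l :: ν) (k + 2) =
      lastFrom (boundsFrom w₁ n₁ f u (l :: ν) 2).1 (boundsFrom w₁ n₁ f u (l :: ν) 2).2
        (fun i => f (i + 1)) (u - 1) ν (k + 1) := by
  rw [lastFrom, boundsFrom_cons, lastFrom]
  rfl

theorem lastFrom_one (w₁ n₁ : ℕ∞) (f : ℕ → ℕ) (u : ℕ) (l : List ℕ) (ν : List (List ℕ))
    (h : l.length = f 1) : lastFrom w₁ n₁ f u (l :: ν) 1 = lastPart n₁ l := by
  rw [lastFrom, ← h]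
  cases l with
  | nil => rfl
  | cons n l =>
    rw [if_neg (by simp), lastPart_eq_getLastD _ (by simp)]
    simp [part, nth, List.getD_eq_getElem?_getD, List.getLastD_eq_getLast?,
      List.getLast?_eq_getElem?]

/-- The admissible sequences of partitions, with general initial values. -/
structure AdmissibleFrom (w₁ n₁ : ℕ∞) (T : ℕ) (f : ℕ → ℕ) (u : ℕ) (ν : List (List ℕ)) :
    Prop where
  ne_nil : ν ≠ []
  le_x : u ≤ ν.length
  x_le : ν.length ≤ T
  level : ∀ k, 1 ≤ k → k ≤ ν.length → (nth ν k).length = f k ∧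
    IsLevel (boundsFrom w₁ n₁ f u ν k).2 (boundsFrom w₁ n₁ f u ν k).1 (nth ν k)
  wt_last : (((nth ν ν.length).sum : ℕ) : ℕ∞) = (boundsFrom w₁ n₁ f u ν ν.length).1
  wt_lt : u < ν.length → (((nth ν u).sum : ℕ) : ℕ∞) < (boundsFrom w₁ n₁ f u ν u).1
  pos : ∀ k, u < k → k < ν.length → lastFrom w₁ n₁ f u ν k ≠ 0
  last_eq_zero : ν.length < T → lastFrom w₁ n₁ f u ν ν.length = 0

theorem admissibleFrom_singleton {w₁ n₁ : ℕ∞} {T : ℕ} {f : ℕ → ℕ} {u : ℕ} {l : List ℕ} :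
    AdmissibleFrom w₁ n₁ (T + 1) f u [l] ↔ (l.length = f 1 ∧ IsLevel n₁ w₁ l) ∧
      u ≤ 1 ∧ ((l.sum : ℕ) : ℕ∞) = w₁ ∧ (T = 0 ∨ lastFrom w₁ n₁ f u [l] 1 = 0) := by
  constructor
  · intro h
    refine ⟨h.level 1 le_rfl le_rfl, h.le_x, h.wt_last, ?_⟩
    rcases Nat.eq_zero_or_pos T with hT | hT
    · exact Or.inl hT
    · exact Or.inr (h.last_eq_zero (by simpa using hT))
  · rintro ⟨h1, h2, h3, h4⟩
    refine ⟨by simp, h2, by simp, ?_, h3, ?_, ?_, ?_⟩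
    · intro k hk hk'
      obtain rfl : k = 1 := le_antisymm hk' hk
      exact h1
    · intro hu
      obtain rfl : u = 0 := by simpa using hu
      exact ENat.natCast_lt_top _
    · intro k hk hk'
      simp at hk'
      omega
    · intro hT
      rcases h4 with rfl | h4
      · simp at hT
      · exact h4

theorem admissibleFrom_cons {w₁ n₁ : ℕ∞} {T : ℕ} {f : ℕ → ℕ} {u : ℕ} {l : List ℕ}
    {ν : List (List ℕ)} (hν : ν ≠ []) :
    AdmissibleFrom w₁ n₁ (T + 1) f u (l :: ν) ↔ (l.length = f 1 ∧ IsLevel n₁ w₁ l) ∧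
      (u = 0 → lastFrom w₁ n₁ f u (l :: ν) 1 ≠ 0) ∧ (u = 1 → ((l.sum : ℕ) : ℕ∞) < w₁) ∧
      AdmissibleFrom (boundsFrom w₁ n₁ f u (l :: ν) 2).1 (boundsFrom w₁ n₁ f u (l :: ν) 2).2
        T (fun i => f (i + 1)) (u - 1) ν := by
  obtain ⟨x, hx⟩ : ∃ x, ν.length = x + 1 :=
    ⟨_, (Nat.succ_pred_eq_of_pos (List.length_pos_iff.2 hν)).symm⟩
  constructor
  · intro h
    have hx' : (l :: ν).length = x + 2 := by rw [List.length_cons, hx]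
    refine ⟨h.level 1 le_rfl (by omega), fun hu => h.pos 1 (by omega) (by omega), ?_, hν, ?_, ?_,
      ?_, ?_, ?_, ?_, ?_⟩
    · rintro rfl
      exact h.wt_lt (by omega)
    · have := h.le_x; omega
    · have := h.x_le; omega
    · intro k hk hk'
      obtain ⟨k, rfl⟩ := Nat.exists_eq_add_of_le' hk
      have := h.level (k + 2) (by omega) (by omega)
      rwa [boundsFrom_cons, nth_cons_succ] at this
    · have := h.wt_last
      rw [hx', boundsFrom_cons, nth_cons_succ] at this
      rwa [hx]
    · intro hu
      match u with
      | 0 => exact ENat.natCast_lt_top _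
      | 1 => exact ENat.natCast_lt_top _
      | u + 2 =>
        have := h.wt_lt (by omega)
        rwa [boundsFrom_cons, nth_cons_succ] at this
    · intro k hk hk'
      obtain ⟨k, rfl⟩ := Nat.exists_eq_add_of_le' (show 1 ≤ k by omega)
      have := h.pos (k + 2) (by omega) (by omega)
      rwa [lastFrom_cons] at this
    · intro hT
      have := h.last_eq_zero (by omega)
      rw [hx', lastFrom_cons] at this
      rwa [hx]
  · rintro ⟨h1, h2, h3, h⟩
    have hx' : (l :: ν).length = x + 2 := by rw [List.length_cons, hx]
    refine ⟨by simp, ?_, ?_, ?_, ?_, ?_, ?_, ?_⟩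
    · have := h.le_x; omega
    · have := h.x_le; omega
    · intro k hk hk'
      rcases Nat.lt_or_ge 1 k with hk1 | hk1
      · obtain ⟨k, rfl⟩ := Nat.exists_eq_add_of_le' (show 2 ≤ k by omega)
        rw [boundsFrom_cons, nth_cons_succ]
        exact h.level (k + 1) (by omega) (by omega)
      · obtain rfl : k = 1 := le_antisymm hk1 hk
        exact h1
    · rw [hx', boundsFrom_cons, nth_cons_succ]
      have := h.wt_last
      rwa [hx] at this
    · intro hu
      match u with
      | 0 => exact ENat.natCast_lt_top _
      | 1 => exact h3 rfl
      | u + 2 =>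
        rw [boundsFrom_cons, nth_cons_succ]
        exact h.wt_lt (by omega)
    · intro k hk hk'
      rcases Nat.lt_or_ge 1 k with hk1 | hk1
      · obtain ⟨k, rfl⟩ := Nat.exists_eq_add_of_le' (show 2 ≤ k by omega)
        rw [lastFrom_cons]
        exact h.pos (k + 1) (by omega) (by omega)
      · obtain rfl : k = 1 := by omega
        exact h2 (by omega)
    · intro hT
      rw [hx', lastFrom_cons]
      have := h.last_eq_zero (by omega)
      rwa [hx] at this

/-- The factor of the summand that belongs to the `k`-th partition. -/
noncomputable def levelTerm (w₁ n₁ : ℕ∞) (f : ℕ → ℕ) (u : ℕ) (ν : List (List ℕ)) (k : ℕ) : ℤ⟦X⟧ :=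
  X ^ levelExp (if k ≤ u then 0 else 1) (nth ν k) *
    levelGauss (boundsFrom w₁ n₁ f u ν k).2 (boundsFrom w₁ n₁ f u ν k).1 (nth ν k)

/-- The summand that belongs to a sequence of partitions. -/
noncomputable def seqTerm (w₁ n₁ : ℕ∞) (f : ℕ → ℕ) (u : ℕ) (ν : List (List ℕ)) : ℤ⟦X⟧ :=
  (if u = 0 then 1 else X ^ (nth ν u).getLastD 0) *
    ∏ k ∈ Finset.range ν.length, levelTerm w₁ n₁ f u ν (k + 1)

theorem levelTerm_cons (w₁ n₁ : ℕ∞) (f : ℕ → ℕ) (u : ℕ) (l : List ℕ) (ν : List (List ℕ))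
    (k : ℕ) : levelTerm w₁ n₁ f u (l :: ν) (k + 2) =
      levelTerm (boundsFrom w₁ n₁ f u (l :: ν) 2).1 (boundsFrom w₁ n₁ f u (l :: ν) 2).2
        (fun i => f (i + 1)) (u - 1) ν (k + 1) := by
  rw [levelTerm, boundsFrom_cons, nth_cons_succ, levelTerm]
  have h1 : (k + 2 ≤ u) = (k + 1 ≤ u - 1) := by rw [eq_iff_iff]; omega
  simp only [h1]

theorem seqTerm_cons (w₁ n₁ : ℕ∞) (f : ℕ → ℕ) (u : ℕ) (l : List ℕ) (ν : List (List ℕ)) :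
    seqTerm w₁ n₁ f u (l :: ν) = X ^ levelExp (if u = 0 then 1 else 0) l * levelGauss n₁ w₁ l *
      ((if u = 1 then X ^ l.getLastD 0 else 1) *
        seqTerm (boundsFrom w₁ n₁ f u (l :: ν) 2).1 (boundsFrom w₁ n₁ f u (l :: ν) 2).2
          (fun i => f (i + 1)) (u - 1) ν) := by
  have h1 : levelTerm w₁ n₁ f u (l :: ν) (0 + 1)
      = X ^ levelExp (if u = 0 then 1 else 0) l * levelGauss n₁ w₁ l := by
    rw [levelTerm]
    have : (if 0 + 1 ≤ u then 0 else 1) = if u = 0 then 1 else 0 := by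
      split_ifs <;> omega
    rw [this]
    rfl
  have h2 : (if u = 0 then (1 : ℤ⟦X⟧) else X ^ (nth (l :: ν) u).getLastD 0) =
      (if u = 1 then X ^ l.getLastD 0 else 1) *
        (if u - 1 = 0 then 1 else X ^ (nth ν (u - 1)).getLastD 0) := by
    match u with
    | 0 => simp
    | 1 => simp [nth]
    | u + 2 => simp [nth_cons_succ]
  rw [seqTerm, List.length_cons, Finset.prod_range_succ', h1, h2, seqTerm,
    Finset.prod_congr rfl fun k _ => levelTerm_cons w₁ n₁ f u l ν k]
  ring

/-- The list `f 1, …, f T`. -/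
def lengths (f : ℕ → ℕ) : ℕ → List ℕ
  | 0 => []
  | T + 1 => f 1 :: lengths (fun i => f (i + 1)) T
termination_by structural T => T

open scoped Classical in
-- Unfolds the nested recursion one partition at a time: its tests are the clauses of admissibility,
-- and its factors are the level terms. The hypothesis on `u` excludes a sequence ending with the
-- `u`-th partition for lack of further lengths.
theorem seqWeight_eq (T : ℕ) : ∀ (f : ℕ → ℕ) (u : ℕ) (w₁ n₁ : ℕ∞) (ν : List (List ℕ)),
    (u = 0 ∨ u < T) → seqWeight u (lengths f T) n₁ w₁ ν =
      if AdmissibleFrom w₁ n₁ T f u ν then seqTerm w₁ n₁ f u ν else 0 := by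
  induction T with
  | zero =>
    intro f u w₁ n₁ ν _
    rw [if_neg]
    · rfl
    · intro h
      exact h.ne_nil (List.length_eq_zero_iff.1 (Nat.le_zero.1 h.x_le))
  | succ T ih =>
    intro f u w₁ n₁ ν hu
    cases ν with
    | nil =>
      rw [seqWeight_nil, if_neg]
      exact fun h => h.ne_nil rfl
    | cons l ν =>
      rw [lengths, seqWeight]
      by_cases hl : l.length = f 1
      swap
      · rw [if_neg hl, if_neg]
        exact fun h => hl (h.level 1 le_rfl (by simp)).1
      rw [if_pos hl, levelWeight_eq]
      by_cases hlev : IsLevel n₁ w₁ l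
      swap
      · rw [if_neg hlev, zero_mul, if_neg]
        exact fun h => hlev (h.level 1 le_rfl (by simp)).2
      rw [if_pos hlev, seqTerm_cons]
      have hlast := lastFrom_one w₁ n₁ f u l ν hl
      by_cases hν : ν = []
      · subst hν
        have hc : contWith (fun u N M => seqWeight u (lengths (fun i => f (i + 1)) T) N M []) u
            n₁ w₁ l = 0 := by
          match u with
          | 0 => simp [contWith, seqWeight_nil]
          | 1 => simp [contWith, seqWeight_nil]
          | u + 2 => simp [contWith, seqWeight_nil]
        rw [hc, add_zero]
        have hiff : ([] = ([] : List (List ℕ)) ∧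
            IsTerminal u (lengths (fun i => f (i + 1)) T) n₁ w₁ l) ↔
            AdmissibleFrom w₁ n₁ (T + 1) f u [l] := by
          rw [admissibleFrom_singleton, hlast, IsTerminal]
          have : lengths (fun i => f (i + 1)) T = [] ↔ T = 0 := by
            cases T <;> simp [lengths]
          rw [this]
          exact ⟨fun h => ⟨⟨hl, hlev⟩, h.2⟩, fun h => ⟨rfl, h.2⟩⟩
        by_cases h : AdmissibleFrom w₁ n₁ (T + 1) f u [l]
        · rw [if_pos (hiff.2 h), if_pos h]
          -- A sequence ending at the `u`-th partition gets no factor `q ^ n_{u,d}` in the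
          -- recursion. None is missing, because the partition then has last part `0`.
          have hd : (if u = 1 then (X : ℤ⟦X⟧) ^ l.getLastD 0 else 1) = 1 := by
            split_ifs with hu1
            · subst hu1
              have h0 := ((hiff.2 h).2.2.2).resolve_left (by
                cases T with
                | zero => omega
                | succ T => simp [lengths])
              cases l with
              | nil => simp
              | cons n l =>
                rw [lastPart_eq_getLastD _ (by simp)] at h0
                have h0 : (n :: l).getLastD 0 = 0 := by exact_mod_cast h0
                rw [h0, pow_zero]
            · rfl
          have hu1 : u - 1 = 0 := by
            have := h.le_x
            simp at this
            omega
          rw [hd, seqTerm, hu1]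
          simp
        · rw [if_neg fun h' => h (hiff.1 h'), if_neg h, mul_zero]
      · rw [if_neg (show ¬(ν = [] ∧ IsTerminal u (lengths (fun i => f (i + 1)) T) n₁ w₁ l) from
          fun h => hν h.1), zero_add]
        have hadm := admissibleFrom_cons (w₁ := w₁) (n₁ := n₁) (T := T) (f := f) (u := u) (l := l) hν
        rw [hlast] at hadm
        match u with
        | 0 =>
          have hb : boundsFrom w₁ n₁ f 0 (l :: ν) 2
              = (lastPart n₁ l - 1, w₁ - (l.sum : ℕ) + 1) := by
            rw [boundsFrom_succ_succ _ _ _ _ _ 0, zero_add, hlast, if_neg (by norm_num),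
              if_neg (by norm_num)]
            exact congrArg _ (add_one_sub_natCast hlev.wt_le)
          rw [hb] at hadm ⊢
          rw [contWith]
          rw [ih _ 0 _ _ ν (Or.inl rfl)]
          by_cases h0 : lastPart n₁ l = 0
          · rw [if_neg (not_not.2 h0), if_neg fun h => (hadm.1 h).2.1 rfl h0, mul_zero]
          · rw [if_pos h0]
            by_cases h : AdmissibleFrom (lastPart n₁ l - 1) (w₁ - (l.sum : ℕ) + 1) T
                (fun i => f (i + 1)) 0 ν
            · rw [if_pos h, if_pos (hadm.2 ⟨⟨hl, hlev⟩, fun _ => h0, by simp, h⟩)]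
              simp
            · rw [if_neg h, if_neg fun h' => h (hadm.1 h').2.2.2, mul_zero]
        | 1 =>
          have hb : boundsFrom w₁ n₁ f 1 (l :: ν) 2
              = (w₁ - 1 - (l.sum : ℕ), lastPart n₁ l + 1) := by
            rw [boundsFrom_succ_succ _ _ _ _ _ 0, zero_add, hlast, if_neg (by norm_num),
              if_pos (by norm_num)]
            rfl
          rw [hb] at hadm ⊢
          rw [contWith]
          rw [ih _ 0 _ _ ν (Or.inl rfl)]
          by_cases h0 : ((l.sum : ℕ) : ℕ∞) < w₁
          · rw [if_pos h0]
            by_cases h : AdmissibleFrom (w₁ - 1 - (l.sum : ℕ)) (lastPart n₁ l + 1) T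
                (fun i => f (i + 1)) 0 ν
            · rw [if_pos h, if_pos (hadm.2 ⟨⟨hl, hlev⟩, by simp, fun _ => h0, h⟩)]
              simp
            · rw [if_neg h, if_neg fun h' => h (hadm.1 h').2.2.2, mul_zero, mul_zero]
          · rw [if_neg h0, if_neg fun h => h0 ((hadm.1 h).2.2.1 rfl), mul_zero]
        | u + 2 =>
          have hb : boundsFrom w₁ n₁ f (u + 2) (l :: ν) 2
              = (lastPart n₁ l, w₁ - (l.sum : ℕ)) := by
            rw [boundsFrom_succ_succ _ _ _ _ _ 0, zero_add, hlast, if_pos (by omega)]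
            rfl
          rw [hb] at hadm ⊢
          rw [contWith]
          rw [ih _ (u + 1) _ _ ν (Or.inr (by omega))]
          by_cases h : AdmissibleFrom (lastPart n₁ l) (w₁ - (l.sum : ℕ)) T
              (fun i => f (i + 1)) (u + 1) ν
          · rw [if_pos h, if_pos (hadm.2 ⟨⟨hl, hlev⟩, by simp, by simp, h⟩)]
            simp
          · rw [if_neg h, if_neg fun h' => h (hadm.1 h').2.2.2, mul_zero]

/-! ### The summands of the limit -/

section Summands

variable {t : ℕ} {c : ℕ → ℕ} {u d : ℕ} {ν : List (List ℕ)}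

theorem bounds_eq (c : ℕ → ℕ) (u d : ℕ) (ν : List (List ℕ)) : ∀ k,
    bounds c u d ν k = boundsFrom ⊤ ⊤ (fSeq c u d) u ν k
  | 0 => rfl
  | 1 => rfl
  | k + 2 => by rw [bounds, boundsFrom, bounds_eq c u d ν (k + 1)]

theorem n_zero (k : ℕ) : n c u d ν k 0 = (bounds c u d ν k).2 := rfl

theorem n_succ (k i : ℕ) : n c u d ν k (i + 1) = (part ν k (i + 1) : ℕ) := rfl

theorem n_ne_top {k i : ℕ} (hi : 1 ≤ i) : n c u d ν k i ≠ ⊤ := by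
  rw [n, if_neg (by omega)]
  exact ENat.natCast_ne_top _

theorem n_fSeq (k : ℕ) : n c u d ν k (fSeq c u d k) = lastFrom ⊤ ⊤ (fSeq c u d) u ν k := by
  rw [n, lastFrom, bounds_eq]

theorem bounds_succ_succ (k : ℕ) : bounds c u d ν (k + 2) =
    if k + 2 ≤ u then
      (n c u d ν (k + 1) (fSeq c u d (k + 1)), w c u d ν (k + 1) - ((nth ν (k + 1)).sum : ℕ))
    else if k + 2 = u + 1 then
      (w c u d ν (k + 1) - 1 - ((nth ν (k + 1)).sum : ℕ),
        n c u d ν (k + 1) (fSeq c u d (k + 1)) + 1)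
    else (n c u d ν (k + 1) (fSeq c u d (k + 1)) - 1,
      w c u d ν (k + 1) + 1 - ((nth ν (k + 1)).sum : ℕ)) := rfl

theorem admissible_iff (hu : 1 ≤ u) :
    Admissible t c u d ν ↔ AdmissibleFrom ⊤ ⊤ (t + 1) (fSeq c u d) u ν := by
  constructor
  · intro h
    refine ⟨?_, h.le_x, h.x_le, fun k hk hk' => ⟨h.length_eq k hk hk', h.sorted k hk hk', ?_, ?_⟩,
      ?_, ?_, ?_, ?_⟩
    · rintro rfl
      have := h.le_x
      simp at this
      omega
    · rw [← bounds_eq]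
      exact h.le_bound k hk hk'
    · rw [← bounds_eq]
      exact h.wt_le k hk hk'
    · rw [← bounds_eq]
      exact h.wt_last
    · rw [← bounds_eq]
      exact h.wt_lt
    · intro k hk hk'
      rw [← n_fSeq]
      exact (h.pos k hk hk').ne'
    · rw [← n_fSeq]
      exact h.last_eq_zero
  · intro h
    have hl := h.wt_last
    have hlt := h.wt_lt
    have hz := h.last_eq_zero
    rw [← bounds_eq] at hl hlt
    rw [← n_fSeq] at hz
    refine ⟨h.le_x, h.x_le, fun k hk hk' => (h.level k hk hk').1,
      fun k hk hk' => (h.level k hk hk').2.sorted, fun k hk hk' => ?_, fun k hk hk' => ?_,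
      hl, hlt, fun k hk hk' => ?_, hz⟩
    · rw [n_zero, bounds_eq]
      exact (h.level k hk hk').2.le_bound
    · rw [w, bounds_eq]
      exact (h.level k hk hk').2.wt_le
    · rw [n_fSeq]
      exact pos_iff_ne_zero.2 (h.pos k hk hk')

/-- The factor of the summand that belongs to `n_{k,i}`, for possibly infinite bounds. -/
noncomputable def levelFactor (c : ℕ → ℕ) (u d : ℕ) (ν : List (List ℕ)) (k i : ℕ) : ℤ⟦X⟧ :=
  gaussE (n c u d ν k (i - 1))
    (w c u d ν k - ((∑ j ∈ Finset.Icc 1 (i - 1), part ν k j : ℕ) : ℕ∞)) (n c u d ν k i)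

theorem prod_range_succ_eq_prod_Icc {M : Type*} [CommMonoid M] (g : ℕ → M) (m : ℕ) :
    ∏ i ∈ Finset.range m, g (i + 1) = ∏ i ∈ Finset.Icc 1 m, g i := by
  induction m with
  | zero => rfl
  | succ m ih => rw [Finset.prod_range_succ, ih, Finset.prod_Icc_succ_top (by omega)]

theorem sum_range_succ_eq_sum_Icc (g : ℕ → ℕ) (m : ℕ) :
    ∑ i ∈ Finset.range m, g (i + 1) = ∑ i ∈ Finset.Icc 1 m, g i := by
  induction m with
  | zero => rfl
  | succ m ih => rw [Finset.sum_range_succ, ih, Finset.sum_Icc_succ_top (by omega)]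

theorem Icc_add_one_eq_Ioc (a b : ℕ) : Finset.Icc (a + 1) b = Finset.Ioc a b := by
  ext i
  rw [Finset.mem_Icc, Finset.mem_Ioc, Nat.succ_le_iff]

theorem prod_Icc_eq_mul {M : Type*} [CommMonoid M] (g : ℕ → M) {a b : ℕ} (h : a ≤ b) :
    ∏ i ∈ Finset.Icc a b, g i = g a * ∏ i ∈ Finset.Icc (a + 1) b, g i := by
  rw [← Finset.mul_prod_Ioc_eq_prod_Icc h, Icc_add_one_eq_Ioc]

theorem sum_Icc_one_add (g : ℕ → ℕ) {a b : ℕ} (h : a ≤ b) :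
    ∑ i ∈ Finset.Icc 1 a, g i + ∑ i ∈ Finset.Icc (a + 1) b, g i = ∑ i ∈ Finset.Icc 1 b, g i := by
  have h0 := Finset.sum_Ioc_consecutive g (Nat.zero_le a) h
  rwa [← Icc_add_one_eq_Ioc, ← Icc_add_one_eq_Ioc, ← Icc_add_one_eq_Ioc] at h0

theorem sum_take_eq (l : List ℕ) (i : ℕ) :
    (l.take i).sum = ∑ j ∈ Finset.range i, l.getD j 0 := by
  induction i generalizing l with
  | zero => simp
  | succ i ih =>
    cases l with
    | nil => simp
    | cons a l => rw [Finset.sum_range_succ', List.take_succ_cons, List.sum_cons, ih, add_comm]; rfl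

theorem sum_Icc_part (ν : List (List ℕ)) (k i : ℕ) :
    ∑ j ∈ Finset.Icc 1 i, part ν k j = ((nth ν k).take i).sum := by
  rw [sum_take_eq, ← sum_range_succ_eq_sum_Icc]
  rfl

theorem levelGauss_eq (k : ℕ) :
    levelGauss (bounds c u d ν k).2 (bounds c u d ν k).1 (nth ν k) =
      ∏ i ∈ Finset.Icc 1 (nth ν k).length, levelFactor c u d ν k i := by
  rw [levelGauss, ← prod_range_succ_eq_prod_Icc]
  refine Finset.prod_congr rfl fun i _ => ?_
  rw [levelFactor, Nat.add_sub_cancel, sum_Icc_part]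
  cases i <;> rfl

theorem levelExp_eq (e k : ℕ) : levelExp e (nth ν k) =
    ∑ i ∈ Finset.Icc 1 (nth ν k).length, (part ν k i * part ν k i - e * part ν k i) := by
  rw [levelExp, ← sum_range_succ_eq_sum_Icc]
  rfl

theorem getLastD_eq_getD (l : List ℕ) : l.getLastD 0 = l.getD (l.length - 1) 0 := by
  rw [List.getLastD_eq_getLast?, List.getLast?_eq_getElem?, List.getD_eq_getElem?_getD]

theorem seqTerm_eq (hu : 1 ≤ u) (h : Admissible t c u d ν) :
    seqTerm ⊤ ⊤ (fSeq c u d) u ν = X ^ expo c u d ν *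
      ∏ k ∈ Finset.Icc 1 ν.length, ∏ i ∈ Finset.Icc 1 (fSeq c u d k), levelFactor c u d ν k i := by
  have hfu : fSeq c u d u = d := by simp [fSeq]
  have hlast : (nth ν u).getLastD 0 = part ν u d := by
    rw [getLastD_eq_getD, h.length_eq u hu h.le_x, hfu]
    rfl
  have hterm : ∀ k ∈ Finset.Icc 1 ν.length, levelTerm ⊤ ⊤ (fSeq c u d) u ν k =
      X ^ levelExp (if k ≤ u then 0 else 1) (nth ν k) *
        ∏ i ∈ Finset.Icc 1 (fSeq c u d k), levelFactor c u d ν k i := by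
    intro k hk
    obtain ⟨hk1, hk2⟩ := Finset.mem_Icc.1 hk
    rw [levelTerm, ← bounds_eq, levelGauss_eq, h.length_eq k hk1 hk2]
  have hexp : expo c u d ν = part ν u d
      + ∑ k ∈ Finset.Icc 1 ν.length, levelExp (if k ≤ u then 0 else 1) (nth ν k) := by
    rw [expo, add_assoc, ← sum_Icc_one_add _ h.le_x]
    congr 2
    · refine Finset.sum_congr rfl fun k hk => ?_
      obtain ⟨hk1, hk2⟩ := Finset.mem_Icc.1 hk
      rw [levelExp_eq, if_pos hk2, h.length_eq k hk1 (hk2.trans h.le_x)]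
      refine Finset.sum_congr rfl fun i _ => ?_
      rw [zero_mul, tsub_zero, sq]
    · refine Finset.sum_congr rfl fun k hk => ?_
      obtain ⟨hk1, hk2⟩ := Finset.mem_Icc.1 hk
      rw [levelExp_eq, if_neg (by omega), h.length_eq k (by omega) hk2]
      refine Finset.sum_congr rfl fun i _ => ?_
      rw [one_mul, Nat.mul_sub, mul_one]
  rw [seqTerm, if_neg (by omega), hlast,
    prod_range_succ_eq_prod_Icc (levelTerm ⊤ ⊤ (fSeq c u d) u ν), Finset.prod_congr rfl hterm,
    Finset.prod_mul_distrib, Finset.prod_pow_eq_pow_sum, hexp, pow_add, mul_assoc]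

theorem qFacInvE_top : qFacInvE ⊤ = qFacInfInv := if_pos rfl

theorem qFacE_top : qFacE ⊤ = qFacInf := if_pos rfl

theorem qFacInvE_of_ne_top {x : ℕ∞} (h : x ≠ ⊤) : qFacInvE x = qFacInv x.toNat := if_neg h

theorem gaussE_eq_gauss {N M a : ℕ∞} (hN : N ≠ ⊤) (hM : M ≠ ⊤) (haN : a ≤ N) (haM : a ≤ M) :
    gaussE N M a = gauss (2 * (M - a) + N + a).toNat (N - a).toNat := by
  have ha : a ≠ ⊤ := ne_top_of_le_ne_top hN haN
  lift N to ℕ using hN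
  lift M to ℕ using hM
  lift a to ℕ using ha
  have h1 : a ≤ N := by exact_mod_cast haN
  have h2 : a ≤ M := by exact_mod_cast haM
  have h3 : 2 * ((M : ℕ∞) - a) + N + a = ((2 * M + N - a : ℕ) : ℕ∞) := by
    rw [show 2 * M + N - a = 2 * (M - a) + N + a by omega]
    push_cast
    rfl
  have h4 : (N : ℕ∞) - a = ((N - a : ℕ) : ℕ∞) := by push_cast; rfl
  rw [gaussE_coe h1, h3, h4, ENat.toNat_natCast, ENat.toNat_natCast]

theorem top_mul_two : 2 * (⊤ : ℕ∞) = ⊤ := ENat.mul_top (by norm_num)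

/-- For `M = ⊤` the numerator and `(q)_{2M}` are both `(q)_∞` and cancel. -/
theorem gaussE_top_right {N a : ℕ∞} (ha : a ≠ ⊤) : gaussE N ⊤ a = qFacInvE (N - a) := by
  lift a to ℕ using ha
  rw [gaussE, top_mul_two, top_add, ENat.top_sub_natCast, qFacE_top, qFacInvE_top, mul_right_comm,
    qFacInf_mul_qFacInfInv, one_mul]

theorem gaussE_top_left {M a : ℕ∞} (ha : a ≠ ⊤) : gaussE ⊤ M a = qFacInvE (2 * M) := by
  lift a to ℕ using ha
  rw [gaussE, add_top, ENat.top_sub_natCast, qFacE_top, qFacInvE_top, qFacInf_mul_qFacInfInv, one_mul]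

/-! ### Identification of the factors with those of the stated sum -/

theorem Admissible.n_le (h : Admissible t c u d ν) {k i : ℕ} (hk : 1 ≤ k) (hk' : k ≤ ν.length)
    (hi : 1 ≤ i) (hi' : i ≤ fSeq c u d k) : n c u d ν k i ≤ n c u d ν k (i - 1) := by
  obtain ⟨i, rfl⟩ := Nat.exists_eq_add_of_le' hi
  have hlen := h.length_eq k hk hk'
  rw [n_succ, part, Nat.add_sub_cancel, List.getD_eq_getElem _ _ (by omega)]
  cases i with
  | zero => exact h.le_bound k hk hk' _ (List.getElem_mem _)
  | succ i =>
    rw [n_succ, part, Nat.add_sub_cancel, List.getD_eq_getElem _ _ (by omega)]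
    exact_mod_cast List.pairwise_iff_getElem.1 (h.sorted k hk hk') i (i + 1) (by omega) (by omega)
      (by omega)

theorem Admissible.add_n_le (h : Admissible t c u d ν) {k i : ℕ} (hk : 1 ≤ k)
    (hk' : k ≤ ν.length) (hi : 1 ≤ i) :
    ((∑ j ∈ Finset.Icc 1 (i - 1), part ν k j : ℕ) : ℕ∞) + n c u d ν k i ≤ w c u d ν k := by
  obtain ⟨i, rfl⟩ := Nat.exists_eq_add_of_le' hi
  rw [n_succ, ← Nat.cast_add, Nat.add_sub_cancel, ← Finset.sum_Icc_succ_top (by omega),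
    sum_Icc_part]
  refine le_trans ?_ (h.wt_le k hk hk')
  exact_mod_cast (List.take_sublist _ _).sum_le_sum (by simp)

theorem levelFactor_eq_gaussFactor (h : Admissible t c u d ν) {k i : ℕ} (hk : 1 ≤ k)
    (hk' : k ≤ ν.length) (hi : 1 ≤ i) (hi' : i ≤ fSeq c u d k) (hw : w c u d ν k ≠ ⊤)
    (hn : n c u d ν k (i - 1) ≠ ⊤) : levelFactor c u d ν k i = gaussFactor c u d ν k i := by
  have hle := h.add_n_le hk hk' hi
  rw [levelFactor, gaussE_eq_gauss hn (ne_top_of_le_ne_top hw tsub_le_self)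
    (h.n_le hk hk' hi hi') (ENat.le_sub_of_add_le_left (ENat.natCast_ne_top _) hle), gaussFactor]
  obtain ⟨i, rfl⟩ := Nat.exists_eq_add_of_le' hi
  rw [Finset.sum_Icc_succ_top (show 1 ≤ i + 1 by omega), Nat.cast_add, tsub_add_eq_tsub_tsub]
  rfl

theorem levelFactor_eq_diffFactor {k i : ℕ} (hi : 1 ≤ i) (hw : w c u d ν k = ⊤)
    (hn : n c u d ν k (i - 1) ≠ ⊤) : levelFactor c u d ν k i = diffFactor c u d ν k i := by
  rw [levelFactor, hw, ENat.top_sub_natCast, gaussE_top_right (n_ne_top hi),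
    qFacInvE_of_ne_top (ne_top_of_le_ne_top hn tsub_le_self)]
  rfl

theorem levelFactor_one_eq_qFacInv {k : ℕ} (hw : w c u d ν k ≠ ⊤) (hn : n c u d ν k 0 = ⊤) :
    levelFactor c u d ν k 1 = qFacInv (2 * w c u d ν k).toNat := by
  rw [levelFactor, Nat.sub_self, hn, gaussE_top_left (n_ne_top le_rfl),
    Finset.Icc_eq_empty (by norm_num), Finset.sum_empty, Nat.cast_zero, tsub_zero,
    qFacInvE_of_ne_top (x := 2 * w c u d ν k)]
  exact fun h => (WithTop.mul_ne_top (ENat.natCast_ne_top 2) hw) h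

/-- Both bounds are infinite here, and only here; this is the origin of the prefactor `1 / (q)_∞`.
-/
theorem levelFactor_one_one : levelFactor c u d ν 1 1 = qFacInfInv := by
  have hw : w c u d ν 1 = ⊤ := rfl
  have hn : n c u d ν 1 0 = ⊤ := rfl
  rw [levelFactor, hw, ENat.top_sub_natCast, gaussE_top_right (n_ne_top le_rfl), Nat.sub_self, hn]
  obtain ⟨a, ha⟩ := ENat.ne_top_iff_exists.1 (n_ne_top (c := c) (u := u) (d := d) (ν := ν)
    (k := 1) (le_refl 1))
  rw [← ha, ENat.top_sub_natCast, qFacInvE_top]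

theorem n_fSeq_ne_top {k : ℕ} (h : 1 ≤ fSeq c u d k ∨ n c u d ν k 0 ≠ ⊤) :
    n c u d ν k (fSeq c u d k) ≠ ⊤ := by
  rcases Nat.eq_zero_or_pos (fSeq c u d k) with h0 | h0
  · rw [h0]
    exact h.resolve_left (by omega)
  · exact n_ne_top h0

theorem bounds_ne_top {k : ℕ} (hk : 1 ≤ k) (hw : w c u d ν k ≠ ⊤)
    (hn : 1 ≤ fSeq c u d k ∨ n c u d ν k 0 ≠ ⊤) :
    w c u d ν (k + 1) ≠ ⊤ ∧ n c u d ν (k + 1) 0 ≠ ⊤ := by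
  obtain ⟨k, rfl⟩ := Nat.exists_eq_add_of_le' hk
  have hl := n_fSeq_ne_top hn
  rw [n_zero, w, bounds_succ_succ]
  have h1 := WithTop.add_ne_top.2 ⟨hw, ENat.one_ne_top⟩
  have h2 := WithTop.add_ne_top.2 ⟨hl, ENat.one_ne_top⟩
  split_ifs
  · exact ⟨hl, ne_top_of_le_ne_top hw tsub_le_self⟩
  · exact ⟨ne_top_of_le_ne_top hw (tsub_le_self.trans tsub_le_self), h2⟩
  · exact ⟨ne_top_of_le_ne_top hl tsub_le_self, ne_top_of_le_ne_top h1 tsub_le_self⟩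

theorem bounds_ne_top_of_le {k₀ : ℕ} (h₀ : 1 ≤ k₀)
    (h : w c u d ν k₀ ≠ ⊤ ∧ n c u d ν k₀ 0 ≠ ⊤) {k : ℕ} (hk : k₀ ≤ k) :
    w c u d ν k ≠ ⊤ ∧ n c u d ν k 0 ≠ ⊤ := by
  induction k, hk using Nat.le_induction with
  | base => exact h
  | succ k hk ih => exact bounds_ne_top (h₀.trans hk) ih.1 (Or.inr ih.2)

theorem n_pred_ne_top {k i : ℕ} (h : n c u d ν k 0 ≠ ⊤ ∨ 2 ≤ i) : n c u d ν k (i - 1) ≠ ⊤ := by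
  rcases Nat.lt_or_ge i 2 with hi | hi
  · rw [show i - 1 = 0 by omega]
    exact h.resolve_right (by omega)
  · exact n_ne_top (by omega)

/-- For `u > 1` the bounds `w_1`, `n_{1,0}` and `n_{2,0}` are infinite and all others finite.
Finiteness of `w_2` and of the third pair of bounds needs `f_1` and `f_2` to be positive. -/
theorem seqTerm_eq_termGt (hu : 2 ≤ u) (h : Admissible t c u d ν) (hf₁ : 1 ≤ fSeq c u d 1)
    (hf₂ : 1 ≤ fSeq c u d 2) :
    seqTerm ⊤ ⊤ (fSeq c u d) u ν = qFacInfInv * termGt c u d ν := by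
  have hx := h.le_x
  have hb₂ : bounds c u d ν 2 = (n c u d ν 1 (fSeq c u d 1), ⊤) := by
    rw [bounds_succ_succ, if_pos (by omega)]
    rfl
  have hw₂ : w c u d ν 2 = n c u d ν 1 (fSeq c u d 1) := by rw [w, hb₂]
  have hn₂ : n c u d ν 2 0 = ⊤ := by rw [n_zero, hb₂]
  have hw₂' : w c u d ν 2 ≠ ⊤ := hw₂ ▸ n_ne_top hf₁
  have h₃ := bounds_ne_top (by norm_num) hw₂' (Or.inl hf₂)
  have h1 : ∏ i ∈ Finset.Icc 1 (fSeq c u d 1), levelFactor c u d ν 1 i =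
      qFacInfInv * ∏ i ∈ Finset.Icc 2 (fSeq c u d 1), diffFactor c u d ν 1 i := by
    rw [prod_Icc_eq_mul _ hf₁, levelFactor_one_one]
    congr 1
    refine Finset.prod_congr rfl fun i hi => ?_
    have hi := (Finset.mem_Icc.1 hi).1
    exact levelFactor_eq_diffFactor (by omega) rfl (n_pred_ne_top (Or.inr hi))
  have h2 : ∏ i ∈ Finset.Icc 1 (fSeq c u d 2), levelFactor c u d ν 2 i =
      qFacInv (2 * n c u d ν 1 (fSeq c u d 1)).toNat *
        ∏ i ∈ Finset.Icc 2 (fSeq c u d 2), gaussFactor c u d ν 2 i := by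
    rw [prod_Icc_eq_mul _ hf₂, levelFactor_one_eq_qFacInv hw₂' hn₂, hw₂]
    congr 1
    refine Finset.prod_congr rfl fun i hi => ?_
    obtain ⟨hi, hi'⟩ := Finset.mem_Icc.1 hi
    exact levelFactor_eq_gaussFactor h (by norm_num) (by omega) (by omega) hi' hw₂'
      (n_pred_ne_top (Or.inr hi))
  have h3 : ∏ k ∈ Finset.Icc 3 ν.length, ∏ i ∈ Finset.Icc 1 (fSeq c u d k),
      levelFactor c u d ν k i = ∏ k ∈ Finset.Icc 3 ν.length,
        ∏ i ∈ Finset.Icc (1 + if k = 2 then 1 else 0) (fSeq c u d k), gaussFactor c u d ν k i := by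
    refine Finset.prod_congr rfl fun k hk => ?_
    obtain ⟨hk, hk'⟩ := Finset.mem_Icc.1 hk
    rw [if_neg (by omega), add_zero]
    refine Finset.prod_congr rfl fun i hi => ?_
    obtain ⟨hi, hi'⟩ := Finset.mem_Icc.1 hi
    have hb := bounds_ne_top_of_le (by norm_num) h₃ hk
    exact levelFactor_eq_gaussFactor h (by omega) hk' hi hi' hb.1 (n_pred_ne_top (Or.inl hb.2))
  rw [seqTerm_eq (by omega) h, prod_Icc_eq_mul _ (show 1 ≤ ν.length by omega),
    prod_Icc_eq_mul _ (show 1 + 1 ≤ ν.length by omega), h1, h2, h3, termGt, prod_Icc_eq_mul _ (show 2 ≤ ν.length by omega), if_pos rfl]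
  ring

/-- For `u = 1` the removal step exchanges no roles, so `w_2` stays infinite while `n_{2,0}` is
finite; the single infinite bound among `w_3`, `n_{3,0}` is the latter. -/
theorem seqTerm_eq_termOne (hd : 1 ≤ d) (h : Admissible t c 1 d ν)
    (hf₃ : ν.length ≤ 3 ∨ 1 ≤ fSeq c 1 d 3) :
    seqTerm ⊤ ⊤ (fSeq c 1 d) 1 ν = qFacInfInv * termOne c d ν := by
  have hf₁ : 1 ≤ fSeq c 1 d 1 := by simpa [fSeq] using hd
  have hb₂ : bounds c 1 d ν 2 = (⊤, n c 1 d ν 1 (fSeq c 1 d 1) + 1) := by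
    rw [bounds_succ_succ, if_neg (by omega), if_pos (by omega)]
    rfl
  have hw₂ : w c 1 d ν 2 = ⊤ := by rw [w, hb₂]
  have hn₂ : n c 1 d ν 2 0 ≠ ⊤ := by
    rw [n_zero, hb₂]
    exact WithTop.add_ne_top.2 ⟨n_ne_top hf₁, ENat.one_ne_top⟩
  -- The last weight must equal `w_x`, which is infinite for `x = 1, 2`.
  have hx : 3 ≤ ν.length := by
    by_contra hx
    have hl := h.wt_last
    have hx1 := h.le_x
    have : ν.length = 1 ∨ ν.length = 2 := by omega
    rcases this with h0 | h0
    · rw [h0] at hl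
      exact ENat.natCast_ne_top _ hl
    · rw [h0, hw₂] at hl
      exact ENat.natCast_ne_top _ hl
  have hb₃ : bounds c 1 d ν 3 = (n c 1 d ν 2 (fSeq c 1 d 2) - 1, ⊤) := by
    rw [bounds_succ_succ, if_neg (by omega), if_neg (by omega), hw₂]
    rfl
  have hw₃ : w c 1 d ν 3 = n c 1 d ν 2 (fSeq c 1 d 2) - 1 := by rw [w, hb₃]
  have hn₃ : n c 1 d ν 3 0 = ⊤ := by rw [n_zero, hb₃]
  have hw₃' : w c 1 d ν 3 ≠ ⊤ :=
    hw₃ ▸ ne_top_of_le_ne_top (n_fSeq_ne_top (Or.inr hn₂)) tsub_le_self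
  have h1 : ∏ i ∈ Finset.Icc 1 (fSeq c 1 d 1), levelFactor c 1 d ν 1 i =
      qFacInfInv * ∏ i ∈ Finset.Icc 2 (fSeq c 1 d 1), diffFactor c 1 d ν 1 i := by
    rw [prod_Icc_eq_mul _ hf₁, levelFactor_one_one]
    congr 1
    refine Finset.prod_congr rfl fun i hi => ?_
    have hi := (Finset.mem_Icc.1 hi).1
    exact levelFactor_eq_diffFactor (by omega) rfl (n_pred_ne_top (Or.inr hi))
  have h2 : ∏ i ∈ Finset.Icc 1 (fSeq c 1 d 2), levelFactor c 1 d ν 2 i =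
      ∏ i ∈ Finset.Icc 1 (fSeq c 1 d 2), diffFactor c 1 d ν 2 i := by
    refine Finset.prod_congr rfl fun i hi => ?_
    have hi := (Finset.mem_Icc.1 hi).1
    exact levelFactor_eq_diffFactor (by omega) hw₂ (n_pred_ne_top (Or.inl hn₂))
  have h3 : ∏ i ∈ Finset.Icc 1 (fSeq c 1 d 3), levelFactor c 1 d ν 3 i =
      qFacInv (2 * (n c 1 d ν 2 (fSeq c 1 d 2) - 1)).toNat *
        ∏ i ∈ Finset.Icc 2 (fSeq c 1 d 3), gaussFactor c 1 d ν 3 i := by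
    rcases Nat.eq_zero_or_pos (fSeq c 1 d 3) with h0 | h0
    -- An empty third partition is then the last one, so `w_3 = 0` and the factor `1 / (q)_{2 w_3}`
    -- is `1`.
    · have hx3 : ν.length = 3 := le_antisymm (hf₃.resolve_right (by omega)) hx
      have hl := h.wt_last
      have hlen := h.length_eq 3 (by norm_num) hx
      rw [h0, List.length_eq_zero_iff] at hlen
      rw [hx3, hlen, hw₃] at hl
      rw [h0, ← hl, Finset.Icc_eq_empty (by norm_num), Finset.Icc_eq_empty (by norm_num)]
      simpa [qFac] using (qFac_mul_qFacInv 0).symm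
    · rw [prod_Icc_eq_mul _ h0, levelFactor_one_eq_qFacInv hw₃' hn₃, hw₃]
      congr 1
      refine Finset.prod_congr rfl fun i hi => ?_
      obtain ⟨hi, hi'⟩ := Finset.mem_Icc.1 hi
      exact levelFactor_eq_gaussFactor h (by norm_num) hx (by omega) hi' hw₃'
        (n_pred_ne_top (Or.inr hi))
  have h4 : ∏ k ∈ Finset.Icc 4 ν.length, ∏ i ∈ Finset.Icc 1 (fSeq c 1 d k),
      levelFactor c 1 d ν k i = ∏ k ∈ Finset.Icc 4 ν.length,
        ∏ i ∈ Finset.Icc (1 + if k = 3 then 1 else 0) (fSeq c 1 d k), gaussFactor c 1 d ν k i := by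
    refine Finset.prod_congr rfl fun k hk => ?_
    obtain ⟨hk, hk'⟩ := Finset.mem_Icc.1 hk
    rw [if_neg (by omega), add_zero]
    refine Finset.prod_congr rfl fun i hi => ?_
    obtain ⟨hi, hi'⟩ := Finset.mem_Icc.1 hi
    have hb := bounds_ne_top_of_le (by norm_num)
      (bounds_ne_top (by norm_num) hw₃' (Or.inl (hf₃.resolve_left (by omega)))) hk
    exact levelFactor_eq_gaussFactor h (by omega) hk' hi hi' hb.1 (n_pred_ne_top (Or.inl hb.2))
  rw [seqTerm_eq le_rfl h, prod_Icc_eq_mul _ (show 1 ≤ ν.length by omega),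
    prod_Icc_eq_mul _ (show 1 + 1 ≤ ν.length by omega),
    prod_Icc_eq_mul _ (show 1 + 1 + 1 ≤ ν.length by omega), h1, h2, h3, h4, termOne, prod_Icc_eq_mul _ hx, if_pos rfl]
  ring

end Summands

/-! ### Continued fractions -/

/-- The pair `(s : r)` with a given continued fraction. -/
def fracPair : List ℕ → ℕ × ℕ
  | [] => (1, 0)
  | c :: l => (c * (fracPair l).1 + (fracPair l).2, (fracPair l).1)

theorem fracPair_contFrac (s r : ℕ) (hs : 0 < s) (h : Nat.Coprime s r) :
    fracPair (contFrac s r) = (s, r) := by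
  induction r using Nat.strong_induction_on generalizing s with
  | _ r ih =>
    rw [contFrac]
    split_ifs with hr
    · subst hr
      rw [Nat.coprime_zero_right] at h
      rw [h]
      rfl
    · have hr0 := Nat.pos_of_ne_zero hr
      rw [fracPair, ih (s % r) (Nat.mod_lt _ hr0) r hr0
        (by rw [Nat.Coprime, Nat.gcd_comm, ← Nat.gcd_rec, Nat.gcd_comm]; exact h)]
      simp only [Prod.mk.injEq, and_true]
      rw [mul_comm]
      exact Nat.div_add_mod s r

theorem fracPair_append_one (l : List ℕ) (c : ℕ) :
    fracPair (l ++ [c, 1]) = fracPair (l ++ [c + 1]) := by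
  induction l with
  | nil => simp [fracPair]
  | cons a l ih => rw [List.cons_append, List.cons_append, fracPair, fracPair, ih]

theorem IsContFrac.fracPair_eq {l : List ℕ} {s r : ℕ} (h : IsContFrac l s r) :
    fracPair l = (s, r) := by
  obtain ⟨hs, hsr, rfl | ⟨l', c, rfl, hl⟩⟩ := h
  · exact fracPair_contFrac s r hs hsr
  · rw [fracPair_append_one, ← hl]
    exact fracPair_contFrac s r hs hsr

theorem pos_of_mem_contFrac {s r : ℕ} (h : r ≤ s) {a : ℕ} (ha : a ∈ contFrac s r) : 0 < a := by
  induction r using Nat.strong_induction_on generalizing s with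
  | _ r ih =>
    rw [contFrac] at ha
    split_ifs at ha with hr
    · simp at ha
    · have hr0 := Nat.pos_of_ne_zero hr
      rcases List.mem_cons.1 ha with rfl | ha
      · exact Nat.div_pos h hr0
      · exact ih _ (Nat.mod_lt _ hr0) (Nat.mod_lt _ hr0).le ha

theorem IsContFrac.pos_of_mem {l : List ℕ} {c s r : ℕ} (h : IsContFrac (l ++ [c + 2]) s r)
    (hrs : r ≤ s) {a : ℕ} (ha : a ∈ l) : 0 < a := by
  obtain ⟨-, -, h | ⟨l', c', h, -⟩⟩ := h
  · exact pos_of_mem_contFrac hrs (h ▸ List.mem_append_left _ ha)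
  -- A list ending in `c + 2` cannot be the alternative form, which ends in `1`; so it is the
  -- Euclidean expansion, whose quotients are positive.
  · have := congrArg List.getLast? h
    simp at this

theorem bumpFrac_append (l : List ℕ) (c : ℕ) : bumpFrac (l ++ [c]) = fracPair (l ++ [c + 2]) := by
  induction l with
  | nil => simp [bumpFrac, fracPair]
  | cons a l ih =>
    rw [List.cons_append, List.cons_append, fracPair, ← ih]
    cases l <;> rfl

/-- The parameters obey the recursion of the continuants: `(α, a)` follows the fraction truncated at
`d`, and `(α + β, a + b)` the full one, whose `u`-th quotient splits as `d` plus the first entry of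
the rest. Hence they are `(r, p - r, s, p' - s)`. -/
theorem quad_spec {d : ℕ} {gs hs : List ℕ} {g : ℕ} (h : bumpFrac gs = fracPair (g :: hs))
    (hpos : 0 < (bumpFrac gs).2) (l : List ℕ) :
    fracPair (l ++ [d]) = ((quad d gs l).2.2.1, (quad d gs l).1) ∧
      fracPair (l ++ (g + d) :: hs) = ((quad d gs l).2.2.1 + (quad d gs l).2.2.2,
        (quad d gs l).1 + (quad d gs l).2.1) := by
  induction l with
  | nil =>
    rw [h] at hpos
    rw [quad, h]
    simp only [fracPair] at hpos ⊢
    obtain ⟨x, hx⟩ := Nat.exists_eq_add_of_le' (Nat.succ_le_of_lt hpos)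
    simp only [List.nil_append, fracPair, hx, Prod.mk.injEq, Nat.succ_eq_add_one,
      Nat.add_sub_cancel]
    refine ⟨⟨by ring, trivial⟩, by ring, by ring⟩
  | cons c l ih =>
    rw [List.cons_append, List.cons_append, fracPair, fracPair, ih.1, ih.2, quad]
    simp only [Prod.mk.injEq, and_true]
    refine ⟨by ring, by ring⟩

/-! ### The list of the lengths `f_1, …, f_{t+1}` -/

theorem lengths_eq_map (T : ℕ) (f : ℕ → ℕ) : lengths f T = (List.range' 1 T).map f := by
  induction T generalizing f with
  | zero => rfl
  | succ T ih =>
    rw [lengths, ih, List.range'_succ, List.map_cons, List.range'_succ_left (s := 1), List.map_map]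
    rfl

theorem lengths_fSeq {t u d : ℕ} (c : ℕ → ℕ) (hu : 1 ≤ u) (hut : u ≤ t) :
    lengths (fSeq c u d) (t + 1) = (List.range' 1 (u - 1)).map c ++
      d :: (c u - d) :: (List.range' (u + 1) (t - u)).map c := by
  obtain ⟨v, rfl⟩ := Nat.exists_eq_add_of_le' hu
  obtain ⟨m, rfl⟩ := Nat.exists_eq_add_of_le hut
  have h1 : List.range' 1 (v + 1 + m + 1)
      = List.range' 1 v ++ (v + 1) :: (v + 2) :: List.range' (v + 3) m := by
    have h : (v + 1) :: (v + 2) :: List.range' (v + 3) m = List.range' (1 + v) (m + 2) := by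
      rw [List.range'_succ, List.range'_succ, add_comm 1 v]
    rw [h, List.range'_append_1]
    congr 1
    ring
  have h2 : List.range' (v + 3) m = (List.range' (v + 1 + 1) m).map (· + 1) := by
    rw [List.range'_succ_left]
  rw [lengths_eq_map, h1, List.map_append, List.map_cons, List.map_cons, h2, List.map_map,
    Nat.add_sub_cancel, Nat.add_sub_cancel_left]
  congr 1
  · refine List.map_congr_left fun k hk => ?_
    have := (List.mem_range'_1.1 hk).2
    rw [fSeq, if_pos (by omega)]
  · congr 1
    · simp [fSeq]
    congr 1
    · simp [fSeq]
    · refine List.map_congr_left fun k hk => ?_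
      have := (List.mem_range'_1.1 hk).1
      simp only [Function.comp, fSeq]
      rw [if_neg (by omega), if_neg (by omega), if_neg (by omega), Nat.add_sub_cancel]

theorem headPos_map_range' {f : ℕ → ℕ} {a m : ℕ} (h : 2 ≤ m → 0 < f a) :
    HeadPos ((List.range' a m).map f) := by
  match m with
  | 0 => trivial
  | 1 => trivial
  | m + 2 => exact h (by omega)

/-! ### The limit -/

theorem hasDoubleLimit_R {p p' : ℕ} (hpp' : p < p') {t : ℕ} {c : ℕ → ℕ}
    (hc : IsContFrac ((List.range' 1 (t - 1)).map c ++ [c t + 2]) p' p)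
    {u d : ℕ} (hu : 1 ≤ u) (hut : u ≤ t) (hd : 1 ≤ d) (hdc : d ≤ c u) {r s : ℕ}
    (hrs : IsContFrac ((List.range' 1 (u - 1)).map c ++ [d]) s r) :
    (∀ k, 1 ≤ k → k < t → 0 < c k) ∧
    ∃ L, HasSum (fun ν => seqWeight u (lengths (fSeq c u d) (t + 1)) ⊤ ⊤ ν) L ∧
      HasDoubleLimit (fun N M => (R N M r (p - r) s (p' - s) : ℤ⟦X⟧)) L := by
  have hpos : ∀ k, 1 ≤ k → k < t → 0 < c k := fun k hk hkt =>
    hc.pos_of_mem hpp'.le (List.mem_map.2 ⟨k, List.mem_range'_1.2 ⟨hk, by omega⟩, rfl⟩)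
  refine ⟨hpos, ?_⟩
  set l := (List.range' 1 (u - 1)).map c with hl
  set gs := (c u - d) :: (List.range' (u + 1) (t - u)).map c with hgs
  have hlen : lengths (fSeq c u d) (t + 1) = l ++ d :: gs := lengths_fSeq c hu hut
  have hlu : l.length + 1 = u := by
    rw [hl, List.length_map, List.length_range']
    omega
  -- The final quotient carries the extra `2`. For `u = t` it is the split quotient itself, so the
  -- `2` goes to `g`; otherwise it stays at the end of `hs`.
  have hbump : ∃ g hs, bumpFrac gs = fracPair (g :: hs) ∧
      (List.range' 1 (t - 1)).map c ++ [c t + 2] = l ++ (g + d) :: hs := by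
    rcases hut.eq_or_lt with rfl | hut'
    · refine ⟨c u - d + 2, [], ?_, ?_⟩
      · rw [hgs, Nat.sub_self]
        exact bumpFrac_append [] (c u - d)
      · rw [hl]
        congr 2
        omega
    · refine ⟨c u - d, (List.range' (u + 1) (t - u - 1)).map c ++ [c t + 2], ?_, ?_⟩
      · rw [← List.cons_append, ← bumpFrac_append, hgs, List.cons_append]
        congr 2
        obtain ⟨m, hm⟩ := Nat.exists_eq_add_of_lt hut'
        rw [show t - u = m + 1 by omega, Nat.add_sub_cancel, List.range'_1_concat, List.map_append,
          show u + 1 + m = t by omega]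
        rfl
      · rw [hl, Nat.sub_add_cancel hdc, ← List.cons_append, ← List.append_assoc]
        congr 1
        rw [← List.map_cons, ← List.range'_succ, ← List.map_append]
        congr 1
        obtain ⟨v, rfl⟩ := Nat.exists_eq_add_of_le' hu
        rw [Nat.add_sub_cancel, add_comm v 1, List.range'_append_1]
        congr 1
        omega
  obtain ⟨g, hs, h1, h2⟩ := hbump
  obtain ⟨h3, h4⟩ := quad_spec (d := d) h1 (bumpFrac_pos gs).2 l
  rw [hrs.fracPair_eq] at h3
  rw [← h2, hc.fracPair_eq] at h4
  rw [Prod.mk.injEq] at h3 h4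
  have hR : ∀ N M, (R N M r (p - r) s (p' - s) : ℤ⟦X⟧) = pairR N M (quad d gs l).1
      (quad d gs l).2.1 (quad d gs l).2.2.1 (quad d gs l).2.2.2 := by
    intro N M
    rw [coe_R]
    congr 1 <;> omega
  have hf₁ : HeadPos (lengths (fSeq c u d) (t + 1)) := by
    rw [lengths_eq_map]
    refine headPos_map_range' fun _ => ?_
    rcases hu.eq_or_lt with rfl | hu'
    · simpa [fSeq] using Nat.succ_le_iff.1 hd
    · rw [fSeq, if_pos hu']
      exact hpos 1 le_rfl (by omega)
  have hf₂ : if l = [] then HeadPos gs.tail else HeadPos (l ++ d :: gs).tail := by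
    split_ifs with hl0
    · refine headPos_map_range' fun _ => hpos _ (by omega) (by omega)
    · have hu' : 2 ≤ u := by
        have := List.length_pos_iff.2 hl0
        omega
      rw [← hlen, lengths_eq_map, List.range'_succ, List.map_cons, List.tail_cons]
      refine headPos_map_range' fun _ => ?_
      rcases hu'.eq_or_lt with rfl | hu''
      · simpa [fSeq] using Nat.succ_le_iff.1 hd
      · rw [fSeq, if_pos hu'']
        exact hpos 2 (by omega) (by omega)
  rw [hlen] at hf₁ ⊢
  have := hasDoubleLimit_pairR hd (by simp [hgs]) hf₁ hf₂
  rw [hlu] at this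
  simpa only [hR] using this

/-- Multiplication by the unit `(q)_∞` transfers summability to the family without the prefactor. -/
theorem summable_and_eq_of_hasSum {ι : Type*} {P : ι → Prop} {F T : ι → ℤ⟦X⟧} {L : ℤ⟦X⟧}
    (h : HasSum F L) (h0 : ∀ i, ¬P i → F i = 0) (h1 : ∀ i, P i → F i = qFacInfInv * T i) :
    Summable (fun i : {i // P i} => T i) ∧ L = qFacInfInv * ∑' i : {i // P i}, T i := by
  have h2 : HasSum (fun i : {i // P i} => F i) L := by
    have hF : {i | P i}.indicator F = F := by
      refine Set.indicator_eq_self.2 fun i hi => ?_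
      by_contra hP
      exact hi (h0 i hP)
    exact hasSum_subtype_iff_indicator.2 (hF.symm ▸ h)
  have h3 : HasSum (fun i : {i // P i} => T i) (qFacInf * L) := by
    have h4 := h2.mul_left qFacInf
    refine h4.congr_fun ?_
    intro i
    rw [h1 i i.2, ← mul_assoc, qFacInf_mul_qFacInfInv, one_mul]
  refine ⟨h3.summable, ?_⟩
  rw [h3.tsum_eq, ← mul_assoc, mul_comm qFacInfInv, qFacInf_mul_qFacInfInv, one_mul]

end Burge

theorem mainTheorem11
    (p p' : ℕ) (hp : 0 < p) (hpp' : p < p') (hcop : Nat.Coprime p' p)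
    (t : ℕ) (ht : 1 ≤ t) (c : ℕ → ℕ)
    (hc : Burge.IsContFrac ((List.range' 1 (t - 1)).map c ++ [c t + 2]) p' p)
    (u d : ℕ) (hu : 1 ≤ u) (hut : u ≤ t) (hd : 1 ≤ d) (hdc : d ≤ c u)
    (r s : ℕ)
    (hrs : Burge.IsContFrac ((List.range' 1 (u - 1)).map c ++ [d]) s r) :
    (1 < u →
      Summable (fun ν : {ν : List (List ℕ) // Burge.Admissible t c u d ν} =>
        Burge.termGt c u d ν) ∧
      Burge.HasDoubleLimit
        (fun N M => (Burge.R N M r (p - r) s (p' - s) : PowerSeries ℤ))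
        (Burge.qFacInfInv *
          ∑' ν : {ν : List (List ℕ) // Burge.Admissible t c u d ν}, Burge.termGt c u d ν)) ∧
    (u = 1 →
      Summable (fun ν : {ν : List (List ℕ) // Burge.Admissible t c u d ν} =>
        Burge.termOne c d ν) ∧
      Burge.HasDoubleLimit
        (fun N M => (Burge.R N M r (p - r) s (p' - s) : PowerSeries ℤ))
        (Burge.qFacInfInv *
          ∑' ν : {ν : List (List ℕ) // Burge.Admissible t c u d ν}, Burge.termOne c d ν)) := by
  obtain ⟨hpos, L, hL, hlim⟩ := Burge.hasDoubleLimit_R hpp' hc hu hut hd hdc hrs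
  have hF : ∀ ν, Burge.seqWeight u (Burge.lengths (Burge.fSeq c u d) (t + 1)) ⊤ ⊤ ν = _ :=
    fun ν => Burge.seqWeight_eq (t + 1) _ u ⊤ ⊤ ν (Or.inr (by omega))
  have h0 : ∀ ν, ¬Burge.Admissible t c u d ν →
      Burge.seqWeight u (Burge.lengths (Burge.fSeq c u d) (t + 1)) ⊤ ⊤ ν = 0 := by
    intro ν hν
    rw [hF, if_neg fun h => hν ((Burge.admissible_iff hu).2 h)]
  refine ⟨fun hu1 => ?_, ?_⟩
  · have h1 : ∀ ν, Burge.Admissible t c u d ν →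
        Burge.seqWeight u (Burge.lengths (Burge.fSeq c u d) (t + 1)) ⊤ ⊤ ν =
          Burge.qFacInfInv * Burge.termGt c u d ν := by
      intro ν hν
      rw [hF, if_pos ((Burge.admissible_iff hu).1 hν)]
      refine Burge.seqTerm_eq_termGt hu1 hν ?_ ?_
      · rw [Burge.fSeq, if_pos hu1]
        exact hpos 1 le_rfl (by omega)
      · rcases (show 2 ≤ u from hu1).eq_or_lt with rfl | hu2
        · simpa [Burge.fSeq] using hd
        · rw [Burge.fSeq, if_pos hu2]
          exact hpos 2 (by omega) (by omega)
    obtain ⟨hs, rfl⟩ := Burge.summable_and_eq_of_hasSum hL h0 h1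
    exact ⟨hs, hlim⟩
  · rintro rfl
    have h1 : ∀ ν, Burge.Admissible t c 1 d ν →
        Burge.seqWeight 1 (Burge.lengths (Burge.fSeq c 1 d) (t + 1)) ⊤ ⊤ ν =
          Burge.qFacInfInv * Burge.termOne c d ν := by
      intro ν hν
      rw [hF, if_pos ((Burge.admissible_iff hu).1 hν)]
      refine Burge.seqTerm_eq_termOne hd hν ?_
      -- Here `f_3 = c_2`, which is known to be positive only if `2 < t`; for smaller `t` there are
      -- at most three partitions.
      rcases Nat.lt_or_ge t 3 with ht3 | ht3
      · exact Or.inl (hν.x_le.trans (by omega))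
      · exact Or.inr (hpos 2 (by omega) (by omega))
    obtain ⟨hs, rfl⟩ := Burge.summable_and_eq_of_hasSum hL h0 h1
    exact ⟨hs, hlim⟩
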